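/- Let $\mathbb K=\mathbb R$ or $\mathbb K=\mathbb C$; read "smooth" as $C^\infty$ if $\mathbb K=\mathbb R$ and as holomorphic if $\mathbb K=\mathbb C$. Let $G$ be a (finite-dimensional) Lie group over $\mathbb K$, let $P\subseteq G$ be a closed Lie subgroup over $\mathbb K$, let $\mathfrak g,\mathfrak p$ be the Lie algebras and $\mathfrak U(\mathfrak g),\mathfrak U(\mathfrak p)$ their universal enveloping algebras over $\mathbb K$, and let $(\lambda,\mathbb V)$, $(\nu,\mathbb W)$, $(\rho,\mathbb E)$ be finite-dimensional smooth representations of $P$ over $\mathbb K$, inducing homogeneous vector bundles $V,W,E$ on $G/P$. For an open set $O\subseteq G/P$ with preimage $\tilde O\subseteq G$, the sections $\Gamma(O,V)$ are the smooth functions $\varphi:\tilde O\to\mathbb V$ with $\varphi(gp)=\lambda(p)^{-1}\varphi(g)$ for all $g\in\tilde O$, $p\in P$ (similarly for $W$, $E$), and $G$ acts on local sections by $(l_g\varphi)(h)=\varphi(g^{-1}h)$, which maps sections over $O$ to sections over $gO$. A bilinear differential pairing is a family of bilinear maps $B_O:\Gamma(O,V)\times\Gamma(O,W)\to\Gamma(O,E)$,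 $O\subseteq G/P$ open, compatible with restriction to smaller open sets, and such that in each coordinate system of $G/P$ with a local trivialization of $G\to G/P$ it has the form $B(\varphi,\psi)(x)=\sum_{\alpha,\beta}a_{\alpha\beta}(x)\bigl(\partial^\alpha\varphi(x)\otimes\partial^\beta\psi(x)\bigr)$, a finite sum with smooth coefficients $a_{\alpha\beta}$ in $\mathrm{Hom}(\mathbb V\otimes\mathbb W,\mathbb E)$; it is $G$-invariant if $B_{gO}(l_g\varphi,l_g\psi)=l_gB_O(\varphi,\psi)$ for all $g\in G$, all $O$, $\varphi$ and $\psi$. Let $u\mapsto u^0$ be the antiautomorphism of the enveloping algebra with $X^0=-X$ for $X$ in the Lie algebra. Regard $\mathfrak U(\mathfrak g)\otimes\mathfrak U(\mathfrak g)$ as a right $\mathfrak U(\mathfrak p)\otimes\mathfrak U(\mathfrak p)$-module by multiplication (through the homomorphism $\mathfrak U(\mathfrak p)\to\mathfrak U(\mathfrak g)$ induced by the inclusion) and $\mathrm{Hom}(\mathbb V\otimes\mathbb W,\mathbb E)$ as a left $\mathfrak U(\mathfrak p)\otimes\mathfrak U(\mathfrak p)$-module by $$\bigl((Y_1\otimes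 Y_2).T\bigr)(v\otimes w)=T\bigl(\lambda(Y_1^0)v\otimes\nu(Y_2^0)w\bigr),$$ where $\lambda$, $\nu$ also denote the induced actions of $\mathfrak U(\mathfrak p)$. Let $p\in P$ act on $$M=\bigl(\mathfrak U(\mathfrak g)\otimes\mathfrak U(\mathfrak g)\bigr)\otimes_{\mathfrak U(\mathfrak p)\otimes\mathfrak U(\mathfrak p)}\mathrm{Hom}(\mathbb V\otimes\mathbb W,\mathbb E)$$ by $p.(u_1\otimes u_2\otimes T)=\mathrm{Ad}(p)u_1\otimes\mathrm{Ad}(p)u_2\otimes\bigl(\rho(p)\circ T\circ(\lambda(p)^{-1}\otimes\nu(p)^{-1})\bigr)$, and let $M^P$ be the subspace of $P$-invariant elements. Let $r$ be the action of $\mathfrak U(\mathfrak g)$ on smooth functions on open subsets of $G$ by left invariant differential operators, $(r(X)f)(g)=\frac{d}{dt}\big|_{t=0}f(g\exp tX)$ for $X\in\mathfrak g$. Then the assignment of $(\varphi,\psi)\mapsto\sum_iT_i\bigl(r(u_i)\varphi\otimes r(u_i')\psi\bigr)$ to the class of $\sum_iu_i\otimes u_i'\otimes T_i$ is a well-defined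 isomorphism of vector spaces from $M^P$ onto the space of $G$-invariant bilinear differential pairings from $V$ and $W$ to $E$. If $\mathbb K=\mathbb R$, the same holds for global sections: the same formula is an isomorphism from $M^P$ onto the space of $G$-invariant bilinear differential pairings $\Gamma(V)\times\Gamma(W)\to\Gamma(E)$, that is, of bilinear maps on the spaces of smooth sections over all of $G/P$ which commute with all $l_g$, $g\in G$, and have the above form in each coordinate system with a local trivialization. -/

import Mathlib

open scoped Manifold ContDiff Topology TensorProduct

namespace BiPairing
open VectorField

section
variable {𝕜 : Type*} [RCLike 𝕜]

theorem fderiv_lieBracket_apply {E F : Type*} [NormedAddCommGroup E] [NormedSpace 𝕜 E]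
    [NormedAddCommGroup F] [NormedSpace 𝕜 F] {f : E → F} {x : E} (hf : ContDiffAt 𝕜 ∞ f x)
    {V W : E → E} (hV : DifferentiableAt 𝕜 V x) (hW : DifferentiableAt 𝕜 W x) :
    fderiv 𝕜 f x (lieBracket 𝕜 V W x) =
      fderiv 𝕜 (fun y => fderiv 𝕜 f y (W y)) x (V x) -
        fderiv 𝕜 (fun y => fderiv 𝕜 f y (V y)) x (W x) := by
  have hs : IsSymmSndFDerivAt 𝕜 f x := hf.isSymmSndFDerivAt (by
    rw [minSmoothness_of_isRCLikeNormedField]; exact WithTop.coe_le_coe.2 le_top)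
  have hd : DifferentiableAt 𝕜 (fderiv 𝕜 f) x :=
    (hf.fderiv_right (m := 1) (by exact WithTop.coe_le_coe.2 le_top)).differentiableAt (by decide)
  rw [fderiv_clm_apply hd hW, fderiv_clm_apply hd hV]
  simp [lieBracket, hs.eq (V x) (W x)]

variable {E F M : Type*} [NormedAddCommGroup E] [NormedSpace 𝕜 E]
    [NormedAddCommGroup F] [NormedSpace 𝕜 F] [TopologicalSpace M] [ChartedSpace E M]

/-- The directional derivative of a function at a point, as a linear map on the tangent space. -/
noncomputable def dirDeriv (f : M → F) (x : M) : TangentSpace 𝓘(𝕜, E) x →ₗ[𝕜] F :=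
  (mfderiv 𝓘(𝕜, E) 𝓘(𝕜, F) f x).toLinearMap

/-- A vector field, written in the preferred chart around `x`. -/
noncomputable def chartField (x : M) (V : Π y : M, TangentSpace 𝓘(𝕜, E) y) : E → E := fun z =>
  mpullbackWithin 𝓘(𝕜, E) 𝓘(𝕜, E) (extChartAt 𝓘(𝕜, E) x).symm V (Set.range 𝓘(𝕜, E)) z

variable [IsManifold 𝓘(𝕜, E) ∞ M]

theorem dirDeriv_chart {f : M → F} {x : M} {z : E} (hz : z ∈ (extChartAt 𝓘(𝕜, E) x).target)
    (hf : MDifferentiableAt 𝓘(𝕜, E) 𝓘(𝕜, F) f ((extChartAt 𝓘(𝕜, E) x).symm z))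
    (V : Π y : M, TangentSpace 𝓘(𝕜, E) y)  :
    dirDeriv f ((extChartAt 𝓘(𝕜, E) x).symm z) (V ((extChartAt 𝓘(𝕜, E) x).symm z)) =
     fderiv 𝕜 (f ∘ (extChartAt 𝓘(𝕜, E) x).symm) z
      (chartField x V z) := by
  have h1 := isInvertible_mfderivWithin_extChartAt_symm hz
  have h2 : MDifferentiableAt 𝓘(𝕜, E) 𝓘(𝕜, E) (extChartAt 𝓘(𝕜, E) x).symm z := by
    have := mdifferentiableWithinAt_extChartAt_symm hz
    rwa [modelWithCornersSelf_coe, Set.range_id, mdifferentiableWithinAt_univ] at this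
  rw [← mfderiv_eq_fderiv, mfderiv_comp (I' := 𝓘(𝕜, E)) z hf h2]
  simp only [chartField, mpullbackWithin, modelWithCornersSelf_coe, Set.range_id, mfderivWithin_univ]
  simp only [modelWithCornersSelf_coe, Set.range_id, mfderivWithin_univ] at h1
  obtain ⟨e, he⟩ := h1
  rw [← he, ContinuousLinearMap.inverse_equiv]
  change _ = (mfderiv 𝓘(𝕜, E) 𝓘(𝕜, F) f _) (e (e.symm _))
  rw [e.apply_symm_apply]
  rfl

variable [CompleteSpace E]
theorem dirDeriv_mlieBracket {f : M → F} {x : M}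
    (hf : ContMDiffAt 𝓘(𝕜, E) 𝓘(𝕜, F) ∞ f x) {V W : Π y : M, TangentSpace 𝓘(𝕜, E) y}
    (hV : MDiffAt (fun y ↦ (V y : TangentBundle 𝓘(𝕜, E) M)) x)
    (hW : MDiffAt (fun y ↦ (W y : TangentBundle 𝓘(𝕜, E) M)) x) :
    dirDeriv f x (mlieBracket 𝓘(𝕜, E) V W x) =
      dirDeriv (fun y => dirDeriv f y (W y)) x (V x) -
        dirDeriv (fun y => dirDeriv f y (V y)) x (W x) := by
  set c := extChartAt 𝓘(𝕜, E) x with hc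
  have hxt : c x ∈ c.target := mem_extChartAt_target x
  have hcx : c.symm (c x) = x := extChartAt_to_inv x
  have htgt : ∀ᶠ z in 𝓝 (c x), z ∈ c.target := (isOpen_extChartAt_target x).mem_nhds hxt
  have hcsm : ContMDiffAt 𝓘(𝕜, E) 𝓘(𝕜, E) ∞ c.symm (c x) :=
    (contMDiffOn_extChartAt_symm x).contMDiffAt htgt
  have hf' : ContDiffAt 𝕜 ∞ (f ∘ c.symm) (c x) := by
    rw [← contMDiffAt_iff_contDiffAt]
    refine ContMDiffAt.comp (I' := 𝓘(𝕜, E)) _ ?_ hcsm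
    rwa [hcx]
  have hfd : ∀ᶠ z in 𝓝 (c x), MDifferentiableAt 𝓘(𝕜, E) 𝓘(𝕜, F) f (c.symm z) := by
    have h1 : ∀ᶠ y in 𝓝 x, MDifferentiableAt 𝓘(𝕜, E) 𝓘(𝕜, F) f y := by
      have h2 : ContMDiffAt 𝓘(𝕜, E) 𝓘(𝕜, F) 1 f x := hf.of_le (by exact WithTop.coe_le_coe.2 le_top)
      filter_upwards [(contMDiffAt_iff_contMDiffAt_nhds (by decide)).1 h2] with y hy
      exact hy.mdifferentiableAt (by decide)
    have h3 := hcsm.continuousAt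
    rw [ContinuousAt, hcx] at h3
    exact h3.eventually h1
  have key : ∀ U : Π y : M, TangentSpace 𝓘(𝕜, E) y, ∀ᶠ z in 𝓝 (c x),
      dirDeriv f (c.symm z) (U (c.symm z)) = fderiv 𝕜 (f ∘ c.symm) z
        (chartField x U z) := by
    intro U
    filter_upwards [htgt, hfd] with z hz hz'
    exact dirDeriv_chart hz hz' U
  have hdiff : ∀ U : Π y : M, TangentSpace 𝓘(𝕜, E) y,
      MDiffAt (fun y ↦ (U y : TangentBundle 𝓘(𝕜, E) M)) x →
      DifferentiableAt 𝕜 (chartField x U) (c x) := by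
    intro U hU
    have : IsManifold 𝓘(𝕜, E) 2 M := inferInstance
    have := (mdifferentiableWithinAt_univ.2 hU).differentiableWithinAt_mpullbackWithin_vectorField
    have h : (extChartAt 𝓘(𝕜, E) x).symm ⁻¹' Set.univ ∩ Set.range 𝓘(𝕜, E) = Set.univ := by simp
    rw [h] at this
    exact differentiableWithinAt_univ.1 this
  have hD : DifferentiableAt 𝕜 (fderiv 𝕜 (f ∘ c.symm)) (c x) :=
    (hf'.fderiv_right (m := 1) (by exact WithTop.coe_le_coe.2 le_top)).differentiableAt (by decide)
  -- second derivatives in the chart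
  have key2 : ∀ U U' : Π y : M, TangentSpace 𝓘(𝕜, E) y,
      MDiffAt (fun y ↦ (U y : TangentBundle 𝓘(𝕜, E) M)) x →
      dirDeriv (fun y => dirDeriv f y (U y)) x (U' x) =
      fderiv 𝕜 (fun z => fderiv 𝕜 (f ∘ c.symm) z
        (chartField x U z)) (c x)
        (chartField x U' (c x)) := by
    intro U U' hU
    have h1 : DifferentiableAt 𝕜 (fun z => fderiv 𝕜 (f ∘ c.symm) z
        (chartField x U z)) (c x) :=
      hD.clm_apply (hdiff U hU)
    have h2 : MDifferentiableAt 𝓘(𝕜, E) 𝓘(𝕜, F) (fun y => dirDeriv f y (U y)) x := by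
      have h3 : MDifferentiableAt 𝓘(𝕜, E) 𝓘(𝕜, F) ((fun z => fderiv 𝕜 (f ∘ c.symm) z
        (chartField x U z)) ∘ c) x :=
        MDifferentiableAt.comp (I' := 𝓘(𝕜, E)) x h1.mdifferentiableAt
          (mdifferentiableAt_extChartAt (mem_chart_source E x))
      refine h3.congr_of_eventuallyEq ?_
      have h4 := (continuousAt_extChartAt (I := 𝓘(𝕜, E)) x).eventually (key U)
      filter_upwards [h4, extChartAt_source_mem_nhds (I := 𝓘(𝕜, E)) x] with y hy hy'
      rw [c.left_inv hy'] at hy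
      exact hy
    have h5 := dirDeriv_chart (f := fun y => dirDeriv f y (U y)) hxt (by rw [← hc, hcx]; exact h2) U'
    rw [← hc, hcx] at h5
    rw [h5]
    congr 1
    refine Filter.EventuallyEq.fderiv_eq ?_
    exact key U
  rw [key2 W V hW, key2 V W hV, ← fderiv_lieBracket_apply hf' (hdiff V hV) (hdiff W hW)]
  have h7 : MDifferentiableAt 𝓘(𝕜, E) 𝓘(𝕜, E) c x :=
    mdifferentiableAt_extChartAt (mem_chart_source E x)
  have h6 : mfderiv 𝓘(𝕜, E) 𝓘(𝕜, F) f x =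
      (mfderiv 𝓘(𝕜, E) 𝓘(𝕜, F) (f ∘ c.symm) (c x)).comp (mfderiv 𝓘(𝕜, E) 𝓘(𝕜, E) c x) := by
    rw [← mfderiv_comp (I' := 𝓘(𝕜, E)) x
      (hf'.differentiableAt (by decide)).mdifferentiableAt h7]
    refine Filter.EventuallyEq.mfderiv_eq ?_
    filter_upwards [extChartAt_source_mem_nhds (I := 𝓘(𝕜, E)) x] with y hy
    simp only [Function.comp_apply]
    rw [c.left_inv hy]
  obtain ⟨e, he⟩ := isInvertible_mfderiv_extChartAt (mem_extChartAt_source (I := 𝓘(𝕜, E)) x)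
  let b : E := lieBracket 𝕜 (chartField x V) (chartField x W) (c x)
  have h8 : mlieBracket 𝓘(𝕜, E) V W x = e.symm b := by
    have h : (extChartAt 𝓘(𝕜, E) x).symm ⁻¹' Set.univ ∩ Set.range 𝓘(𝕜, E) = Set.univ := by simp
    rw [mlieBracket, mlieBracketWithin_apply, ← he, ContinuousLinearMap.inverse_equiv, h]
    exact congrArg (fun u : E => e.symm u) (congrFun
      (lieBracketWithin_univ (𝕜 := 𝕜) (V := chartField x V) (W := chartField x W)) (c x))
  rw [h8, dirDeriv, h6, ← he, mfderiv_eq_fderiv]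
  exact congrArg (fun u : E => fderiv 𝕜 (f ∘ c.symm) (c x) u) (e.apply_symm_apply b)
end

section
variable {𝕜 : Type*} [RCLike 𝕜] {E : Type*} [NormedAddCommGroup E] [NormedSpace 𝕜 E]
  {EP : Type*} [NormedAddCommGroup EP] [NormedSpace 𝕜 EP]
  {F : Type*} [NormedAddCommGroup F] [NormedSpace 𝕜 F]
  {G : Type*} [TopologicalSpace G] [ChartedSpace E G] [Group G] [LieGroup 𝓘(𝕜, E) ∞ G]
  {H : Type*} [TopologicalSpace H] [ChartedSpace EP H] [Group H] [LieGroup 𝓘(𝕜, EP) ∞ H]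

instance : ENat.LEInfty (minSmoothness 𝕜 3) :=
  ⟨by rw [minSmoothness_of_isRCLikeNormedField]; exact WithTop.coe_le_coe.2 le_top⟩

variable (𝕜 E G) in
/-- The Lie algebra of `G`: the tangent space at `1`, with the bracket of left invariant vector fields. -/
abbrev LieAlg : Type _ := GroupLieAlgebra 𝓘(𝕜, E) G

/-- `(r(X) f)(g)`, the derivative of `h ↦ f (g h)` at `h = 1` in the direction `X`, that is
`d/dt f (g exp (t X))` at `t = 0`: the action of the left invariant vector field of `X`. -/
noncomputable def rightDeriv (X : LieAlg 𝕜 E G) (f : G → F) (g : G) : F :=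
  dirDeriv (𝕜 := 𝕜) (fun h : G => f (g * h)) 1 X

theorem rightDeriv_eq (X : LieAlg 𝕜 E G) {f : G → F} {g : G}
    (hf : MDifferentiableAt 𝓘(𝕜, E) 𝓘(𝕜, F) f g) :
    rightDeriv X f g = dirDeriv f g (mulInvariantVectorField X g) := by
  have h1 : MDifferentiableAt 𝓘(𝕜, E) 𝓘(𝕜, E) (fun h : G => g * h) 1 :=
    (contMDiff_mul_left (I := 𝓘(𝕜, E)) (n := ∞)).contMDiffAt.mdifferentiableAt (by decide)
  have h2 : (mfderiv 𝓘(𝕜, E) 𝓘(𝕜, F) (f ∘ fun h : G => g * h) 1) =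
      (mfderiv 𝓘(𝕜, E) 𝓘(𝕜, F) f (g * 1)).comp
        (mfderiv 𝓘(𝕜, E) 𝓘(𝕜, E) (fun h : G => g * h) 1) :=
    mfderiv_comp (I' := 𝓘(𝕜, E)) 1 (by simpa using hf) h1
  have h3 : mfderiv 𝓘(𝕜, E) 𝓘(𝕜, F) f (g * 1) = mfderiv 𝓘(𝕜, E) 𝓘(𝕜, F) f g := by rw [mul_one]
  change mfderiv 𝓘(𝕜, E) 𝓘(𝕜, F) (f ∘ fun h : G => g * h) 1 X = _
  rw [h2, h3]
  rfl

theorem contMDiffOn_rightDeriv (X : LieAlg 𝕜 E G) {f : G → F} {O : Set G} (hO : IsOpen O)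
    (hf : ContMDiffOn 𝓘(𝕜, E) 𝓘(𝕜, F) ∞ f O) :
    ContMDiffOn 𝓘(𝕜, E) 𝓘(𝕜, F) ∞ (rightDeriv X f) O := by
  intro g hg
  apply ContMDiffAt.contMDiffWithinAt
  have h1 : ContMDiffAt (𝓘(𝕜, E).prod 𝓘(𝕜, E)) 𝓘(𝕜, F) ∞
      (Function.uncurry fun g h : G => f (g * h)) (g, 1) := by
    have h2 : ContMDiffAt 𝓘(𝕜, E) 𝓘(𝕜, F) ∞ f (g * 1) := by
      rw [mul_one]; exact hf.contMDiffAt (hO.mem_nhds hg)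
    exact ContMDiffAt.comp (g, (1 : G)) h2 (contMDiff_mul 𝓘(𝕜, E) ∞).contMDiffAt
  let X' : E := X
  have h3 := (ContMDiffAt.mfderiv (fun g h : G => f (g * h)) (fun _ => (1 : G))
    h1 (contMDiffAt_const) (m := ∞) (by decide)).clm_apply (contMDiffAt_const (c := X'))
  refine h3.congr_of_eventuallyEq (Filter.Eventually.of_forall fun x => ?_)
  let ϕ : G → E →L[𝕜] F := fun x => mfderiv 𝓘(𝕜, E) 𝓘(𝕜, F) (fun h : G => f (x * h)) 1
  have h6 := inTangentCoordinates_eq (I := 𝓘(𝕜, E)) (I' := 𝓘(𝕜, F)) (fun _ : G => (1 : G))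
    (fun x => f (x * 1)) ϕ (x₀ := g) (x := x) (mem_chart_source E _) (by rw [chartAt_self_eq]; trivial)
  rw [tangentBundleCore_coordChange_model_space] at h6
  have h4 : (tangentBundleCore 𝓘(𝕜, E) G).coordChange (achart E 1) (achart E 1) 1 X' = X' :=
    (tangentBundleCore 𝓘(𝕜, E) G).coordChange_self _ _ (mem_chart_source E 1) _
  refine Eq.trans ?_ (congrArg (fun L : E →L[𝕜] F => L X') h6.symm)
  exact (congrArg (fun Z : E => ϕ x Z) h4).symm

theorem rightDeriv_congr (X : LieAlg 𝕜 E G) {f f' : G → F} {O : Set G} (hO : IsOpen O)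
    (h : Set.EqOn f f' O) {g : G} (hg : g ∈ O) : rightDeriv X f g = rightDeriv X f' g := by
  have hc : ContinuousAt (fun h : G => g * h) 1 :=
    (contMDiff_mul_left (I := 𝓘(𝕜, E)) (n := ∞)).continuous.continuousAt
  have h1 : (fun h : G => f (g * h)) =ᶠ[𝓝 1] fun h : G => f' (g * h) := by
    filter_upwards [hc.preimage_mem_nhds (hO.mem_nhds (by simpa using hg))] with y hy
    exact h hy
  unfold rightDeriv dirDeriv
  rw [h1.mfderiv_eq]

/-- `r([X, Y]) f = r(X) r(Y) f - r(Y) r(X) f`. -/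
theorem rightDeriv_lie [CompleteSpace E] (X Y : LieAlg 𝕜 E G) {f : G → F} {O : Set G}
    (hO : IsOpen O) (hf : ContMDiffOn 𝓘(𝕜, E) 𝓘(𝕜, F) ∞ f O) {g : G} (hg : g ∈ O) :
    rightDeriv ⁅X, Y⁆ f g = rightDeriv X (rightDeriv Y f) g - rightDeriv Y (rightDeriv X f) g := by
  have hd : ∀ {f : G → F}, ContMDiffOn 𝓘(𝕜, E) 𝓘(𝕜, F) ∞ f O → ∀ {g}, g ∈ O →
      MDifferentiableAt 𝓘(𝕜, E) 𝓘(𝕜, F) f g := fun hf _ hg =>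
    (hf.contMDiffAt (hO.mem_nhds hg)).mdifferentiableAt (by decide)
  have h2 : ∀ X Y : LieAlg 𝕜 E G, rightDeriv X (rightDeriv Y f) g =
      dirDeriv (fun y => dirDeriv f y (mulInvariantVectorField Y y)) g
        (mulInvariantVectorField X g) := by
    intro X Y
    rw [rightDeriv_eq X (hd (contMDiffOn_rightDeriv Y hO hf) hg)]
    unfold dirDeriv
    congr 1
    refine congrArg _ (Filter.EventuallyEq.mfderiv_eq ?_)
    filter_upwards [hO.mem_nhds hg] with y hy
    exact rightDeriv_eq Y (hd hf hy)
  rw [rightDeriv_eq _ (hd hf hg), h2 X Y, h2 Y X,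
    ← dirDeriv_mlieBracket (hf.contMDiffAt (hO.mem_nhds hg))
      (mdifferentiableAt_mulInvariantVectorField X) (mdifferentiableAt_mulInvariantVectorField Y),
    ← mulInvariantVector_mlieBracket]
  rfl

theorem rightDeriv_add (X : LieAlg 𝕜 E G) {f f' : G → F} {g : G}
    (hf : MDifferentiableAt 𝓘(𝕜, E) 𝓘(𝕜, F) f g) (hf' : MDifferentiableAt 𝓘(𝕜, E) 𝓘(𝕜, F) f' g) :
    rightDeriv X (f + f') g = rightDeriv X f g + rightDeriv X f' g := by
  have h : MDifferentiableAt 𝓘(𝕜, E) 𝓘(𝕜, F) (f + f') g := hf.add hf'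
  rw [rightDeriv_eq X h, rightDeriv_eq X hf, rightDeriv_eq X hf', dirDeriv, mfderiv_add hf hf']
  rfl

theorem rightDeriv_clm {F' : Type*} [NormedAddCommGroup F'] [NormedSpace 𝕜 F']
    (X : LieAlg 𝕜 E G) (L : F →L[𝕜] F') {f : G → F} {g : G}
    (hf : MDifferentiableAt 𝓘(𝕜, E) 𝓘(𝕜, F) f g) :
    rightDeriv X (fun y => L (f y)) g = L (rightDeriv X f g) := by
  have hL : MDifferentiableAt 𝓘(𝕜, F) 𝓘(𝕜, F') L (f g) :=
    L.differentiableAt.mdifferentiableAt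
  have h1 : MDifferentiableAt 𝓘(𝕜, E) 𝓘(𝕜, F') (fun y => L (f y)) g :=
    MDifferentiableAt.comp (I' := 𝓘(𝕜, F)) g hL hf
  have h2 : mfderiv 𝓘(𝕜, E) 𝓘(𝕜, F') (L ∘ f) g =
    (mfderiv 𝓘(𝕜, F) 𝓘(𝕜, F') L (f g)).comp (mfderiv 𝓘(𝕜, E) 𝓘(𝕜, F) f g) :=
    mfderiv_comp (I' := 𝓘(𝕜, F)) g hL hf
  rw [rightDeriv_eq X h1, rightDeriv_eq X hf]
  change mfderiv 𝓘(𝕜, E) 𝓘(𝕜, F') (L ∘ f) g _ = _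
  rw [h2, mfderiv_eq_fderiv, L.fderiv]
  rfl

/-! ### Differentials of homomorphisms of Lie groups -/
/-- The differential at `1` of a homomorphism of Lie groups. -/
noncomputable def homDeriv (φ : H →* G) : LieAlg 𝕜 EP H →ₗ[𝕜] LieAlg 𝕜 E G where
  toFun X := (mfderiv 𝓘(𝕜, EP) 𝓘(𝕜, E) φ 1 X : E)
  map_add' X Y := (mfderiv 𝓘(𝕜, EP) 𝓘(𝕜, E) φ 1).map_add X Y
  map_smul' c X := (mfderiv 𝓘(𝕜, EP) 𝓘(𝕜, E) φ 1).map_smul c X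

theorem rightDeriv_comp {φ : H →* G} (hφ : ContMDiff 𝓘(𝕜, EP) 𝓘(𝕜, E) ∞ φ) (X : LieAlg 𝕜 EP H)
    {f : G → F} {h : H} (hf : MDifferentiableAt 𝓘(𝕜, E) 𝓘(𝕜, F) f (φ h)) :
    rightDeriv X (fun y => f (φ y)) h = rightDeriv (homDeriv φ X : LieAlg 𝕜 E G) f (φ h) := by
  have h1 : (fun y => f (φ (h * y))) = (fun y => f (φ h * y)) ∘ φ := by
    funext y; simp
  have h2 : MDifferentiableAt 𝓘(𝕜, E) 𝓘(𝕜, F) (fun y => f (φ h * y)) (φ 1) := by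
    have h3 : MDifferentiableAt 𝓘(𝕜, E) 𝓘(𝕜, F) f (φ h * φ 1) := by simpa using hf
    exact MDifferentiableAt.comp (I' := 𝓘(𝕜, E)) (φ 1) h3
      ((contMDiff_mul_left (I := 𝓘(𝕜, E)) (n := ∞)).contMDiffAt.mdifferentiableAt (by decide))
  have h4 := mfderiv_comp (I' := 𝓘(𝕜, E)) (1 : H) h2 (hφ.mdifferentiable (by decide) 1)
  rw [← h1] at h4
  have h5 : (mfderiv 𝓘(𝕜, E) 𝓘(𝕜, F) (fun y => f (φ h * y)) (φ 1) : E →L[𝕜] F) =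
    mfderiv 𝓘(𝕜, E) 𝓘(𝕜, F) (fun y => f (φ h * y)) 1 := by rw [map_one]
  change mfderiv 𝓘(𝕜, EP) 𝓘(𝕜, F) (fun y => f (φ (h * y))) 1 X = _
  rw [h4]
  exact congrArg (fun L : E →L[𝕜] F => L (homDeriv φ X : LieAlg 𝕜 E G)) h5

theorem lieAlg_ext {X Y : LieAlg 𝕜 E G}
    (h : ∀ (O : Set G) (f : G → E), IsOpen O → 1 ∈ O → ContMDiffOn 𝓘(𝕜, E) 𝓘(𝕜, E) ∞ f O →
      rightDeriv X f 1 = rightDeriv Y f 1) : X = Y := by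
  have h1 := h (chartAt E (1 : G)).source (extChartAt 𝓘(𝕜, E) (1 : G))
    (chartAt E (1 : G)).open_source (mem_chart_source E 1) contMDiffOn_extChartAt
  have h2 : MDifferentiableAt 𝓘(𝕜, E) 𝓘(𝕜, E) (extChartAt 𝓘(𝕜, E) (1 : G)) 1 :=
    mdifferentiableAt_extChartAt (mem_chart_source E 1)
  obtain ⟨e, he⟩ := isInvertible_mfderiv_extChartAt (mem_extChartAt_source (I := 𝓘(𝕜, E)) (1 : G))
  have h3 : ∀ Z : LieAlg 𝕜 E G, rightDeriv Z (extChartAt 𝓘(𝕜, E) (1 : G)) 1 = e Z := by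
    intro Z
    have h4 : (fun h : G => extChartAt 𝓘(𝕜, E) (1 : G) (1 * h)) = extChartAt 𝓘(𝕜, E) (1 : G) := by
      funext y; rw [one_mul]
    have h5 : dirDeriv (fun h : G => extChartAt 𝓘(𝕜, E) (1 : G) (1 * h)) 1 Z =
        dirDeriv (extChartAt 𝓘(𝕜, E) (1 : G)) 1 Z := by rw [h4]
    refine h5.trans ?_
    exact congrArg (fun L : E →L[𝕜] E => L Z) he.symm
  rw [h3, h3] at h1
  exact e.injective h1

theorem homDeriv_lie [CompleteSpace E] [CompleteSpace EP] {φ : H →* G}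
    (hφ : ContMDiff 𝓘(𝕜, EP) 𝓘(𝕜, E) ∞ φ) (X Y : LieAlg 𝕜 EP H) :
    (homDeriv φ ⁅X, Y⁆ : LieAlg 𝕜 E G) = ⁅(homDeriv φ X : LieAlg 𝕜 E G), (homDeriv φ Y : LieAlg 𝕜 E G)⁆ := by
  apply lieAlg_ext
  intro O f hO h1 hf
  have hO' : IsOpen (φ ⁻¹' O) := hO.preimage hφ.continuous
  have h1' : (1 : H) ∈ φ ⁻¹' O := by simpa using h1
  have hd : ∀ {f : G → E}, ContMDiffOn 𝓘(𝕜, E) 𝓘(𝕜, E) ∞ f O → ∀ {g}, g ∈ O →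
      MDifferentiableAt 𝓘(𝕜, E) 𝓘(𝕜, E) f g := fun hf _ hg =>
    (hf.contMDiffAt (hO.mem_nhds hg)).mdifferentiableAt (by decide)
  have hf' : ContMDiffOn 𝓘(𝕜, EP) 𝓘(𝕜, E) ∞ (fun y => f (φ y)) (φ ⁻¹' O) :=
    hf.comp hφ.contMDiffOn (fun _ h => h)
  have key : ∀ X Y : LieAlg 𝕜 EP H, rightDeriv X (rightDeriv Y (fun y => f (φ y))) 1 =
      rightDeriv (homDeriv φ X : LieAlg 𝕜 E G) (rightDeriv (homDeriv φ Y : LieAlg 𝕜 E G) f) 1 := by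
    intro X Y
    rw [rightDeriv_congr X hO' (f' := fun y => rightDeriv (homDeriv φ Y : LieAlg 𝕜 E G) f (φ y))
      (fun y hy => rightDeriv_comp hφ Y (hd hf hy)) h1',
      rightDeriv_comp hφ X (hd (contMDiffOn_rightDeriv _ hO hf) h1'), map_one]
  have h3 := rightDeriv_comp hφ ⁅X, Y⁆ (hd hf h1')
  rw [map_one] at h3
  rw [← h3, rightDeriv_lie X Y hO' hf' h1', rightDeriv_lie _ _ hO hf h1, key, key]

theorem homDeriv_comp {EQ : Type*} [NormedAddCommGroup EQ] [NormedSpace 𝕜 EQ]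
    {K : Type*} [TopologicalSpace K] [ChartedSpace EQ K] [Group K] [LieGroup 𝓘(𝕜, EQ) ∞ K]
    {φ : H →* G} (hφ : ContMDiff 𝓘(𝕜, EP) 𝓘(𝕜, E) ∞ φ) {ψ : K →* H}
    (hψ : ContMDiff 𝓘(𝕜, EQ) 𝓘(𝕜, EP) ∞ ψ) (X : LieAlg 𝕜 EQ K) :
    (homDeriv (φ.comp ψ) X : LieAlg 𝕜 E G) = homDeriv φ (homDeriv ψ X : LieAlg 𝕜 EP H) := by
  have h4 := mfderiv_comp (I' := 𝓘(𝕜, EP)) (1 : K) (hφ.mdifferentiable (by decide) (ψ 1))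
    (hψ.mdifferentiable (by decide) 1)
  have h5 : (mfderiv 𝓘(𝕜, EP) 𝓘(𝕜, E) φ (ψ 1) : EP →L[𝕜] E) = mfderiv 𝓘(𝕜, EP) 𝓘(𝕜, E) φ 1 := by
    rw [map_one]
  change mfderiv 𝓘(𝕜, EQ) 𝓘(𝕜, E) (φ ∘ ψ) 1 X = _
  rw [h4]
  exact congrArg (fun L : EP →L[𝕜] E => L (homDeriv ψ X : LieAlg 𝕜 EP H)) h5
end

section
attribute [local instance 100] LieRing.ofAssociativeRing
open MulOpposite

section algebra
variable {R : Type*} [CommRing R] {L L' : Type*} [LieRing L] [LieAlgebra R L]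
  [LieRing L'] [LieAlgebra R L']

/-- The homomorphism of enveloping algebras induced by a homomorphism of Lie algebras. -/
noncomputable def envMap (f : L →ₗ⁅R⁆ L') :
    UniversalEnvelopingAlgebra R L →ₐ[R] UniversalEnvelopingAlgebra R L' :=
  UniversalEnvelopingAlgebra.lift R ((UniversalEnvelopingAlgebra.ι R).comp f)

theorem envMap_ι (f : L →ₗ⁅R⁆ L') (X : L) :
    envMap f (UniversalEnvelopingAlgebra.ι R X) = UniversalEnvelopingAlgebra.ι R (f X) :=
  UniversalEnvelopingAlgebra.lift_ι_apply R _ X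

theorem env_induction {C : UniversalEnvelopingAlgebra R L → Prop}
    (halg : ∀ c : R, C (algebraMap R _ c)) (hι : ∀ X : L, C (UniversalEnvelopingAlgebra.ι R X))
    (hadd : ∀ a b, C a → C b → C (a + b)) (hmul : ∀ a b, C a → C b → C (a * b)) (a) : C a := by
  let S : Subalgebra R (UniversalEnvelopingAlgebra R L) :=
    { carrier := {a | C a}
      mul_mem' := hmul _ _
      add_mem' := hadd _ _
      algebraMap_mem' := halg }
  let f : L →ₗ⁅R⁆ S :=
    { toFun := fun X => ⟨UniversalEnvelopingAlgebra.ι R X, hι X⟩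
      map_add' := fun X Y => by ext; simp
      map_smul' := fun c X => by ext; simp
      map_lie' := fun {X Y} => by
        apply Subtype.ext
        exact (UniversalEnvelopingAlgebra.ι R).map_lie X Y }
  have h : S.val.comp (UniversalEnvelopingAlgebra.lift R f) = AlgHom.id R _ := by
    apply UniversalEnvelopingAlgebra.hom_ext
    ext X
    change ((UniversalEnvelopingAlgebra.lift R f) (UniversalEnvelopingAlgebra.ι R X) : _) =
      UniversalEnvelopingAlgebra.ι R X
    rw [UniversalEnvelopingAlgebra.lift_ι_apply]
    rfl
  have h2 := DFunLike.congr_fun h a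
  rw [AlgHom.id_apply] at h2
  rw [← h2]
  exact (UniversalEnvelopingAlgebra.lift R f a).2

variable (R L) in
/-- The antiautomorphism `u ↦ u⁰` of the enveloping algebra with `X⁰ = -X` for `X` in the Lie
algebra, as a homomorphism into the opposite algebra. -/
noncomputable def envAnti :
    UniversalEnvelopingAlgebra R L →ₐ[R] (UniversalEnvelopingAlgebra R L)ᵐᵒᵖ :=
  UniversalEnvelopingAlgebra.lift R
    { toFun := fun X => op (-UniversalEnvelopingAlgebra.ι R X)
      map_add' := fun X Y => by simp [add_comm]
      map_smul' := fun c X => by simp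
      map_lie' := fun {X Y} => by
        rw [LieHom.map_lie, LieRing.of_associative_ring_bracket,
          LieRing.of_associative_ring_bracket, ← op_mul, ← op_mul, ← op_sub]
        simp }

theorem envAnti_ι (X : L) : envAnti R L (UniversalEnvelopingAlgebra.ι R X) =
    op (-UniversalEnvelopingAlgebra.ι R X) :=
  UniversalEnvelopingAlgebra.lift_ι_apply R _ X

/-- `End(M)` acts on `Hom(M, N)` from the right, by precomposition. -/
def precompHom (M N : Type*) [AddCommGroup M] [Module R M] [AddCommGroup N] [Module R N] :
    (Module.End R M)ᵐᵒᵖ →ₐ[R] Module.End R (M →ₗ[R] N) where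
  toFun f := LinearMap.lcomp R N (unop f)
  map_one' := rfl
  map_mul' _ _ := rfl
  map_zero' := by ext; simp
  map_add' _ _ := by ext; simp
  commutes' c := by ext; simp [Algebra.algebraMap_eq_smul_one]

section balanced
variable {A B N : Type*} [Ring A] [Algebra R A] [Ring B] [Algebra R B] [AddCommGroup N] [Module R N]

/-- For an algebra `A`, which is a right `B`-module through `j : B → A`, and a left `B`-module `N`
with action `σ`: the span of the elements `a j(b) ⊗ n - a ⊗ b.n` of `A ⊗ N`. -/
def balancedRel (j : B →ₐ[R] A) (σ : B →ₐ[R] Module.End R N) : Submodule R (A ⊗[R] N) :=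
  Submodule.span R {z | ∃ (a : A) (b : B) (n : N), z = (a * j b) ⊗ₜ[R] n - a ⊗ₜ[R] (σ b n)}

/-- The tensor product `A ⊗_B N` of the right `B`-module `A` and the left `B`-module `N`, for a not
necessarily commutative algebra `B`. -/
abbrev BalancedTensor (j : B →ₐ[R] A) (σ : B →ₐ[R] Module.End R N) : Type _ :=
  (A ⊗[R] N) ⧸ balancedRel j σ

theorem balancedRel_le_comap (j : B →ₐ[R] A) (σ : B →ₐ[R] Module.End R N) (a : A →ₐ[R] A)
    (b : B →ₐ[R] B) (n : N →ₗ[R] N) (haj : ∀ y, a (j y) = j (b y))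
    (hn : ∀ y T, n (σ y T) = σ (b y) (n T)) :
    balancedRel j σ ≤ (balancedRel j σ).comap (TensorProduct.map a.toLinearMap n) := by
  rw [balancedRel, Submodule.span_le]
  rintro _ ⟨u, y, T, rfl⟩
  refine Submodule.subset_span ⟨a u, b y, n T, ?_⟩
  simp [haj, hn]
end balanced
end algebra

section rep
variable {𝕜 : Type*} [RCLike 𝕜] {E : Type*} [NormedAddCommGroup E] [NormedSpace 𝕜 E]
  [CompleteSpace E]
  {P : Type*} [TopologicalSpace P] [ChartedSpace E P] [Group P] [LieGroup 𝓘(𝕜, E) ∞ P]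

variable (𝕜 E P) in
/-- A smooth (holomorphic, if `𝕜 = ℂ`) representation of the Lie group `P`. -/
structure SmoothRep (V : Type*) [NormedAddCommGroup V] [NormedSpace 𝕜 V] where
  toRep : Representation 𝕜 P V
  smooth : ∀ v, ContMDiff 𝓘(𝕜, E) 𝓘(𝕜, V) ∞ fun p => toRep p v

variable {V W : Type*} [NormedAddCommGroup V] [NormedSpace 𝕜 V] [FiniteDimensional 𝕜 V]
  [NormedAddCommGroup W] [NormedSpace 𝕜 W] [FiniteDimensional 𝕜 W]

/-- The differential of a representation: `X.v = d/dt exp(t X).v` at `t = 0`. -/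
noncomputable def derivedLin (ρ : SmoothRep 𝕜 E P V) : LieAlg 𝕜 E P →ₗ[𝕜] Module.End 𝕜 V :=
  LinearMap.mk₂ 𝕜 (fun X v => rightDeriv X (fun p => ρ.toRep p v) 1)
    (fun X Y v => (dirDeriv _ _).map_add X Y)
    (fun c X v => (dirDeriv _ _).map_smul c X)
    (fun X v w => by
      rw [← rightDeriv_add X ((ρ.smooth v).mdifferentiable (by decide) 1)
        ((ρ.smooth w).mdifferentiable (by decide) 1)]
      congr 1
      funext p
      simp)
    (fun c X v => by
      have := rightDeriv_clm X (c • ContinuousLinearMap.id 𝕜 V)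
        ((ρ.smooth v).mdifferentiable (by decide) 1)
      simpa using this)

theorem derivedLin_apply (ρ : SmoothRep 𝕜 E P V) (X : LieAlg 𝕜 E P) (v : V) :
    derivedLin ρ X v = rightDeriv X (fun p => ρ.toRep p v) 1 := rfl

theorem rightDeriv_rep (ρ : SmoothRep 𝕜 E P V) (X : LieAlg 𝕜 E P) (v : V) (p : P) :
    rightDeriv X (fun p => ρ.toRep p v) p = ρ.toRep p (derivedLin ρ X v) := by
  have := rightDeriv_clm X (LinearMap.toContinuousLinearMap (ρ.toRep p))
        ((ρ.smooth v).mdifferentiable (by decide) 1)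
  rw [LinearMap.coe_toContinuousLinearMap', ← derivedLin_apply] at this
  rw [← this]
  unfold rightDeriv
  simp

theorem derivedLin_lie (ρ : SmoothRep 𝕜 E P V) (X Y : LieAlg 𝕜 E P) :
    derivedLin ρ ⁅X, Y⁆ = ⁅derivedLin ρ X, derivedLin ρ Y⁆ := by
  ext v
  have h : ∀ Y : LieAlg 𝕜 E P, rightDeriv Y (fun p => ρ.toRep p v) =
      fun p => ρ.toRep p (derivedLin ρ Y v) := fun Y => funext (rightDeriv_rep ρ Y v)
  rw [derivedLin_apply, rightDeriv_lie X Y isOpen_univ (ρ.smooth v).contMDiffOn (Set.mem_univ _),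
    h X, h Y, rightDeriv_rep, rightDeriv_rep, LieRing.of_associative_ring_bracket]
  simp

/-- The differential of a representation, as a representation of the Lie algebra. -/
noncomputable def derivedRep (ρ : SmoothRep 𝕜 E P V) : LieAlg 𝕜 E P →ₗ⁅𝕜⁆ Module.End 𝕜 V :=
  { derivedLin ρ with map_lie' := fun {X Y} => derivedLin_lie ρ X Y }

variable (𝕜 E P) in
/-- The universal enveloping algebra of the Lie algebra of `P`. -/
abbrev Env : Type _ := UniversalEnvelopingAlgebra 𝕜 (LieAlg 𝕜 E P)

/-- The representation of the enveloping algebra induced by a representation of the group. -/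
noncomputable def envRep (ρ : SmoothRep 𝕜 E P V) : Env 𝕜 E P →ₐ[𝕜] Module.End 𝕜 V :=
  UniversalEnvelopingAlgebra.lift 𝕜 (derivedRep ρ)

theorem envRep_ι (ρ : SmoothRep 𝕜 E P V) (X : LieAlg 𝕜 E P) :
    envRep ρ (UniversalEnvelopingAlgebra.ι 𝕜 X) = derivedLin ρ X :=
  UniversalEnvelopingAlgebra.lift_ι_apply 𝕜 _ X

/-- `Hom(V ⊗ W, U)` as a left module over `𝔘(𝔭) ⊗ 𝔘(𝔭)`:
`((y₁ ⊗ y₂).T)(v ⊗ w) = T(y₁⁰.v ⊗ y₂⁰.w)`, where `u ↦ u⁰` is the antiautomorphism. -/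
noncomputable def homAct (ρV : SmoothRep 𝕜 E P V) (ρW : SmoothRep 𝕜 E P W) (U : Type*)
    [AddCommGroup U] [Module 𝕜 U] :
    Env 𝕜 E P ⊗[𝕜] Env 𝕜 E P →ₐ[𝕜] Module.End 𝕜 (V ⊗[𝕜] W →ₗ[𝕜] U) :=
  (precompHom (V ⊗[𝕜] W) U).comp <|
    (AlgHom.op (Module.endTensorEndAlgHom (R := 𝕜) (S := 𝕜) (A := 𝕜) (M := V) (N := W))).comp <|
    (Algebra.TensorProduct.opAlgEquiv 𝕜 𝕜 (Module.End 𝕜 V) (Module.End 𝕜 W)).toAlgHom.comp <|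
    Algebra.TensorProduct.map ((AlgHom.op (envRep ρV)).comp (envAnti 𝕜 (LieAlg 𝕜 E P)))
      ((AlgHom.op (envRep ρW)).comp (envAnti 𝕜 (LieAlg 𝕜 E P)))

theorem homAct_tmul (ρV : SmoothRep 𝕜 E P V) (ρW : SmoothRep 𝕜 E P W) {U : Type*}
    [AddCommGroup U] [Module 𝕜 U] (y₁ y₂ : Env 𝕜 E P) (T : V ⊗[𝕜] W →ₗ[𝕜] U) (v : V) (w : W) :
    homAct ρV ρW U (y₁ ⊗ₜ y₂) T (v ⊗ₜ w) =
      T (envRep ρV (unop (envAnti 𝕜 _ y₁)) v ⊗ₜ envRep ρW (unop (envAnti 𝕜 _ y₂)) w) := rfl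

end rep

section subgroup
variable {𝕜 : Type*} [RCLike 𝕜] {E : Type*} [NormedAddCommGroup E] [NormedSpace 𝕜 E]
  [CompleteSpace E] {EP : Type*} [NormedAddCommGroup EP] [NormedSpace 𝕜 EP] [CompleteSpace EP]
  {G : Type*} [TopologicalSpace G] [ChartedSpace E G] [Group G] [LieGroup 𝓘(𝕜, E) ∞ G]
  {H : Type*} [TopologicalSpace H] [ChartedSpace EP H] [Group H] [LieGroup 𝓘(𝕜, EP) ∞ H]

/-- The differential at `1` of a smooth homomorphism, as a homomorphism of Lie algebras. -/
noncomputable def homLie (φ : H →* G) (hφ : ContMDiff 𝓘(𝕜, EP) 𝓘(𝕜, E) ∞ φ) :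
    LieAlg 𝕜 EP H →ₗ⁅𝕜⁆ LieAlg 𝕜 E G :=
  { homDeriv φ with map_lie' := fun {X Y} => homDeriv_lie hφ X Y }

theorem homLie_comp {EQ : Type*} [NormedAddCommGroup EQ] [NormedSpace 𝕜 EQ] [CompleteSpace EQ]
    {K : Type*} [TopologicalSpace K] [ChartedSpace EQ K] [Group K] [LieGroup 𝓘(𝕜, EQ) ∞ K]
    {φ : H →* G} (hφ : ContMDiff 𝓘(𝕜, EP) 𝓘(𝕜, E) ∞ φ) {ψ : K →* H}
    (hψ : ContMDiff 𝓘(𝕜, EQ) 𝓘(𝕜, EP) ∞ ψ)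
    (h : ContMDiff 𝓘(𝕜, EQ) 𝓘(𝕜, E) ∞ (φ.comp ψ)) (X : LieAlg 𝕜 EQ K) :
    homLie (φ.comp ψ) h X = homLie φ hφ (homLie ψ hψ X) :=
  homDeriv_comp hφ hψ X

variable (𝕜 E) in
theorem contMDiff_conj (g : G) :
    ContMDiff 𝓘(𝕜, E) 𝓘(𝕜, E) ∞ (MulAut.conj g).toMonoidHom := by
  have h : ContMDiff 𝓘(𝕜, E) 𝓘(𝕜, E) ∞ fun h : G => g * h * g⁻¹ :=
    (contMDiff_mul_right (a := g⁻¹)).comp (contMDiff_mul_left (a := g))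
  exact h

variable (𝕜 E) in
/-- The adjoint action `Ad(g)` on the Lie algebra. -/
noncomputable def adLie (g : G) : LieAlg 𝕜 E G →ₗ⁅𝕜⁆ LieAlg 𝕜 E G :=
  homLie (MulAut.conj g).toMonoidHom (contMDiff_conj 𝕜 E g)

variable (𝕜 E) in
/-- The adjoint action `Ad(g)` on the enveloping algebra. -/
noncomputable def adEnv (g : G) : Env 𝕜 E G →ₐ[𝕜] Env 𝕜 E G :=
  envMap (adLie 𝕜 E g)

variable (𝕜 E EP) in
/-- The subgroup `P` of `G` is closed, and its manifold structure makes it an immersed submanifold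
(for a homomorphism of Lie groups it is enough to check the differential at `1`). -/
class IsClosedLieSubgroup (P : Subgroup G) [ChartedSpace EP P] : Prop where
  isClosed : IsClosed (P : Set G)
  contMDiff_subtype : ContMDiff 𝓘(𝕜, EP) 𝓘(𝕜, E) ∞ P.subtype
  injective_mfderiv : Function.Injective (mfderiv 𝓘(𝕜, EP) 𝓘(𝕜, E) P.subtype 1)

section
variable {V : Type*} [NormedAddCommGroup V] [NormedSpace 𝕜 V] [FiniteDimensional 𝕜 V]

theorem derivedLin_ad (ρ : SmoothRep 𝕜 E G V) (p : G) (X : LieAlg 𝕜 E G) (v : V) :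
    derivedLin ρ (adLie 𝕜 E p X) v = ρ.toRep p (derivedLin ρ X (ρ.toRep p⁻¹ v)) := by
  have h1 := rightDeriv_comp (contMDiff_conj 𝕜 E p) X (h := 1)
    (((ρ.smooth v).mdifferentiable (by decide) _))
  rw [map_one] at h1
  refine h1.symm.trans ?_
  rw [derivedLin_apply]
  have := rightDeriv_clm X (LinearMap.toContinuousLinearMap (ρ.toRep p))
        ((ρ.smooth (ρ.toRep p⁻¹ v)).mdifferentiable (by decide) 1)
  rw [LinearMap.coe_toContinuousLinearMap'] at this
  rw [← this]
  congr 1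
  funext y
  simp

theorem envRep_ad (ρ : SmoothRep 𝕜 E G V) (p : G) (y : Env 𝕜 E G) (v : V) :
    envRep ρ (unop (envAnti 𝕜 _ (adEnv 𝕜 E p y))) v =
      ρ.toRep p (envRep ρ (unop (envAnti 𝕜 _ y)) (ρ.toRep p⁻¹ v)) := by
  induction y using env_induction generalizing v with
  | halg c => simp [Algebra.algebraMap_eq_smul_one]
  | hι X =>
    rw [adEnv, envMap_ι, envAnti_ι, envAnti_ι, unop_op, unop_op, map_neg, map_neg, envRep_ι,
      envRep_ι, LinearMap.neg_apply, derivedLin_ad]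
    simp
  | hadd a b ha hb => simp [ha, hb]
  | hmul a b ha hb => simp [ha, hb]
end

variable {P : Subgroup G} [ChartedSpace EP P] [LieGroup 𝓘(𝕜, EP) ∞ P]
  [hP : IsClosedLieSubgroup 𝕜 E EP P]

variable (𝕜 E EP P) in
/-- The homomorphism `𝔘(𝔭) → 𝔘(𝔤)`. -/
noncomputable def envIncl : Env 𝕜 EP P →ₐ[𝕜] Env 𝕜 E G :=
  envMap (homLie P.subtype (hP.contMDiff_subtype))

theorem envIncl_ad (p : P) (y : Env 𝕜 EP P) :
    adEnv 𝕜 E (p : G) (envIncl 𝕜 E EP P y) = envIncl 𝕜 E EP P (adEnv 𝕜 EP p y) := by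
  induction y using env_induction with
  | halg c => rw [AlgHom.commutes, AlgHom.commutes, AlgHom.commutes, AlgHom.commutes]
  | hι X =>
    simp only [adEnv, envIncl, envMap_ι, adLie]
    congr 1
    have h1 := contMDiff_conj 𝕜 E (p : G)
    have h2 := contMDiff_conj 𝕜 EP p
    have h3 := hP.contMDiff_subtype
    have h4 : (MulAut.conj (p : G)).toMonoidHom.comp P.subtype =
      P.subtype.comp (MulAut.conj p).toMonoidHom := by ext; simp
    rw [← homLie_comp h1 h3 (h1.comp h3), ← homLie_comp h3 h2 (h3.comp h2)]
    simp only [h4]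
  | hadd a b ha hb => rw [map_add, map_add, map_add, map_add, ha, hb]
  | hmul a b ha hb => rw [map_mul, map_mul, map_mul, map_mul, ha, hb]

variable {V : Type*} [NormedAddCommGroup V] [NormedSpace 𝕜 V] [FiniteDimensional 𝕜 V]
  {W : Type*} [NormedAddCommGroup W] [NormedSpace 𝕜 W] [FiniteDimensional 𝕜 W]
  {U : Type*} [NormedAddCommGroup U] [NormedSpace 𝕜 U] [FiniteDimensional 𝕜 U]
  (ρV : SmoothRep 𝕜 EP P V) (ρW : SmoothRep 𝕜 EP P W) (ρU : SmoothRep 𝕜 EP P U)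

variable (E U) in
/-- The tensor product `(𝔘(𝔤) ⊗ 𝔘(𝔤)) ⊗_{𝔘(𝔭) ⊗ 𝔘(𝔭)} Hom(V ⊗ W, U)`. -/
abbrev BiVermaHom : Type _ :=
  BalancedTensor (Algebra.TensorProduct.map (envIncl 𝕜 E EP P) (envIncl 𝕜 E EP P))
    (homAct ρV ρW U)

variable (E) in
/-- The class in `(𝔘(𝔤) ⊗ 𝔘(𝔤)) ⊗_{𝔘(𝔭) ⊗ 𝔘(𝔭)} Hom(V ⊗ W, U)` of an element of the tensor product
over `𝕜`. -/
noncomputable def biVermaMk : (Env 𝕜 E G ⊗[𝕜] Env 𝕜 E G) ⊗[𝕜] (V ⊗[𝕜] W →ₗ[𝕜] U) →ₗ[𝕜] BiVermaHom E U ρV ρW :=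
  Submodule.mkQ _

/-- The action `p.T = p ∘ T ∘ (p⁻¹ ⊗ p⁻¹)` of `P` on `Hom(V ⊗ W, U)`. -/
noncomputable def conjHom (p : P) : (V ⊗[𝕜] W →ₗ[𝕜] U) →ₗ[𝕜] (V ⊗[𝕜] W →ₗ[𝕜] U) where
  toFun T := ρU.toRep p ∘ₗ T ∘ₗ TensorProduct.map (ρV.toRep p⁻¹) (ρW.toRep p⁻¹)
  map_add' _ _ := by simp [LinearMap.add_comp, LinearMap.comp_add]
  map_smul' _ _ := by simp [LinearMap.smul_comp, LinearMap.comp_smul]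

theorem conjHom_homAct (p : P) (y : Env 𝕜 EP P ⊗[𝕜] Env 𝕜 EP P) (T : V ⊗[𝕜] W →ₗ[𝕜] U) :
    conjHom ρV ρW ρU p (homAct ρV ρW U y T) =
      homAct ρV ρW U (Algebra.TensorProduct.map (adEnv 𝕜 EP p) (adEnv 𝕜 EP p) y)
        (conjHom ρV ρW ρU p T) := by
  induction y using TensorProduct.induction_on with
  | zero => simp
  | tmul y₁ y₂ =>
    ext v w
    change ρU.toRep p (homAct ρV ρW U (y₁ ⊗ₜ y₂) T (ρV.toRep p⁻¹ v ⊗ₜ ρW.toRep p⁻¹ w)) =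
      homAct ρV ρW U (adEnv 𝕜 EP p y₁ ⊗ₜ adEnv 𝕜 EP p y₂) (conjHom ρV ρW ρU p T) (v ⊗ₜ w)
    rw [homAct_tmul, homAct_tmul, envRep_ad, envRep_ad]
    simp [conjHom]
  | add a b ha hb =>
    rw [map_add, map_add, map_add, LinearMap.add_apply, LinearMap.add_apply, map_add, ha, hb]

variable (E) in
/-- The action of `P` on `(𝔘(𝔤) ⊗ 𝔘(𝔤)) ⊗_{𝔘(𝔭) ⊗ 𝔘(𝔭)} Hom(V ⊗ W, U)`:
`p.(u₁ ⊗ u₂ ⊗ T) = Ad(p) u₁ ⊗ Ad(p) u₂ ⊗ p.T`. -/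
noncomputable def biVermaAct (p : P) : BiVermaHom E U ρV ρW →ₗ[𝕜] BiVermaHom E U ρV ρW :=
  Submodule.mapQ _ _
    (TensorProduct.map
      (Algebra.TensorProduct.map (adEnv 𝕜 E (p : G)) (adEnv 𝕜 E (p : G))).toLinearMap
      (conjHom ρV ρW ρU p))
    (balancedRel_le_comap _ _ _
      (Algebra.TensorProduct.map (adEnv 𝕜 EP p) (adEnv 𝕜 EP p)) _
      (fun y => by
        induction y using TensorProduct.induction_on with
        | zero => simp
        | tmul y₁ y₂ => simp [envIncl_ad]
        | add a b ha hb => rw [map_add, map_add, map_add, map_add, ha, hb])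
      (conjHom_homAct ρV ρW ρU p))

variable (E) in
/-- The `P`-invariant elements of `(𝔘(𝔤) ⊗ 𝔘(𝔤)) ⊗_{𝔘(𝔭) ⊗ 𝔘(𝔭)} Hom(V ⊗ W, U)`. -/
def biVermaInvariants : Submodule 𝕜 (BiVermaHom E U ρV ρW) where
  carrier := {m | ∀ p : P, biVermaAct E ρV ρW ρU p m = m}
  zero_mem' p := map_zero _
  add_mem' ha hb p := by rw [map_add, ha p, hb p]
  smul_mem' c a ha p := by rw [map_smul, ha p]
end subgroup

section functions
open TopologicalSpace
variable {𝕜 : Type*} [RCLike 𝕜] {E : Type*} [NormedAddCommGroup E] [NormedSpace 𝕜 E]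
  [CompleteSpace E]
  {G : Type*} [TopologicalSpace G] [ChartedSpace E G] [Group G] [LieGroup 𝓘(𝕜, E) ∞ G]
  {F : Type*} [NormedAddCommGroup F] [NormedSpace 𝕜 F]

variable (𝕜 E F) in
/-- The smooth (holomorphic, if `𝕜 = ℂ`) functions `O → F` on an open subset `O` of `G`, each one
represented by its extension by zero to `G`. -/
def smoothFn (O : Opens G) : Submodule 𝕜 (G → F) where
  carrier := {f | ContMDiffOn 𝓘(𝕜, E) 𝓘(𝕜, F) ∞ f O ∧ ∀ g ∉ O, f g = 0}
  zero_mem' := ⟨contMDiffOn_const, fun _ _ => rfl⟩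
  add_mem' ha hb := ⟨ha.1.add hb.1, fun g hg => by simp [ha.2 g hg, hb.2 g hg]⟩
  smul_mem' c f hf := ⟨(c • ContinuousLinearMap.id 𝕜 F).contMDiff.comp_contMDiffOn hf.1, fun g hg => by simp [hf.2 g hg]⟩

/-- The operator `r(X)` on smooth functions on `O`. -/
noncomputable def rightLin (O : Opens G) (X : LieAlg 𝕜 E G) :
    smoothFn 𝕜 E F O →ₗ[𝕜] smoothFn 𝕜 E F O where
  toFun f := ⟨(O : Set G).indicator (rightDeriv X (f : G → F)),
    (contMDiffOn_rightDeriv X O.isOpen f.2.1).congr fun g hg => Set.indicator_of_mem hg _,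
    fun g hg => Set.indicator_of_notMem hg _⟩
  map_add' f f' := by
    ext g
    by_cases hg : g ∈ (O : Set G)
    · have h : ∀ f : smoothFn 𝕜 E F O, MDifferentiableAt 𝓘(𝕜, E) 𝓘(𝕜, F) (f : G → F) g := fun f =>
        (f.2.1.contMDiffAt (O.isOpen.mem_nhds hg)).mdifferentiableAt (by decide)
      simp [Set.indicator_of_mem hg, rightDeriv_add X (h f) (h f')]
    · simp [Set.indicator_of_notMem hg]
  map_smul' c f := by
    ext g
    by_cases hg : g ∈ (O : Set G)
    · have h : MDifferentiableAt 𝓘(𝕜, E) 𝓘(𝕜, F) (f : G → F) g :=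
        (f.2.1.contMDiffAt (O.isOpen.mem_nhds hg)).mdifferentiableAt (by decide)
      have := rightDeriv_clm X (c • ContinuousLinearMap.id 𝕜 F) h
      simp only [SetLike.val_smul, RingHom.id_apply, Pi.smul_apply, Set.indicator_of_mem hg]
      exact this
    · simp [Set.indicator_of_notMem hg]

theorem rightLin_apply (O : Opens G) (X : LieAlg 𝕜 E G) (f : smoothFn 𝕜 E F O) {g : G}
    (hg : g ∈ O) : (rightLin O X f : G → F) g = rightDeriv X (f : G → F) g :=
  Set.indicator_of_mem (s := (O : Set G)) hg _

variable (𝕜 E F) in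
/-- The representation `r` of the Lie algebra on smooth functions on `O`. -/
noncomputable def rightLie (O : Opens G) : LieAlg 𝕜 E G →ₗ⁅𝕜⁆ Module.End 𝕜 (smoothFn 𝕜 E F O) where
  toFun X := rightLin O X
  map_add' X Y := by
    ext f g
    by_cases hg : g ∈ O
    · rw [rightLin_apply O _ _ hg, LinearMap.add_apply, Submodule.coe_add, Pi.add_apply,
        rightLin_apply O _ _ hg, rightLin_apply O _ _ hg]
      exact (dirDeriv _ _).map_add X Y
    · rw [(rightLin O _ f).2.2 g hg]
      exact (((rightLin O X + rightLin O Y : Module.End 𝕜 _) f).2.2 g hg).symm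
  map_smul' c X := by
    ext f g
    by_cases hg : g ∈ O
    · rw [rightLin_apply O _ _ hg, LinearMap.smul_apply, Submodule.coe_smul, Pi.smul_apply,
        RingHom.id_apply, rightLin_apply O _ _ hg]
      exact (dirDeriv _ _).map_smul c X
    · rw [(rightLin O _ f).2.2 g hg, (((RingHom.id 𝕜) c • rightLin O X) f).2.2 g hg]
  map_lie' {X Y} := by
    ext f g
    by_cases hg : g ∈ O
    · have h : ∀ X Y : LieAlg 𝕜 E G, (rightLin O X (rightLin O Y f) : G → F) g =
          rightDeriv X (rightDeriv Y (f : G → F)) g := by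
        intro X Y
        rw [rightLin_apply O _ _ hg]
        exact rightDeriv_congr X O.isOpen (fun y hy => rightLin_apply O Y f hy) hg
      rw [rightLin_apply O _ _ hg, LieRing.of_associative_ring_bracket, LinearMap.sub_apply,
        Submodule.coe_sub, Pi.sub_apply, Module.End.mul_apply, Module.End.mul_apply, h, h,
        rightDeriv_lie X Y O.isOpen f.2.1 hg]
    · rw [(rightLin O _ f).2.2 g hg, ((⁅rightLin O X, rightLin O Y⁆ : Module.End 𝕜 _) f).2.2 g hg]

variable (𝕜 E F) in
/-- The action `r` of the enveloping algebra on smooth functions on `O`, by left invariant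
differential operators. -/
noncomputable def rightAct (O : Opens G) : Env 𝕜 E G →ₐ[𝕜] Module.End 𝕜 (smoothFn 𝕜 E F O) :=
  UniversalEnvelopingAlgebra.lift 𝕜 (rightLie 𝕜 E F O)

variable {V : Type*} [NormedAddCommGroup V] [NormedSpace 𝕜 V]
  {W : Type*} [NormedAddCommGroup W] [NormedSpace 𝕜 W]
  {U : Type*} [NormedAddCommGroup U] [NormedSpace 𝕜 U]

/-- The linear map `u ↦ (r(u) f)(g)`. -/
noncomputable def evalJet {O : Opens G} (f : smoothFn 𝕜 E F O) (g : G) : Env 𝕜 E G →ₗ[𝕜] F where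
  toFun u := (rightAct 𝕜 E F O u f : G → F) g
  map_add' _ _ := by simp
  map_smul' _ _ := by simp

variable (U) in
/-- For fixed `φ`, `ψ` and `g`, the linear map `u₁ ⊗ u₂ ⊗ T ↦ T((r(u₁) φ)(g) ⊗ (r(u₂) ψ)(g))`. -/
noncomputable def biDiff {O : Opens G} (φ : smoothFn 𝕜 E V O) (ψ : smoothFn 𝕜 E W O) (g : G) :
    (Env 𝕜 E G ⊗[𝕜] Env 𝕜 E G) ⊗[𝕜] (V ⊗[𝕜] W →ₗ[𝕜] U) →ₗ[𝕜] U :=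
  TensorProduct.lift ((LinearMap.id (M := V ⊗[𝕜] W →ₗ[𝕜] U)).flip ∘ₗ
    TensorProduct.map (evalJet φ g) (evalJet ψ g))

theorem biDiff_tmul {O : Opens G} (φ : smoothFn 𝕜 E V O) (ψ : smoothFn 𝕜 E W O) (g : G)
    (u₁ u₂ : Env 𝕜 E G) (T : V ⊗[𝕜] W →ₗ[𝕜] U) :
    biDiff U φ ψ g ((u₁ ⊗ₜ u₂) ⊗ₜ T) =
      T ((rightAct 𝕜 E V O u₁ φ : G → V) g ⊗ₜ (rightAct 𝕜 E W O u₂ ψ : G → W) g) := rfl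
end functions

section pairings
open TopologicalSpace
variable {𝕜 : Type*} [RCLike 𝕜] {E : Type*} [NormedAddCommGroup E] [NormedSpace 𝕜 E]
  [CompleteSpace E] {EP : Type*} [NormedAddCommGroup EP] [NormedSpace 𝕜 EP] [CompleteSpace EP]
  {G : Type*} [TopologicalSpace G] [ChartedSpace E G] [Group G] [LieGroup 𝓘(𝕜, E) ∞ G]
  {P : Subgroup G} [ChartedSpace EP P] [LieGroup 𝓘(𝕜, EP) ∞ P]
  {V : Type*} [NormedAddCommGroup V] [NormedSpace 𝕜 V]
  {W : Type*} [NormedAddCommGroup W] [NormedSpace 𝕜 W]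
  {U : Type*} [NormedAddCommGroup U] [NormedSpace 𝕜 U]

/-- The preimage in `G` of an open subset of `G ⧸ P`. -/
def liftOpens (O : Opens (G ⧸ P)) : Opens G :=
  ⟨{g | (g : G ⧸ P) ∈ O}, O.isOpen.preimage continuous_quot_mk⟩

variable (E) in
/-- The sections over `O ⊆ G ⧸ P` of the bundle associated to `ρ`: the smooth (holomorphic) functions
`s` on the preimage of `O` in `G` with `s(g p) = ρ(p)⁻¹ s(g)`, extended by zero to `G`. -/
def sections (ρ : SmoothRep 𝕜 EP P V) (O : Opens (G ⧸ P)) : Submodule 𝕜 (G → V) where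
  carrier := {s | s ∈ smoothFn 𝕜 E V (liftOpens O) ∧ ∀ (g : G) (p : P), s (g * p) = ρ.toRep p⁻¹ (s g)}
  zero_mem' := ⟨Submodule.zero_mem _, fun _ _ => by simp⟩
  add_mem' ha hb := ⟨Submodule.add_mem _ ha.1 hb.1, fun g p => by simp [ha.2 g p, hb.2 g p]⟩
  smul_mem' c f hf := ⟨Submodule.smul_mem _ c hf.1, fun g p => by simp [hf.2 g p]⟩

variable {ρV : SmoothRep 𝕜 EP P V} {ρW : SmoothRep 𝕜 EP P W} {ρU : SmoothRep 𝕜 EP P U}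

/-- A section, viewed as a smooth function on the preimage of its domain. -/
def sectionFn {O : Opens (G ⧸ P)} (s : sections E ρV O) : smoothFn 𝕜 E V (liftOpens O) :=
  ⟨s, s.2.1⟩

/-- Restriction of sections to a smaller open set. -/
noncomputable def restrictSection {O O' : Opens (G ⧸ P)} (h : O' ≤ O) :
    sections E ρV O →ₗ[𝕜] sections E ρV O' where
  toFun s := ⟨(liftOpens O' : Set G).indicator (s : G → V),
    ⟨(s.2.1.1.mono fun g hg => h hg).congr fun g hg => Set.indicator_of_mem hg _,
      fun g hg => Set.indicator_of_notMem hg _⟩,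
    fun g p => by
      have hp : (g * p ∈ (liftOpens O' : Set G)) ↔ g ∈ (liftOpens O' : Set G) := by
        change ((g * p : G) : G ⧸ P) ∈ O' ↔ (g : G ⧸ P) ∈ O'
        rw [QuotientGroup.mk_mul_of_mem g p.2]
      by_cases hg : g ∈ (liftOpens O' : Set G)
      · rw [Set.indicator_of_mem hg, Set.indicator_of_mem (hp.2 hg), s.2.2 g p]
      · rw [Set.indicator_of_notMem hg, Set.indicator_of_notMem (fun h => hg (hp.1 h)), map_zero]⟩
  map_add' s t := Subtype.ext (Set.indicator_add _ _ _)
  map_smul' c s := Subtype.ext (Set.indicator_const_smul _ c _)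

variable (𝕜 E) in
/-- The translate `g • O` of an open subset `O` of `G ⧸ P`. -/
def translateOpens (g : G) (O : Opens (G ⧸ P)) : Opens (G ⧸ P) :=
  ⟨{x | g⁻¹ • x ∈ O}, by
    have := topologicalGroup_of_lieGroup 𝓘(𝕜, E) ∞ (G := G)
    exact O.isOpen.preimage (continuous_const_smul g⁻¹)⟩

/-- Left translation `(l_g s)(h) = s(g⁻¹ h)`, mapping sections over `O` to sections over `g • O`. -/
def translateSection (g : G) {O : Opens (G ⧸ P)} :
    sections E ρV O →ₗ[𝕜] sections E ρV (translateOpens 𝕜 E g O) where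
  toFun s := ⟨fun h => (s : G → V) (g⁻¹ * h),
    ⟨s.2.1.1.comp (contMDiff_mul_left (a := g⁻¹)).contMDiffOn (fun _ hh => hh),
      fun h hh => s.2.1.2 _ hh⟩,
    fun h p => by
      change (s : G → V) (g⁻¹ * (h * p)) = _
      rw [← mul_assoc, s.2.2]⟩
  map_add' _ _ := rfl
  map_smul' _ _ := rfl

variable (𝕜 E EP P) in
/-- A coordinate system on an open subset of `G ⧸ P` together with a local trivialization of the
principal bundle `G → G ⧸ P` over it: a map `s` from an open set `Ω ⊆ 𝕜ⁿ` to `G` such that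
`(x, p) ↦ s(x) p` is a diffeomorphism (biholomorphism, if `𝕜 = ℂ`) from `Ω × P` onto an open
subset of `G`. It trivializes every associated bundle over the image of `Ω` in `G ⧸ P`: the section
given by the equivariant function `φ` becomes the function `φ ∘ s` on `Ω`. -/
structure LocalTriv (n : ℕ) where
  domain : Opens (Fin n → 𝕜)
  toFun : (Fin n → 𝕜) → G
  injOn : Set.InjOn (fun q : (Fin n → 𝕜) × P => toFun q.1 * q.2) {q | q.1 ∈ domain}
  isLocalDiffeomorphAt : ∀ x ∈ domain, ∀ p : P,
    IsLocalDiffeomorphAt (𝓘(𝕜, Fin n → 𝕜).prod 𝓘(𝕜, EP)) 𝓘(𝕜, E) ∞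
      (fun q : (Fin n → 𝕜) × P => toFun q.1 * q.2) (x, p)

/-- The partial derivative `∂^|α| f / ∂x^α` for a multi-index `α`. -/
noncomputable def partialDeriv {n : ℕ} (α : Fin n → ℕ) (f : (Fin n → 𝕜) → V) : (Fin n → 𝕜) → V :=
  (List.finRange n).foldr
    (fun i u => (fun (v : (Fin n → 𝕜) → V) x => fderiv 𝕜 v x (Pi.single i 1))^[α i] u) f

/-- Finite families of coefficient functions `a_{α,β} : 𝕜ⁿ → Hom(V ⊗ W, U)`, indexed by pairs of
multi-indices. -/
abbrev Coeffs (𝕜 V W U : Type*) [RCLike 𝕜] [NormedAddCommGroup V] [NormedSpace 𝕜 V]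
    [NormedAddCommGroup W] [NormedSpace 𝕜 W] [NormedAddCommGroup U] [NormedSpace 𝕜 U] (n : ℕ) :=
  ((Fin n → ℕ) × (Fin n → ℕ)) →₀ ((Fin n → 𝕜) → (V ⊗[𝕜] W →ₗ[𝕜] U))

/-- All coefficients are smooth (holomorphic) on `Ω`. -/
def Coeffs.SmoothOn {n : ℕ} (a : Coeffs 𝕜 V W U n) (Ω : Set (Fin n → 𝕜)) : Prop :=
  ∀ αβ t, ContDiffOn 𝕜 ∞ (fun x => a αβ x t) Ω

/-- `∑_{α,β} a_{α,β}(x) (∂^α φ(x) ⊗ ∂^β ψ(x))`. -/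
noncomputable def Coeffs.eval {n : ℕ} (a : Coeffs 𝕜 V W U n) (φ : (Fin n → 𝕜) → V)
    (ψ : (Fin n → 𝕜) → W) (x : Fin n → 𝕜) : U :=
  a.sum fun αβ c => c x (partialDeriv αβ.1 φ x ⊗ₜ partialDeriv αβ.2 ψ x)

theorem Coeffs.eval_add {n : ℕ} (a b : Coeffs 𝕜 V W U n) (φ : (Fin n → 𝕜) → V)
    (ψ : (Fin n → 𝕜) → W) (x : Fin n → 𝕜) :
    Coeffs.eval (a + b) φ ψ x = Coeffs.eval a φ ψ x + Coeffs.eval b φ ψ x :=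
  Finsupp.sum_add_index' (by simp) (by simp)

theorem Coeffs.eval_smul {n : ℕ} (c : 𝕜) (a : Coeffs 𝕜 V W U n) (φ : (Fin n → 𝕜) → V)
    (ψ : (Fin n → 𝕜) → W) (x : Fin n → 𝕜) :
    Coeffs.eval (c • a) φ ψ x = c • Coeffs.eval a φ ψ x := by
  unfold Coeffs.eval
  rw [Finsupp.sum_smul_index' (by simp), Finsupp.smul_sum]
  simp

/-! ### Pairings of local sections -/

variable (E ρV ρW ρU) in
/-- Families of bilinear maps `Γ(O, V) × Γ(O, W) → Γ(O, U)`, one for every open `O ⊆ G ⧸ P`. -/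
abbrev LocalPairing : Type _ :=
  (O : Opens (G ⧸ P)) → sections E ρV O →ₗ[𝕜] sections E ρW O →ₗ[𝕜] sections E ρU O

/-- Compatibility with restriction to smaller open sets. -/
def IsNaturalPairing (B : LocalPairing E ρV ρW ρU) : Prop :=
  ∀ (O O' : Opens (G ⧸ P)) (h : O' ≤ O) (φ : sections E ρV O) (ψ : sections E ρW O),
    B O' (restrictSection h φ) (restrictSection h ψ) = restrictSection h (B O φ ψ)

/-- In each local trivialization the pairing is a bilinear differential pairing. -/
def IsDifferentialPairing (B : LocalPairing E ρV ρW ρU) : Prop :=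
  ∀ (n : ℕ) (τ : LocalTriv 𝕜 E EP P n), ∃ a : Coeffs 𝕜 V W U n, a.SmoothOn τ.domain ∧
    ∀ (O : Opens (G ⧸ P)) (φ : sections E ρV O) (ψ : sections E ρW O), ∀ x ∈ τ.domain,
      τ.toFun x ∈ liftOpens O → (B O φ ψ : G → U) (τ.toFun x) =
        a.eval (fun y => (φ : G → V) (τ.toFun y)) (fun y => (ψ : G → W) (τ.toFun y)) x

/-- `B(l_g φ, l_g ψ) = l_g B(φ, ψ)`. -/
def IsInvariantPairing (B : LocalPairing E ρV ρW ρU) : Prop :=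
  ∀ (g : G) (O : Opens (G ⧸ P)) (φ : sections E ρV O) (ψ : sections E ρW O),
    B (translateOpens 𝕜 E g O) (translateSection g φ) (translateSection g ψ) =
      translateSection g (B O φ ψ)

variable (E ρV ρW ρU) in
/-- The space of `G`-invariant bilinear differential pairings of (local) sections. -/
def invariantPairings : Submodule 𝕜 (LocalPairing E ρV ρW ρU) where
  carrier := {B | IsNaturalPairing B ∧ IsDifferentialPairing B ∧ IsInvariantPairing B}
  zero_mem' := ⟨fun _ _ h φ ψ => (map_zero (restrictSection h)).symm,
    fun n τ => ⟨0, fun _ _ => contDiffOn_const, fun _ _ _ _ _ _ => rfl⟩,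
    fun g _ _ _ => (map_zero (translateSection g)).symm⟩
  add_mem' {B C} hB hC :=
    ⟨fun O O' h φ ψ => (congrArg₂ (· + ·) (hB.1 O O' h φ ψ) (hC.1 O O' h φ ψ)).trans
      (map_add (restrictSection h) _ _).symm,
    fun n τ => by
      obtain ⟨a, ha, ha'⟩ := hB.2.1 n τ
      obtain ⟨b, hb, hb'⟩ := hC.2.1 n τ
      refine ⟨a + b, fun αβ t => (ha αβ t).add (hb αβ t), fun O φ ψ x hx hxO => ?_⟩
      rw [Coeffs.eval_add, ← ha' O φ ψ x hx hxO, ← hb' O φ ψ x hx hxO]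
      rfl,
    fun g O φ ψ => (congrArg₂ (· + ·) (hB.2.2 g O φ ψ) (hC.2.2 g O φ ψ)).trans
      (map_add (translateSection g) _ _).symm⟩
  smul_mem' c B hB :=
    ⟨fun O O' h φ ψ => (congrArg (c • ·) (hB.1 O O' h φ ψ)).trans
      (map_smul (restrictSection h) c _).symm,
    fun n τ => by
      obtain ⟨a, ha, ha'⟩ := hB.2.1 n τ
      refine ⟨c • a, fun αβ t => contDiffOn_const.smul (ha αβ t), fun O φ ψ x hx hxO => ?_⟩
      rw [Coeffs.eval_smul, ← ha' O φ ψ x hx hxO]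
      rfl,
    fun g O φ ψ => (congrArg (c • ·) (hB.2.2 g O φ ψ)).trans
      (map_smul (translateSection g) c _).symm⟩

/-! ### Pairings of global sections -/

/-- Left translation `(l_g s)(h) = s(g⁻¹ h)` of global sections. -/
def translateGlobal (g : G) :
    sections E ρV (⊤ : Opens (G ⧸ P)) →ₗ[𝕜] sections E ρV (⊤ : Opens (G ⧸ P)) where
  toFun s := ⟨fun h => (s : G → V) (g⁻¹ * h),
    ⟨s.2.1.1.comp (contMDiff_mul_left (a := g⁻¹)).contMDiffOn (fun _ _ => trivial),
      fun _ hh => (hh trivial).elim⟩,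
    fun h p => by
      change (s : G → V) (g⁻¹ * (h * p)) = _
      rw [← mul_assoc, s.2.2]⟩
  map_add' _ _ := rfl
  map_smul' _ _ := rfl

variable (E ρV ρW ρU) in
/-- Bilinear maps `Γ(V) × Γ(W) → Γ(U)` on the spaces of global sections over `G ⧸ P`. -/
abbrev GlobalPairing : Type _ :=
  sections E ρV (⊤ : Opens (G ⧸ P)) →ₗ[𝕜] sections E ρW (⊤ : Opens (G ⧸ P)) →ₗ[𝕜]
    sections E ρU (⊤ : Opens (G ⧸ P))

/-- In each local trivialization the pairing is a bilinear differential pairing. -/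
def IsDifferentialGlobal (B : GlobalPairing E ρV ρW ρU) : Prop :=
  ∀ (n : ℕ) (τ : LocalTriv 𝕜 E EP P n), ∃ a : Coeffs 𝕜 V W U n, a.SmoothOn τ.domain ∧
    ∀ (φ : sections E ρV (⊤ : Opens (G ⧸ P))) (ψ : sections E ρW (⊤ : Opens (G ⧸ P))),
      ∀ x ∈ τ.domain, (B φ ψ : G → U) (τ.toFun x) =
        a.eval (fun y => (φ : G → V) (τ.toFun y)) (fun y => (ψ : G → W) (τ.toFun y)) x

/-- `B(l_g φ, l_g ψ) = l_g B(φ, ψ)` for global sections. -/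
def IsInvariantGlobal (B : GlobalPairing E ρV ρW ρU) : Prop :=
  ∀ (g : G) (φ : sections E ρV (⊤ : Opens (G ⧸ P))) (ψ : sections E ρW (⊤ : Opens (G ⧸ P))),
    B (translateGlobal g φ) (translateGlobal g ψ) = translateGlobal g (B φ ψ)

variable (E ρV ρW ρU) in
/-- The space of `G`-invariant bilinear differential pairings of global sections. -/
def globalInvariantPairings : Submodule 𝕜 (GlobalPairing E ρV ρW ρU) where
  carrier := {B | IsDifferentialGlobal B ∧ IsInvariantGlobal B}
  zero_mem' := ⟨fun n τ => ⟨0, fun _ _ => contDiffOn_const, fun _ _ _ _ => rfl⟩,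
    fun g _ _ => (map_zero (translateGlobal g)).symm⟩
  add_mem' {B C} hB hC :=
    ⟨fun n τ => by
      obtain ⟨a, ha, ha'⟩ := hB.1 n τ
      obtain ⟨b, hb, hb'⟩ := hC.1 n τ
      refine ⟨a + b, fun αβ t => (ha αβ t).add (hb αβ t), fun φ ψ x hx => ?_⟩
      rw [Coeffs.eval_add, ← ha' φ ψ x hx, ← hb' φ ψ x hx]
      rfl,
    fun g φ ψ => (congrArg₂ (· + ·) (hB.2 g φ ψ) (hC.2 g φ ψ)).trans
      (map_add (translateGlobal g) _ _).symm⟩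
  smul_mem' c B hB :=
    ⟨fun n τ => by
      obtain ⟨a, ha, ha'⟩ := hB.1 n τ
      refine ⟨c • a, fun αβ t => contDiffOn_const.smul (ha αβ t), fun φ ψ x hx => ?_⟩
      rw [Coeffs.eval_smul, ← ha' φ ψ x hx]
      rfl,
    fun g φ ψ => (congrArg (c • ·) (hB.2 g φ ψ)).trans
      (map_smul (translateGlobal g) c _).symm⟩

end pairings
end

end BiPairing

open BiPairing

/-! By left invariance a pairing is determined by its values at the identity, and there a bilinear
differential operator sees only the jets of `φ` and `ψ`. In a local trivialization `s` with `s(0) =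
1`, the partial derivatives of `φ ∘ s` at `0` are values of `r(u) φ` with `u ∈ 𝔘(𝔤)`, so the value
of the pairing at `1` is given by some `t ∈ 𝔘(𝔤) ⊗ 𝔘(𝔤) ⊗ Hom(V ⊗ W, E)`
(`LocalTriv.exists_biDiff_eq_eval`). Operators `r(u)` commute with left translations, so the same
`t` gives the pairing everywhere.

Conversely, each `r(u)` acts on sections, in a trivialization, with smooth coefficients
(`LocalTriv.isDiffOp_evalJet`): at `s(x)` a vector of `𝔤` splits into a part tangent to `s` and a
part in `𝔭`, and `𝔭` acts on sections algebraically. More precisely, differentiating the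
equivariance gives `r(u y) φ = λ(y⁰) r(u) φ` for `y ∈ 𝔘(𝔭)` (`evalJet_section_mul`). These are the
relations of the balanced tensor product, so only the class of `t` matters (`biDiff_balanced`).
Right translation by `p ∈ P` corresponds to the action of `p` on `t` (`biDiff_right`), so a
`P`-invariant class produces equivariant functions.

The main point is that a class which acts by zero is zero (`LocalTriv.biVermaMk_eq_zero`). For this
only the spanning half of the Poincaré–Birkhoff–Witt theorem is needed: modulo the relations `t` is
a sum of `x^α ⊗ x^β ⊗ T_{αβ}`, with ordered monomials in vectors spanning a complement of `𝔭`
(`span_envMono_tmul`). A test section `h^m v`, where `h` is a linear form `l` in the coordinates, is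
annihilated at `1` by monomials of degree less than `m`, and a monomial `x^α` of degree `m` sends it
to `m! l^α v`. Testing against a term of maximal total degree yields a polynomial identity in two
linear forms, which forces the coefficients of that degree to vanish. Applied to `p.t - t`, the same
result shows that the class belonging to an invariant pairing is `P`-invariant.

For global sections in the real case, a bump function extends the germ along `P` of a local section
to a global section (`LocalTriv.exists_global_section`); the extension by zero is smooth because `P`
is closed. -/

namespace BiPairing
set_option linter.unusedSectionVars false

/-! ### Spanning by ordered monomials modulo a Lie subalgebra -/

section filtration
attribute [local instance 100] LieRing.ofAssociativeRing
variable {R : Type*} [Field R] {L L' : Type*} [LieRing L] [LieAlgebra R L]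
  [LieRing L'] [LieAlgebra R L'] (j : L' →ₗ⁅R⁆ L)

/-- The span of the products of at most `n` elements of the Lie algebra and an element of the
enveloping algebra of the subalgebra. -/
noncomputable def relFil (n : ℕ) : Submodule R (UniversalEnvelopingAlgebra R L) :=
  (1 ⊔ LinearMap.range ((UniversalEnvelopingAlgebra.ι R : L →ₗ⁅R⁆ _) : L →ₗ[R] _)) ^ n *
    Subalgebra.toSubmodule (envMap j).range

variable {j}

theorem relFil_zero_mem (y : UniversalEnvelopingAlgebra R L') : envMap j y ∈ relFil j 0 := by
  rw [relFil, pow_zero, one_mul]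
  exact ⟨y, rfl⟩

theorem mem_relFil_zero {u : UniversalEnvelopingAlgebra R L} (hu : u ∈ relFil j 0) :
    ∃ y, envMap j y = u := by
  rw [relFil, pow_zero, one_mul] at hu
  exact hu

theorem relFil_succ (n : ℕ) : relFil j (n + 1) =
    (1 ⊔ LinearMap.range ((UniversalEnvelopingAlgebra.ι R : L →ₗ⁅R⁆ _) : L →ₗ[R] _)) *
      relFil j n := by
  rw [relFil, pow_succ', mul_assoc, relFil]

theorem relFil_mono : Monotone (relFil j) := by
  refine monotone_nat_of_le_succ fun n => ?_
  rw [relFil_succ]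
  calc relFil j n = 1 * relFil j n := (one_mul _).symm
    _ ≤ _ := mul_le_mul' le_sup_left le_rfl

theorem ι_mul_mem_relFil {n : ℕ} (X : L) {s : UniversalEnvelopingAlgebra R L}
    (hs : s ∈ relFil j n) : UniversalEnvelopingAlgebra.ι R X * s ∈ relFil j (n + 1) := by
  rw [relFil_succ]
  exact Submodule.mul_mem_mul (Submodule.mem_sup_right ⟨X, rfl⟩) hs

theorem relFil_succ_induction {n : ℕ} {C : UniversalEnvelopingAlgebra R L → Prop}
    (h0 : ∀ s ∈ relFil j n, C s)
    (h1 : ∀ X : L, ∀ s ∈ relFil j n, C (UniversalEnvelopingAlgebra.ι R X * s))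
    (hadd : ∀ s t, C s → C t → C (s + t)) {u} (hu : u ∈ relFil j (n + 1)) : C u := by
  rw [relFil_succ] at hu
  refine Submodule.mul_induction_on hu ?_ hadd
  intro a ha s hs
  obtain ⟨a1, ha1, a2, ha2, rfl⟩ := Submodule.mem_sup.1 ha
  obtain ⟨c, rfl⟩ := Submodule.mem_one.1 ha1
  obtain ⟨X, rfl⟩ := ha2
  rw [add_mul, ← Algebra.smul_def]
  exact hadd _ _ (h0 _ (Submodule.smul_mem _ _ hs)) (h1 X s hs)

theorem ι_mul_ι (X Y : L) : UniversalEnvelopingAlgebra.ι R X * UniversalEnvelopingAlgebra.ι R Y =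
    UniversalEnvelopingAlgebra.ι R Y * UniversalEnvelopingAlgebra.ι R X +
      UniversalEnvelopingAlgebra.ι R ⁅X, Y⁆ := by
  rw [LieHom.map_lie, LieRing.of_associative_ring_bracket]
  abel

/-- Moving `j Y` to the right past a letter `X` costs only the commutator, which is one letter in
place of two; at the right end it is absorbed by the enveloping algebra of the subalgebra. So the
subalgebra does not raise the degree. -/
theorem ι_sub_mul_mem_relFil {n : ℕ} (Y : L') {s : UniversalEnvelopingAlgebra R L}
    (hs : s ∈ relFil j n) : UniversalEnvelopingAlgebra.ι R (j Y) * s ∈ relFil j n := by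
  induction n generalizing s with
  | zero =>
    obtain ⟨y, rfl⟩ := mem_relFil_zero hs
    rw [← envMap_ι, ← map_mul]
    exact relFil_zero_mem _
  | succ n ih =>
    refine relFil_succ_induction
      (C := fun s => UniversalEnvelopingAlgebra.ι R (j Y) * s ∈ relFil j (n + 1)) ?_ ?_ ?_ hs
    · exact fun s hs => relFil_mono n.le_succ (ih hs)
    · intro X s hs
      rw [← mul_assoc, ι_mul_ι, add_mul, mul_assoc]
      exact add_mem (ι_mul_mem_relFil X (ih hs)) (ι_mul_mem_relFil _ hs)
    · intro s t hs ht
      rw [mul_add]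
      exact add_mem hs ht

/-- Stated for left multiplication, the bound is closed under products. Applied to `1`, it shows
that the filtration exhausts the enveloping algebra. -/
theorem mul_mem_relFil (u : UniversalEnvelopingAlgebra R L) :
    ∃ m, ∀ n, ∀ s ∈ relFil j n, u * s ∈ relFil j (n + m) := by
  induction u using env_induction with
  | halg c =>
    refine ⟨0, fun n s hs => ?_⟩
    rw [← Algebra.smul_def]
    exact Submodule.smul_mem _ _ hs
  | hι X => exact ⟨1, fun n s hs => ι_mul_mem_relFil X hs⟩
  | hadd a b ha hb =>
    obtain ⟨m, hm⟩ := ha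
    obtain ⟨m', hm'⟩ := hb
    refine ⟨m + m', fun n s hs => ?_⟩
    rw [add_mul]
    exact add_mem (relFil_mono (by omega) (hm n s hs)) (relFil_mono (by omega) (hm' n s hs))
  | hmul a b ha hb =>
    obtain ⟨m, hm⟩ := ha
    obtain ⟨m', hm'⟩ := hb
    refine ⟨m' + m, fun n s hs => ?_⟩
    rw [mul_assoc, ← add_assoc]
    exact hm _ _ (hm' n s hs)

variable (j) in
theorem exists_mem_relFil (u : UniversalEnvelopingAlgebra R L) : ∃ n, u ∈ relFil j n := by
  obtain ⟨m, hm⟩ := mul_mem_relFil (j := j) u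
  have := hm 0 1 (by simpa using relFil_zero_mem (j := j) 1)
  exact ⟨0 + m, by simpa using this⟩

variable {d : ℕ} (x : Fin d → L)

/-- The product of the elements of a word in the letters `x i`. -/
noncomputable def envWord (l : List (Fin d)) : UniversalEnvelopingAlgebra R L :=
  (l.map fun i => UniversalEnvelopingAlgebra.ι R (x i)).prod

/-- The ordered monomial in the letters `x i` given by a multiset. -/
noncomputable def envMono (s : Multiset (Fin d)) : UniversalEnvelopingAlgebra R L :=
  envWord x (s.sort (· ≤ ·))

theorem envWord_cons (i : Fin d) (l : List (Fin d)) :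
    envWord (R := R) x (i :: l) = UniversalEnvelopingAlgebra.ι R (x i) * envWord x l := by
  simp [envWord]

theorem envWord_mul_mem_relFil (l : List (Fin d)) (y : UniversalEnvelopingAlgebra R L') :
    envWord x l * envMap j y ∈ relFil j l.length := by
  induction l with
  | nil => simpa [envWord] using relFil_zero_mem y
  | cons i l ih =>
    rw [envWord_cons, mul_assoc]
    exact ι_mul_mem_relFil _ ih

/-- Swapping two neighbours changes a word by the same word with their bracket in place of both,
which has one letter less. The bracket need not be a combination of the `x i`, which is why `relFil`
admits all elements of `L` as letters. -/
theorem envWord_perm {l l' : List (Fin d)} (h : l.Perm l') (y : UniversalEnvelopingAlgebra R L') :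
    ∀ k, l.length ≤ k + 1 →
      envWord x l * envMap j y - envWord x l' * envMap j y ∈ relFil j k := by
  induction h with
  | nil => intro k _; simp
  | @cons i l l' h ih =>
    intro k hk
    rw [envWord_cons, envWord_cons, mul_assoc, mul_assoc, ← mul_sub]
    rcases k with _ | k
    · have : l = [] := List.length_eq_zero_iff.1 (by simpa using hk)
      subst this
      rw [List.nil_perm.1 h]
      simp
    · exact ι_mul_mem_relFil _ (ih k (by simpa using hk))
  | swap i i' l =>
    intro k hk
    simp only [envWord_cons]
    rcases k with _ | k
    · simp at hk
    rw [← sub_mul, ← mul_assoc, ← mul_assoc, ← sub_mul, ι_mul_ι, add_sub_cancel_left, mul_assoc]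
    refine relFil_mono ?_ (ι_mul_mem_relFil _ (envWord_mul_mem_relFil x l y))
    simpa using hk
  | trans h h' ih ih' =>
    intro k hk
    have := add_mem (ih k hk) (ih' k (h.length_eq ▸ hk))
    simpa using this

variable {x}

/-- Split the leading factor by `hx`: a letter `x i` lengthens the word by one, while `j Y` keeps
the degree by `ι_sub_mul_mem_relFil` and is covered by the induction hypothesis. -/
theorem relFil_le_span_envWord (hx : ∀ X : L, ∃ (c : Fin d → R) (Y : L'), X = ∑ i, c i • x i + j Y)
    (k : ℕ) : relFil j k ≤ Submodule.span R
      {u | ∃ (l : List (Fin d)) (y : _), l.length ≤ k ∧ u = envWord x l * envMap j y} := by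
  induction k with
  | zero =>
    intro u hu
    obtain ⟨y, rfl⟩ := mem_relFil_zero hu
    exact Submodule.subset_span ⟨[], y, le_rfl, by simp [envWord]⟩
  | succ k ih =>
    have hmono : Submodule.span R
      {u | ∃ (l : List (Fin d)) (y : _), l.length ≤ k ∧ u = envWord x l * envMap j y} ≤
      Submodule.span R
      {u | ∃ (l : List (Fin d)) (y : _), l.length ≤ k + 1 ∧ u = envWord x l * envMap j y} := by
      refine Submodule.span_mono ?_
      rintro _ ⟨l, y, hl, rfl⟩
      exact ⟨l, y, by omega, rfl⟩
    intro u hu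
    refine relFil_succ_induction (C := fun u => u ∈ Submodule.span R
      {u | ∃ (l : List (Fin d)) (y : _), l.length ≤ k + 1 ∧ u = envWord x l * envMap j y})
      (fun s hs => hmono (ih hs)) ?_ (fun s t hs ht => add_mem hs ht) hu
    · intro X s hs
      obtain ⟨c, Y, rfl⟩ := hx X
      rw [map_add, add_mul, map_sum, Finset.sum_mul]
      refine add_mem (sum_mem fun i _ => ?_) (hmono (ih (ι_sub_mul_mem_relFil Y hs)))
      rw [map_smul, smul_mul_assoc]
      refine Submodule.smul_mem _ _ ?_
      have h2 := Submodule.mem_map_of_mem (f := LinearMap.mulLeft R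
        (UniversalEnvelopingAlgebra.ι R (x i))) (ih hs)
      rw [Submodule.map_span] at h2
      refine Submodule.span_mono ?_ h2
      rintro _ ⟨_, ⟨l, y, hl, rfl⟩, rfl⟩
      exact ⟨i :: l, y, by simpa using hl, by rw [envWord_cons, mul_assoc]; rfl⟩

/-- Ordered monomials in a complement of a subalgebra generate the enveloping algebra as a right
module over the enveloping algebra of the subalgebra. -/
theorem span_envMono (hx : ∀ X : L, ∃ (c : Fin d → R) (Y : L'), X = ∑ i, c i • x i + j Y)
    (u : UniversalEnvelopingAlgebra R L) : u ∈ Submodule.span R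
      {u | ∃ (s : Multiset (Fin d)) (y : _), u = envMono x s * envMap j y} := by
  obtain ⟨k, hk⟩ := exists_mem_relFil j u
  induction k using Nat.strong_induction_on generalizing u with
  | _ k ih =>
    refine Submodule.span_le.2 ?_ (relFil_le_span_envWord hx k hk)
    rintro _ ⟨l, y, hl, rfl⟩
    have h1 : envMono x (l : Multiset (Fin d)) * envMap j y ∈ Submodule.span R
      {u | ∃ (s : Multiset (Fin d)) (y : _), u = envMono x s * envMap j y} :=
      Submodule.subset_span ⟨l, y, rfl⟩
    have hp : l.Perm ((l : Multiset (Fin d)).sort (· ≤ ·)) := by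
      rw [← Multiset.coe_eq_coe, Multiset.sort_eq]
    rcases k with _ | k
    · have : l = [] := List.length_eq_zero_iff.1 (by simpa using hl)
      subst this
      rwa [envMono, List.nil_perm.1 hp] at h1
    -- Sorting a word of length at most `k + 1` leaves an error in `relFil j k`.
    · have h2 := ih k (Nat.lt_succ_self k) _ (envWord_perm (j := j) x hp y k hl)
      have := add_mem h2 h1
      rwa [envMono, sub_add_cancel] at this

/-- The factors `envMap j y` left over by `span_envMono` pass through the balanced tensor product
into `N`. Independence of the monomials is not claimed. -/
theorem span_envMono_tmul
    (hx : ∀ X : L, ∃ (c : Fin d → R) (Y : L'), X = ∑ i, c i • x i + j Y)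
    {N : Type*} [AddCommGroup N] [Module R N]
    (σ : UniversalEnvelopingAlgebra R L' ⊗[R] UniversalEnvelopingAlgebra R L' →ₐ[R] Module.End R N)
    (t : (UniversalEnvelopingAlgebra R L ⊗[R] UniversalEnvelopingAlgebra R L) ⊗[R] N) :
    ∃ c : (Multiset (Fin d) × Multiset (Fin d)) →₀ N,
      t - c.sum (fun s T => (envMono x s.1 ⊗ₜ[R] envMono x s.2) ⊗ₜ[R] T) ∈
        balancedRel (Algebra.TensorProduct.map (envMap j) (envMap j)) σ := by
  classical
  let Θ : ((Multiset (Fin d) × Multiset (Fin d)) →₀ N) →ₗ[R]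
      (UniversalEnvelopingAlgebra R L ⊗[R] UniversalEnvelopingAlgebra R L) ⊗[R] N :=
    Finsupp.lsum R fun s => TensorProduct.mk R _ N (envMono x s.1 ⊗ₜ[R] envMono x s.2)
  suffices h : t ∈ LinearMap.range Θ ⊔
      balancedRel (Algebra.TensorProduct.map (envMap j) (envMap j)) σ by
    obtain ⟨_, ⟨c, rfl⟩, r, hr, rfl⟩ := Submodule.mem_sup.1 h
    refine ⟨c, ?_⟩
    have : Θ c = c.sum (fun s T => (envMono x s.1 ⊗ₜ[R] envMono x s.2) ⊗ₜ[R] T) := rfl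
    rw [← this, add_sub_cancel_left]
    exact hr
  induction t using TensorProduct.induction_on with
  | zero => exact zero_mem _
  | add a b ha hb => exact add_mem ha hb
  | tmul u T =>
    induction u using TensorProduct.induction_on with
    | zero => rw [TensorProduct.zero_tmul]; exact zero_mem _
    | add a b ha hb => rw [TensorProduct.add_tmul]; exact add_mem ha hb
    | tmul u v =>
      induction span_envMono hx u using Submodule.span_induction with
      | zero => rw [TensorProduct.zero_tmul, TensorProduct.zero_tmul]; exact zero_mem _
      | add a b _ _ ha hb =>
        rw [TensorProduct.add_tmul, TensorProduct.add_tmul]; exact add_mem ha hb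
      | smul c a _ ha =>
        rw [← TensorProduct.smul_tmul', ← TensorProduct.smul_tmul']
        exact Submodule.smul_mem _ c ha
      | mem u hu =>
        obtain ⟨s, y, rfl⟩ := hu
        induction span_envMono hx v using Submodule.span_induction with
        | zero => rw [TensorProduct.tmul_zero, TensorProduct.zero_tmul]; exact zero_mem _
        | add a b _ _ ha hb =>
          rw [TensorProduct.tmul_add, TensorProduct.add_tmul]; exact add_mem ha hb
        | smul c a _ ha =>
          rw [TensorProduct.tmul_smul, ← TensorProduct.smul_tmul']
          exact Submodule.smul_mem _ c ha
        | mem v hv =>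
          obtain ⟨s', y', rfl⟩ := hv
          have h1 : ((envMono x s ⊗ₜ[R] envMono x s') *
              Algebra.TensorProduct.map (envMap j) (envMap j) (y ⊗ₜ[R] y')) ⊗ₜ[R] T -
              (envMono x s ⊗ₜ[R] envMono x s') ⊗ₜ[R] σ (y ⊗ₜ[R] y') T ∈
              balancedRel (Algebra.TensorProduct.map (envMap j) (envMap j)) σ :=
            Submodule.subset_span ⟨_, _, _, rfl⟩
          rw [Algebra.TensorProduct.map_tmul, Algebra.TensorProduct.tmul_mul_tmul] at h1
          refine Submodule.mem_sup.2 ⟨_, ⟨Finsupp.single (s, s') (σ (y ⊗ₜ[R] y') T), ?_⟩, _, h1,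
            add_sub_cancel _ _⟩
          simp [Θ]
end filtration

/-! ### Product rules for left invariant derivatives -/

section leibniz
variable {𝕜 : Type*} [RCLike 𝕜] {E : Type*} [NormedAddCommGroup E] [NormedSpace 𝕜 E]
  {F : Type*} [NormedAddCommGroup F] [NormedSpace 𝕜 F]

/-- The chain rule for `y ↦ (y, y)`. Both the product rule for scalar multiples and the derivative
of `p ↦ ρ(p⁻¹)` are deduced from it. -/
theorem dirDeriv_diag {M : Type*} [TopologicalSpace M] [ChartedSpace E M] {f : M × M → F} {x : M}
    (hf : MDifferentiableAt (𝓘(𝕜, E).prod 𝓘(𝕜, E)) 𝓘(𝕜, F) f (x, x))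
    (v : TangentSpace 𝓘(𝕜, E) x) :
    dirDeriv (fun y => f (y, y)) x v =
      dirDeriv (fun y => f (y, x)) x v + dirDeriv (fun y => f (x, y)) x v := by
  have h1 : mfderiv 𝓘(𝕜, E) 𝓘(𝕜, F) (f ∘ fun y => (y, y)) x =
      (mfderiv (𝓘(𝕜, E).prod 𝓘(𝕜, E)) 𝓘(𝕜, F) f (x, x)).comp
        (mfderiv 𝓘(𝕜, E) (𝓘(𝕜, E).prod 𝓘(𝕜, E)) (fun y => (y, y)) x) :=
    mfderiv_comp (I' := 𝓘(𝕜, E).prod 𝓘(𝕜, E)) x hf (mdifferentiableAt_id.prodMk mdifferentiableAt_id)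
  have h2 : mfderiv 𝓘(𝕜, E) (𝓘(𝕜, E).prod 𝓘(𝕜, E)) (fun y : M => (y, y)) x v = (v, v) := by
    have := mfderiv_prodMk (mdifferentiableAt_id (I := 𝓘(𝕜, E)) (x := x))
      (mdifferentiableAt_id (I := 𝓘(𝕜, E)) (x := x))
    rw [mfderiv_id] at this
    exact congrArg (fun L : E →L[𝕜] E × E => L v) this
  change mfderiv 𝓘(𝕜, E) 𝓘(𝕜, F) (f ∘ fun y => (y, y)) x v = _
  rw [h1]
  refine (congrArg (fun w : E × E =>
    (mfderiv (𝓘(𝕜, E).prod 𝓘(𝕜, E)) 𝓘(𝕜, F) f (x, x) : E × E →L[𝕜] F) w) h2).trans ?_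
  exact mfderiv_prod_eq_add_apply (v := ((v, v) : E × E)) hf

variable {G : Type*} [TopologicalSpace G] [ChartedSpace E G] [Group G] [LieGroup 𝓘(𝕜, E) ∞ G]

theorem rightDeriv_smul (X : LieAlg 𝕜 E G) {c : G → 𝕜} {f : G → F} {g : G}
    (hc : MDifferentiableAt 𝓘(𝕜, E) 𝓘(𝕜, 𝕜) c g) (hf : MDifferentiableAt 𝓘(𝕜, E) 𝓘(𝕜, F) f g) :
    rightDeriv X (fun y => c y • f y) g = c g • rightDeriv X f g + rightDeriv X c g • f g := by
  have h1 : MDifferentiableAt (𝓘(𝕜, E).prod 𝓘(𝕜, E)) 𝓘(𝕜, F)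
      (fun q : G × G => c q.1 • f q.2) (g, g) :=
    MDifferentiableAt.smul (MDifferentiableAt.comp (I' := 𝓘(𝕜, E)) (g, g) hc mdifferentiableAt_fst)
      (MDifferentiableAt.comp (I' := 𝓘(𝕜, E)) (g, g) hf mdifferentiableAt_snd)
  have h2 : MDifferentiableAt 𝓘(𝕜, E) 𝓘(𝕜, F) (fun y => c y • f y) g := hc.smul hf
  have h3 : MDifferentiableAt 𝓘(𝕜, E) 𝓘(𝕜, F) (fun y => c g • f y) g :=
    mdifferentiableAt_const.smul hf
  have h4 : MDifferentiableAt 𝓘(𝕜, E) 𝓘(𝕜, F) (fun y => c y • f g) g :=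
    hc.smul mdifferentiableAt_const
  have h5 := rightDeriv_clm X (c g • ContinuousLinearMap.id 𝕜 F) hf
  have h6 := rightDeriv_clm X (ContinuousLinearMap.toSpanSingleton 𝕜 (f g)) hc
  simp only [smul_apply, ContinuousLinearMap.id_apply,
    ContinuousLinearMap.toSpanSingleton_apply] at h5 h6
  rw [rightDeriv_eq X h2, dirDeriv_diag (f := fun q : G × G => c q.1 • f q.2) h1, ← h5, ← h6,
    rightDeriv_eq X h3, rightDeriv_eq X h4, add_comm]

theorem rightDeriv_const (X : LieAlg 𝕜 E G) (v : F) (g : G) :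
    rightDeriv X (fun _ => v) g = 0 := by
  unfold rightDeriv dirDeriv
  rw [mfderiv_const]
  rfl

/-- `d/dt ρ(exp(-t X)) v = -X.v` at `t = 0`. -/
theorem rightDeriv_rep_inv [CompleteSpace E] [FiniteDimensional 𝕜 F] (ρ : SmoothRep 𝕜 E G F)
    (X : LieAlg 𝕜 E G) (v : F) :
    rightDeriv X (fun p => ρ.toRep p⁻¹ v) 1 = - derivedLin ρ X v := by
  have h1 : MDifferentiableAt (𝓘(𝕜, E).prod 𝓘(𝕜, E)) 𝓘(𝕜, F)
      (fun q : G × G => ρ.toRep (q.1 * q.2⁻¹) v) (1, 1) := by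
    have : ContMDiff (𝓘(𝕜, E).prod 𝓘(𝕜, E)) 𝓘(𝕜, F) ∞
        (fun q : G × G => ρ.toRep (q.1 * q.2⁻¹) v) :=
      (ρ.smooth v).comp ((contMDiff_fst).mul (contMDiff_snd.inv))
    exact this.mdifferentiable (by decide) _
  -- On the diagonal `q * q⁻¹` is constant, so the two partial derivatives, `X.v` and the one
  -- sought, cancel.
  have h2 := dirDeriv_diag h1 X
  have h3 : rightDeriv X (fun q : G => ρ.toRep (q * q⁻¹) v) 1 =
      rightDeriv X (fun q : G => ρ.toRep (q * 1⁻¹) v) 1 +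
      rightDeriv X (fun q : G => ρ.toRep (1 * q⁻¹) v) 1 := by
    simpa only [rightDeriv, one_mul] using h2
  simp only [mul_inv_cancel, rightDeriv_const, inv_one, mul_one, one_mul] at h3
  rw [derivedLin_apply, eq_neg_iff_add_eq_zero, add_comm, ← h3]
end leibniz

/-! ### Jets under linear maps and translations -/

section jets
open TopologicalSpace MulOpposite
variable {𝕜 : Type*} [RCLike 𝕜] {E : Type*} [NormedAddCommGroup E] [NormedSpace 𝕜 E]
  [CompleteSpace E]
  {G : Type*} [TopologicalSpace G] [ChartedSpace E G] [Group G] [LieGroup 𝓘(𝕜, E) ∞ G]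
  {F : Type*} [NormedAddCommGroup F] [NormedSpace 𝕜 F]
  {F' : Type*} [NormedAddCommGroup F'] [NormedSpace 𝕜 F']

theorem smoothFn_mdifferentiableAt {O : Opens G} (f : smoothFn 𝕜 E F O) {g : G} (hg : g ∈ O) :
    MDifferentiableAt 𝓘(𝕜, E) 𝓘(𝕜, F) (f : G → F) g :=
  (f.2.1.contMDiffAt (O.isOpen.mem_nhds hg)).mdifferentiableAt (by decide)

theorem evalJet_one {O : Opens G} (f : smoothFn 𝕜 E F O) (g : G) :
    evalJet f g 1 = (f : G → F) g := by
  simp [evalJet]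

theorem evalJet_algebraMap {O : Opens G} (f : smoothFn 𝕜 E F O) (g : G) (c : 𝕜) :
    evalJet f g (algebraMap 𝕜 _ c) = c • (f : G → F) g := by
  rw [Algebra.algebraMap_eq_smul_one, map_smul, evalJet_one]

theorem evalJet_mul {O : Opens G} (f : smoothFn 𝕜 E F O) (g : G) (u v : Env 𝕜 E G) :
    evalJet f g (u * v) = evalJet (rightAct 𝕜 E F O v f) g u := by
  simp [evalJet]

theorem evalJet_ι {O : Opens G} (f : smoothFn 𝕜 E F O) {g : G} (hg : g ∈ O) (X : LieAlg 𝕜 E G) :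
    evalJet f g (UniversalEnvelopingAlgebra.ι 𝕜 X) = rightDeriv X (f : G → F) g := by
  have : rightAct 𝕜 E F O (UniversalEnvelopingAlgebra.ι 𝕜 X) = rightLin O X :=
    UniversalEnvelopingAlgebra.lift_ι_apply 𝕜 _ X
  rw [← rightLin_apply O X f hg, ← this]
  rfl

theorem evalJet_ι_mul {O : Opens G} (f : smoothFn 𝕜 E F O) {g : G} (hg : g ∈ O)
    (X : LieAlg 𝕜 E G) (u : Env 𝕜 E G) :
    evalJet f g (UniversalEnvelopingAlgebra.ι 𝕜 X * u) =
      rightDeriv X (fun h => evalJet f h u) g := by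
  rw [evalJet_mul, evalJet_ι _ hg]
  rfl

theorem contMDiffOn_evalJet {O : Opens G} (f : smoothFn 𝕜 E F O) (u : Env 𝕜 E G) :
    ContMDiffOn 𝓘(𝕜, E) 𝓘(𝕜, F) ∞ (fun h => evalJet f h u) O :=
  (rightAct 𝕜 E F O u f).2.1

/-- Intertwining relations for left invariant differential operators of order one extend to all
left invariant differential operators. -/
theorem evalJet_intertwine {O O' : Opens G} {m : G → G} (hm : ∀ h ∈ O', m h ∈ O)
    (a : Env 𝕜 E G →ₐ[𝕜] Env 𝕜 E G) (L : F →ₗ[𝕜] F')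
    (hX : ∀ (X : LieAlg 𝕜 E G) (f : smoothFn 𝕜 E F O) (f' : smoothFn 𝕜 E F' O'),
      (∀ k ∈ O', L ((f : G → F) (m k)) = (f' : G → F') k) → ∀ h ∈ O',
        L (rightDeriv X (f : G → F) (m h)) = evalJet f' h (a (UniversalEnvelopingAlgebra.ι 𝕜 X)))
    (u : Env 𝕜 E G) (f : smoothFn 𝕜 E F O) (f' : smoothFn 𝕜 E F' O')
    (hf : ∀ k ∈ O', L ((f : G → F) (m k)) = (f' : G → F') k) {h : G} (hh : h ∈ O') :
    L (evalJet f (m h) u) = evalJet f' h (a u) := by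
  induction u using env_induction generalizing f f' h with
  | halg c => rw [AlgHom.commutes, evalJet_algebraMap, evalJet_algebraMap, map_smul, hf h hh]
  | hι X => rw [evalJet_ι _ (hm h hh), hX X f f' hf h hh]
  | hadd u v hu hv => simp only [map_add, hu f f' hf hh, hv f f' hf hh]
  | hmul u v hu hv =>
    rw [evalJet_mul, map_mul a, evalJet_mul]
    -- The relation is assumed at all points of `O'`, so by `hv` it passes from `f`, `f'` to `r(v)
    -- f`, `r(a v) f'`.
    exact hu _ _ (fun k hk => hv f f' hf hk) hh

theorem evalJet_congr {O O' : Opens G} (hO : O' ≤ O) (f : smoothFn 𝕜 E F O)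
    (f' : smoothFn 𝕜 E F O') (hf : ∀ k ∈ O', (f : G → F) k = (f' : G → F) k)
    {g : G} (hg : g ∈ O') (u : Env 𝕜 E G) : evalJet f g u = evalJet f' g u := by
  refine evalJet_intertwine (m := id) (fun h hh => hO hh) (AlgHom.id _ _) LinearMap.id ?_ u f f'
    hf hg
  intro X f f' hf h hh
  rw [AlgHom.id_apply, evalJet_ι _ hh]
  exact rightDeriv_congr X O'.isOpen hf hh

theorem evalJet_clm {O : Opens G} (L : F →L[𝕜] F') (f : smoothFn 𝕜 E F O)
    (f' : smoothFn 𝕜 E F' O) (hf : ∀ k ∈ O, L ((f : G → F) k) = (f' : G → F') k)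
    {g : G} (hg : g ∈ O) (u : Env 𝕜 E G) : L (evalJet f g u) = evalJet f' g u := by
  refine evalJet_intertwine (m := id) (fun h hh => hh) (AlgHom.id _ _) L.toLinearMap ?_ u f f'
    hf hg
  intro X f f' hf h hh
  rw [AlgHom.id_apply, evalJet_ι _ hh]
  refine (rightDeriv_clm X L (smoothFn_mdifferentiableAt f hh)).symm.trans ?_
  exact rightDeriv_congr X O.isOpen hf hh

/-- Left translations and left invariant fields act from opposite sides, so they commute by
associativity. -/
theorem evalJet_translate {O O' : Opens G} (a : G) (ha : ∀ h ∈ O', a * h ∈ O)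
    (f : smoothFn 𝕜 E F O) (f' : smoothFn 𝕜 E F O')
    (hf : ∀ k ∈ O', (f : G → F) (a * k) = (f' : G → F) k)
    {g : G} (hg : g ∈ O') (u : Env 𝕜 E G) : evalJet f (a * g) u = evalJet f' g u := by
  refine evalJet_intertwine (m := fun h => a * h) ha (AlgHom.id _ _) LinearMap.id ?_ u f f' hf hg
  intro X f f' hf h hh
  rw [AlgHom.id_apply, evalJet_ι _ hh, ← rightDeriv_congr X O'.isOpen hf hh]
  simp [rightDeriv, mul_assoc]

/-- Since `h p exp(tX) = h (p exp(tX) p⁻¹) p`, right translation by `p` turns the field of `X` into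
that of `Ad(p) X`. The map `L` undoes the effect of the translation on values, as `ρ(p)` does for
sections. -/
theorem evalJet_right {O : Opens G} (p : G) (hp : ∀ h ∈ O, h * p ∈ O) (L : F →L[𝕜] F)
    (f : smoothFn 𝕜 E F O) (hf : ∀ k ∈ O, L ((f : G → F) (k * p)) = (f : G → F) k)
    {g : G} (hg : g ∈ O) (u : Env 𝕜 E G) :
    L (evalJet f (g * p) u) = evalJet f g (adEnv 𝕜 E p u) := by
  refine evalJet_intertwine (m := fun h => h * p) hp (adEnv 𝕜 E p) L.toLinearMap ?_ u f f hf hg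
  intro X f f' hf h hh
  rw [adEnv, envMap_ι, evalJet_ι _ hh, ← rightDeriv_congr _ O.isOpen hf hh]
  refine (rightDeriv_clm X L (smoothFn_mdifferentiableAt f (hp h hh))).symm.trans ?_
  have h1 : MDifferentiableAt 𝓘(𝕜, E) 𝓘(𝕜, F) (fun k => (f : G → F) (h * k * p))
      ((MulAut.conj p).toMonoidHom 1) := by
    have h2 : MDifferentiableAt 𝓘(𝕜, E) 𝓘(𝕜, F) (f : G → F) (h * 1 * p) := by
      rw [mul_one]; exact smoothFn_mdifferentiableAt f (hp h hh)
    have h3 : ContMDiff 𝓘(𝕜, E) 𝓘(𝕜, E) ∞ fun k : G => h * k * p :=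
      (contMDiff_mul_right (a := p)).comp (contMDiff_mul_left (a := h))
    rw [map_one]
    exact MDifferentiableAt.comp (I' := 𝓘(𝕜, E)) (1 : G) h2 (h3.mdifferentiable (by decide) 1)
  have h4 : MDifferentiableAt 𝓘(𝕜, E) 𝓘(𝕜, F) (fun k => L ((f : G → F) (h * k * p)))
      ((MulAut.conj p).toMonoidHom 1) :=
    MDifferentiableAt.comp (I' := 𝓘(𝕜, F)) _ L.differentiableAt.mdifferentiableAt h1
  have h5 := rightDeriv_comp (contMDiff_conj 𝕜 E p) X h4
  rw [map_one] at h5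
  have h6 : rightDeriv X (fun k => L ((f : G → F) k)) (h * p) =
      rightDeriv X (fun y => L ((f : G → F) (h * (MulAut.conj p).toMonoidHom y * p))) 1 := by
    simp [rightDeriv, mul_assoc]
  refine h6.trans (h5.trans ?_)
  simp only [rightDeriv, mul_assoc, one_mul]
  rfl

end jets

/-! ### Jets of equivariant sections -/

section sectionJets
open TopologicalSpace MulOpposite
variable {𝕜 : Type*} [RCLike 𝕜] {E : Type*} [NormedAddCommGroup E] [NormedSpace 𝕜 E]
  [CompleteSpace E] {EP : Type*} [NormedAddCommGroup EP] [NormedSpace 𝕜 EP] [CompleteSpace EP]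
  {G : Type*} [TopologicalSpace G] [ChartedSpace E G] [Group G] [LieGroup 𝓘(𝕜, E) ∞ G]
  {P : Subgroup G} [ChartedSpace EP P] [LieGroup 𝓘(𝕜, EP) ∞ P]
  [hP : IsClosedLieSubgroup 𝕜 E EP P]
  {V : Type*} [NormedAddCommGroup V] [NormedSpace 𝕜 V] [FiniteDimensional 𝕜 V]
  {W : Type*} [NormedAddCommGroup W] [NormedSpace 𝕜 W] [FiniteDimensional 𝕜 W]
  {U : Type*} [NormedAddCommGroup U] [NormedSpace 𝕜 U] [FiniteDimensional 𝕜 U]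
  {ρV : SmoothRep 𝕜 EP P V} {ρW : SmoothRep 𝕜 EP P W} {ρU : SmoothRep 𝕜 EP P U}

theorem mul_mem_liftOpens {O : Opens (G ⧸ P)} {g : G} (hg : g ∈ liftOpens O) (p : P) :
    g * p ∈ liftOpens O := by
  change ((g * p : G) : G ⧸ P) ∈ O
  rw [QuotientGroup.mk_mul_of_mem g p.2]
  exact hg

/-- Differentiate `φ(g p) = ρ(p)⁻¹ φ(g)` in `p` at `1`; the inverse produces the sign. -/
theorem rightDeriv_section {O : Opens (G ⧸ P)} (φ : sections E ρV O) {g : G}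
    (hg : g ∈ liftOpens O) (Y : LieAlg 𝕜 EP P) :
    rightDeriv (homLie P.subtype hP.contMDiff_subtype Y) (φ : G → V) g =
      - derivedLin ρV Y ((φ : G → V) g) := by
  have h2 : MDifferentiableAt 𝓘(𝕜, E) 𝓘(𝕜, V) (φ : G → V) (g * 1) := by
    rw [mul_one]; exact smoothFn_mdifferentiableAt (sectionFn φ) hg
  have h1 : MDifferentiableAt 𝓘(𝕜, E) 𝓘(𝕜, V) (fun k => (φ : G → V) (g * k)) (P.subtype 1) := by
    rw [map_one]
    exact MDifferentiableAt.comp (I' := 𝓘(𝕜, E)) (1 : G) h2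
      ((contMDiff_mul_left (I := 𝓘(𝕜, E)) (n := ∞)).mdifferentiable (by decide) 1)
  have h3 := rightDeriv_comp hP.contMDiff_subtype Y h1
  simp only [Subgroup.subtype_apply, φ.2.2, rightDeriv_rep_inv] at h3
  rw [h3, Subgroup.coe_one]
  simp only [rightDeriv, one_mul]
  rfl

/-- In `r(u) r(y) φ` the operator `r(y)` acts first, by equivariance as a constant endomorphism,
which commutes with `r(u)`. Successive factors of `y` come out in the reverse order, hence the
antiautomorphism. -/
theorem evalJet_section_mul {O : Opens (G ⧸ P)} (φ : sections E ρV O) {g : G}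
    (hg : g ∈ liftOpens O) (y : Env 𝕜 EP P) (u : Env 𝕜 E G) :
    evalJet (sectionFn φ) g (u * envIncl 𝕜 E EP P y) =
      envRep ρV (unop (envAnti 𝕜 _ y)) (evalJet (sectionFn φ) g u) := by
  induction y using env_induction generalizing u with
  | halg c =>
    rw [AlgHom.commutes, AlgHom.commutes, MulOpposite.algebraMap_apply, unop_op, AlgHom.commutes,
      ← Algebra.commutes, ← Algebra.smul_def, map_smul, Module.algebraMap_end_apply]
  | hι Y =>
    rw [evalJet_mul, envAnti_ι, unop_op, map_neg, envRep_ι, LinearMap.neg_apply]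
    refine (evalJet_clm (-LinearMap.toContinuousLinearMap (derivedLin ρV Y)) (sectionFn φ) _
      ?_ hg u).symm
    intro k hk
    rw [envIncl, envMap_ι]
    exact (rightDeriv_section φ hk Y).symm.trans (evalJet_ι (sectionFn φ) hk _).symm
  | hadd a b ha hb => simp only [map_add, mul_add, unop_add, ha, hb, LinearMap.add_apply]
  | hmul a b ha hb => rw [map_mul (envIncl 𝕜 E EP P), ← mul_assoc, hb, ha, map_mul (envAnti 𝕜 _), unop_mul, map_mul]; rfl

variable (U) in
-- The generators of `balancedRel` are annihilated by `evalJet_section_mul`; the action `homAct` is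
-- made for this. Hence on sections only the class of `t` matters.
theorem biDiff_balanced {O : Opens (G ⧸ P)} (φ : sections E ρV O) (ψ : sections E ρW O) {g : G}
    (hg : g ∈ liftOpens O) {t : (Env 𝕜 E G ⊗[𝕜] Env 𝕜 E G) ⊗[𝕜] (V ⊗[𝕜] W →ₗ[𝕜] U)}
    (ht : biVermaMk E ρV ρW t = 0) : biDiff U (sectionFn φ) (sectionFn ψ) g t = 0 := by
  rw [biVermaMk, Submodule.mkQ_apply, Submodule.Quotient.mk_eq_zero] at ht
  induction ht using Submodule.span_induction with
  | zero => simp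
  | add a b _ _ ha hb => rw [map_add, ha, hb, add_zero]
  | smul c a _ ha => rw [map_smul, ha, smul_zero]
  | mem t ht =>
    obtain ⟨a, b, T, rfl⟩ := ht
    rw [map_sub, sub_eq_zero]
    induction b using TensorProduct.induction_on with
    | zero => simp
    | add b b' hb hb' =>
      rw [map_add, mul_add, TensorProduct.add_tmul, map_add, hb, hb', map_add,
        LinearMap.add_apply, TensorProduct.tmul_add, map_add]
    | tmul y₁ y₂ =>
      induction a using TensorProduct.induction_on with
      | zero => simp
      | add a a' ha ha' =>
        rw [add_mul, TensorProduct.add_tmul, map_add, ha, ha', TensorProduct.add_tmul, map_add]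
      | tmul u₁ u₂ =>
        rw [Algebra.TensorProduct.map_tmul, Algebra.TensorProduct.tmul_mul_tmul, biDiff_tmul,
          biDiff_tmul, homAct_tmul]
        exact congrArg₂ (fun a b => T (a ⊗ₜ[𝕜] b)) (evalJet_section_mul φ hg y₁ u₁)
          (evalJet_section_mul ψ hg y₂ u₂)

variable (ρV ρW ρU E) in
/-- The action of `p ∈ P` on `𝔘(𝔤) ⊗ 𝔘(𝔤) ⊗ Hom(V ⊗ W, U)`. -/
noncomputable def biVermaLift (p : P) :
    (Env 𝕜 E G ⊗[𝕜] Env 𝕜 E G) ⊗[𝕜] (V ⊗[𝕜] W →ₗ[𝕜] U) →ₗ[𝕜]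
      (Env 𝕜 E G ⊗[𝕜] Env 𝕜 E G) ⊗[𝕜] (V ⊗[𝕜] W →ₗ[𝕜] U) :=
  TensorProduct.map
    (Algebra.TensorProduct.map (adEnv 𝕜 E (p : G)) (adEnv 𝕜 E (p : G))).toLinearMap
    (conjHom ρV ρW ρU p)

theorem biVermaAct_mk (p : P) (t : (Env 𝕜 E G ⊗[𝕜] Env 𝕜 E G) ⊗[𝕜] (V ⊗[𝕜] W →ₗ[𝕜] U)) :
    biVermaAct E ρV ρW ρU p (biVermaMk E ρV ρW t) =
      biVermaMk E ρV ρW (biVermaLift E ρV ρW ρU p t) := rfl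

theorem evalJet_section_right {O : Opens (G ⧸ P)} (φ : sections E ρV O) {g : G}
    (hg : g ∈ liftOpens O) (p : P) (u : Env 𝕜 E G) :
    evalJet (sectionFn φ) (g * p) u =
      ρV.toRep p⁻¹ (evalJet (sectionFn φ) g (adEnv 𝕜 E (p : G) u)) := by
  have h := evalJet_right (p : G) (fun h hh => mul_mem_liftOpens hh p)
    (LinearMap.toContinuousLinearMap (ρV.toRep p)) (sectionFn φ) (fun k hk => by
      change ρV.toRep p ((φ : G → V) (k * p)) = (φ : G → V) k
      rw [φ.2.2]
      simp) hg u
  rw [← h]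
  simp

/-- Moving from `g` to `g p` replaces `u₁`, `u₂` by their images under `Ad(p)` and puts `ρ(p)⁻¹` in
front of both jets; `conjHom` absorbs these up to an outer factor. This is what makes `P`-invariant
classes produce equivariant functions. -/
theorem biDiff_right {O : Opens (G ⧸ P)} (φ : sections E ρV O) (ψ : sections E ρW O) {g : G}
    (hg : g ∈ liftOpens O) (p : P) (t : (Env 𝕜 E G ⊗[𝕜] Env 𝕜 E G) ⊗[𝕜] (V ⊗[𝕜] W →ₗ[𝕜] U)) :
    biDiff U (sectionFn φ) (sectionFn ψ) (g * p) t =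
      ρU.toRep p⁻¹ (biDiff U (sectionFn φ) (sectionFn ψ) g (biVermaLift E ρV ρW ρU p t)) := by
  induction t using TensorProduct.induction_on with
  | zero => simp
  | add a b ha hb => rw [map_add, ha, hb, map_add, map_add, map_add]
  | tmul a T =>
    induction a using TensorProduct.induction_on with
    | zero => simp
    | add a b ha hb => rw [TensorProduct.add_tmul, map_add, ha, hb, map_add, map_add, map_add]
    | tmul u₁ u₂ =>
      rw [biVermaLift, TensorProduct.map_tmul, AlgHom.toLinearMap_apply,
        Algebra.TensorProduct.map_tmul, biDiff_tmul, biDiff_tmul]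
      have h1 := evalJet_section_right φ hg p u₁
      have h2 := evalJet_section_right ψ hg p u₂
      refine (congrArg₂ (fun a b => T (a ⊗ₜ[𝕜] b)) h1 h2).trans ?_
      simp [conjHom, evalJet]

theorem biDiff_smooth {O : Opens G} (φ : smoothFn 𝕜 E V O) (ψ : smoothFn 𝕜 E W O)
    (t : (Env 𝕜 E G ⊗[𝕜] Env 𝕜 E G) ⊗[𝕜] (V ⊗[𝕜] W →ₗ[𝕜] U)) :
    ContMDiffOn 𝓘(𝕜, E) 𝓘(𝕜, U) ∞ (fun g => biDiff U φ ψ g t) O := by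
  induction t using TensorProduct.induction_on with
  | zero => simpa using contMDiffOn_const
  | add a b ha hb =>
    simp only [map_add]
    exact ha.add hb
  | tmul a T =>
    induction a using TensorProduct.induction_on with
    | zero => simpa using contMDiffOn_const
    | add a b ha hb =>
      simp only [map_add, TensorProduct.add_tmul]
      exact ha.add hb
    | tmul u₁ u₂ =>
      -- In finite dimensions the curried bilinear map is continuous, so the function is a smooth
      -- family of operators applied to a smooth vector.
      let B : V →L[𝕜] W →L[𝕜] U := LinearMap.toContinuousLinearMap
        ((LinearMap.toContinuousLinearMap (𝕜 := 𝕜) (E := W) (F' := U)).toLinearMap ∘ₗ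
          TensorProduct.curry T)
      exact (B.contMDiff.comp_contMDiffOn (contMDiffOn_evalJet φ u₁)).clm_apply
        (contMDiffOn_evalJet ψ u₂)

end sectionJets

/-! ### The inverse function theorem on manifolds -/

section inverseFunction
variable {𝕜 : Type*} [RCLike 𝕜] {E₁ : Type*} [NormedAddCommGroup E₁] [NormedSpace 𝕜 E₁]
  [CompleteSpace E₁] {E₂ : Type*} [NormedAddCommGroup E₂] [NormedSpace 𝕜 E₂]

/-- The inverse function theorem, with a smooth inverse on a neighbourhood. -/
theorem exists_openPartialHomeomorph_of_fderiv {g : E₁ → E₂} {s : Set E₁} (hs : IsOpen s) {a : E₁}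
    (ha : a ∈ s) (hg : ContDiffOn 𝕜 ∞ g s) (e : E₁ ≃L[𝕜] E₂) (he : fderiv 𝕜 g a = e) :
    ∃ Φ : OpenPartialHomeomorph E₁ E₂, a ∈ Φ.source ∧ Φ.source ⊆ s ∧ (Φ : E₁ → E₂) = g ∧
      ContDiffOn 𝕜 ∞ Φ.symm Φ.target := by
  have hat : ∀ x ∈ s, ContDiffAt 𝕜 ∞ g x := fun x hx => hg.contDiffAt (hs.mem_nhds hx)
  have hd : ∀ x ∈ s, HasFDerivAt g (fderiv 𝕜 g x) x := fun x hx =>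
    ((hat x hx).differentiableAt (by decide)).hasFDerivAt
  have hda : HasFDerivAt g (e : E₁ →L[𝕜] E₂) a := he ▸ hd a ha
  let Φ := (hat a ha).toOpenPartialHomeomorph g hda (by decide)
  have hc : ContinuousOn (fderiv 𝕜 g) s := hg.continuousOn_fderiv_of_isOpen hs (by decide)
  -- Invertibility of the derivative is an open condition; restricting to it makes the inverse
  -- smooth on the whole target, not only at `g a`.
  let s' := s ∩ fderiv 𝕜 g ⁻¹' Set.range ((↑) : (E₁ ≃L[𝕜] E₂) → E₁ →L[𝕜] E₂)
  have hs' : IsOpen s' := hc.isOpen_inter_preimage hs ContinuousLinearEquiv.isOpen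
  have ha' : a ∈ s' := ⟨ha, e, he.symm⟩
  refine ⟨Φ.restrOpen s' hs', ⟨(hat a ha).mem_toOpenPartialHomeomorph_source hda _, ha'⟩,
    fun x hx => hx.2.1, rfl, ?_⟩
  intro b hb
  have hb' := (Φ.restrOpen s' hs').map_target hb
  obtain ⟨e', he'⟩ := hb'.2.2
  refine ((Φ.restrOpen s' hs').contDiffAt_symm (f₀' := e') hb ?_ (hat _ hb'.2.1)).contDiffWithinAt
  rw [he']
  exact hd _ hb'.2.1

variable {H₁ : Type*} [TopologicalSpace H₁] {I : ModelWithCorners 𝕜 E₁ H₁} [I.Boundaryless]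
  {H₂ : Type*} [TopologicalSpace H₂] {J : ModelWithCorners 𝕜 E₂ H₂} [J.Boundaryless]
  {M : Type*} [TopologicalSpace M] [ChartedSpace H₁ M] [IsManifold I ∞ M]
  {N : Type*} [TopologicalSpace N] [ChartedSpace H₂ N] [IsManifold J ∞ N]

variable (I J) in
/-- The differential of a map between manifolds, as a linear map of the model vector spaces. -/
noncomputable def modelDeriv (f : M → N) (x : M) : E₁ →L[𝕜] E₂ := mfderiv I J f x

variable (I) in
/-- A chart, as a partial diffeomorphism onto an open subset of the model vector space. -/
noncomputable def chartDiffeo (x : M) : PartialDiffeomorph I 𝓘(𝕜, E₁) M E₁ ∞ where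
  toPartialEquiv := extChartAt I x
  open_source := isOpen_extChartAt_source x
  open_target := isOpen_extChartAt_target x
  contMDiffOn_toFun := by
    rw [extChartAt_source]
    exact contMDiffOn_extChartAt
  contMDiffOn_invFun := contMDiffOn_extChartAt_symm x

/-- The inverse function theorem on manifolds. -/
theorem isLocalDiffeomorphAt_of_mfderiv {f : M → N} {s : Set M} (hs : IsOpen s) {x : M}
    (hx : x ∈ s) (hf : ContMDiffOn I J ∞ f s) (e : E₁ ≃L[𝕜] E₂)
    (he : modelDeriv I J f x = e) : IsLocalDiffeomorphAt I J ∞ f x := by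
  let c := extChartAt I x
  let c' := extChartAt J (f x)
  let g := c' ∘ f ∘ c.symm
  let s₀ : Set M := s ∩ f ⁻¹' c'.source
  have hs₀ : IsOpen s₀ := hf.continuousOn.isOpen_inter_preimage hs (isOpen_extChartAt_source _)
  let s₁ : Set E₁ := c.target ∩ c.symm ⁻¹' s₀
  have hs₁ : IsOpen s₁ := (continuousOn_extChartAt_symm x).isOpen_inter_preimage
    (isOpen_extChartAt_target x) hs₀
  have hcx : c.symm (c x) = x := extChartAt_to_inv x
  have hx₁ : c x ∈ s₁ := ⟨mem_extChartAt_target x, by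
    change c.symm (c x) ∈ s₀
    rw [hcx]; exact ⟨hx, mem_extChartAt_source _⟩⟩
  have hg : ContDiffOn 𝕜 ∞ g s₁ := by
    rw [← contMDiffOn_iff_contDiffOn]
    refine ContMDiffOn.comp (I' := J) (t := c'.source) ?_ ?_ (fun y hy => hy.2.2)
    · rw [extChartAt_source]; exact contMDiffOn_extChartAt
    · exact hf.comp ((contMDiffOn_extChartAt_symm x).mono fun y hy => hy.1) (fun y hy => hy.2.1)
  have hd : MDifferentiableAt I J f x :=
    (hf.contMDiffAt (hs.mem_nhds hx)).mdifferentiableAt (by decide)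
  have hge : fderiv 𝕜 g (c x) = e := by
    -- By definition `mfderiv` is the derivative in the preferred charts at `x` and `f x`, that is,
    -- of `g`.
    have h1 : modelDeriv I J f x = fderivWithin 𝕜 g (Set.range I) (c x) := hd.mfderiv
    rw [← he, h1, I.range_eq_univ, fderivWithin_univ]
  obtain ⟨Φ, hΦ, hΦs, hΦg, hΦsymm⟩ := exists_openPartialHomeomorph_of_fderiv hs₁ hx₁ hg e hge
  let Ψ : PartialDiffeomorph 𝓘(𝕜, E₁) 𝓘(𝕜, E₂) E₁ E₂ ∞ :=
    { toPartialEquiv := Φ.toPartialEquiv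
      open_source := Φ.open_source
      open_target := Φ.open_target
      contMDiffOn_toFun := by
        change ContMDiffOn 𝓘(𝕜, E₁) 𝓘(𝕜, E₂) ∞ Φ Φ.source
        rw [contMDiffOn_iff_contDiffOn, hΦg]
        exact hg.mono hΦs
      contMDiffOn_invFun := hΦsymm.contMDiffOn }
  have hΨ : ∀ y, Ψ y = g y := fun y => congrFun hΦg y
  refine ⟨((chartDiffeo I x).trans Ψ).trans (chartDiffeo J (f x)).symm, ?_, ?_⟩
  · refine ⟨⟨mem_extChartAt_source x, hΦ⟩, ?_⟩
    change Ψ (c x) ∈ c'.target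
    rw [hΨ]
    change c' (f (c.symm (c x))) ∈ c'.target
    rw [hcx]
    exact mem_extChartAt_target _
  · rintro y ⟨⟨hy1, hy2⟩, hy3⟩
    change f y = c'.symm (Ψ (c y))
    have hy4 : c.symm (c y) = y := c.left_inv hy1
    have hy5 : c y ∈ s₁ := hΦs hy2
    rw [hΨ]
    change f y = c'.symm (c' (f (c.symm (c y))))
    have hy6 : f (c.symm (c y)) ∈ c'.source := hy5.2.2
    rw [c'.left_inv hy6, hy4]
end inverseFunction

/-! ### Existence of local trivializations of `G → G ⧸ P` -/

section localTriv
open TopologicalSpace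
variable {𝕜 : Type*} [RCLike 𝕜] {E : Type*} [NormedAddCommGroup E] [NormedSpace 𝕜 E]
  {EP : Type*} [NormedAddCommGroup EP] [NormedSpace 𝕜 EP]
  {G : Type*} [TopologicalSpace G] [ChartedSpace E G] [Group G] [LieGroup 𝓘(𝕜, E) ∞ G]
  {P : Subgroup G} [ChartedSpace EP P] [LieGroup 𝓘(𝕜, EP) ∞ P]

variable (𝕜 E) in
/-- Right translation, as a diffeomorphism. -/
def mulRightDiffeo (g : G) : G ≃ₘ^∞⟮𝓘(𝕜, E), 𝓘(𝕜, E)⟯ G where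
  toEquiv := Equiv.mulRight g
  contMDiff_toFun := contMDiff_mul_right
  contMDiff_invFun := contMDiff_mul_right

/-- The map is equivariant under right multiplication by `P`: translate by `p⁻¹` in `P`, apply the
map near `(x, 1)`, and translate back by `p` in `G`. -/
theorem isLocalDiffeomorphAt_mul_right {n : ℕ} {s : (Fin n → 𝕜) → G} {x : Fin n → 𝕜}
    (h : IsLocalDiffeomorphAt (𝓘(𝕜, Fin n → 𝕜).prod 𝓘(𝕜, EP)) 𝓘(𝕜, E) ∞
      (fun q : (Fin n → 𝕜) × P => s q.1 * q.2) (x, 1)) (p : P) :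
    IsLocalDiffeomorphAt (𝓘(𝕜, Fin n → 𝕜).prod 𝓘(𝕜, EP)) 𝓘(𝕜, E) ∞
      (fun q : (Fin n → 𝕜) × P => s q.1 * q.2) (x, p) := by
  have h1 := ((Diffeomorph.refl 𝓘(𝕜, Fin n → 𝕜) (Fin n → 𝕜) ∞).prodCongr
    (mulRightDiffeo 𝕜 EP p⁻¹)).isLocalDiffeomorph (x, p)
  have h2 : ((Diffeomorph.refl 𝓘(𝕜, Fin n → 𝕜) (Fin n → 𝕜) ∞).prodCongr
    (mulRightDiffeo 𝕜 EP p⁻¹)) (x, p) = (x, 1) := by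
    change (x, p * p⁻¹) = (x, 1)
    rw [mul_inv_cancel]
  rw [← h2] at h
  have h3 := (h1.comp (K := 𝓘(𝕜, E)) (P := G) h).comp (K := 𝓘(𝕜, E)) (P := G) ((mulRightDiffeo 𝕜 E (p : G)).isLocalDiffeomorph _)
  convert h3 using 1
  funext q
  change s q.1 * (q.2 : G) = s q.1 * ((q.2 * p⁻¹ : P) : G) * p
  simp [mul_assoc]

theorem contMDiffOn_section_mul [IsClosedLieSubgroup 𝕜 E EP P] {n : ℕ} {s : (Fin n → 𝕜) → G}
    {Ω : Set (Fin n → 𝕜)} (hs : ContMDiffOn 𝓘(𝕜, Fin n → 𝕜) 𝓘(𝕜, E) ∞ s Ω) :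
    ContMDiffOn (𝓘(𝕜, Fin n → 𝕜).prod 𝓘(𝕜, EP)) 𝓘(𝕜, E) ∞
      (fun q : (Fin n → 𝕜) × P => s q.1 * q.2) (Prod.fst ⁻¹' Ω) :=
  (hs.comp contMDiffOn_fst (fun _ h => h)).mul
    ((IsClosedLieSubgroup.contMDiff_subtype (𝕜 := 𝕜) (E := E) (EP := EP) (P := P)).comp
      contMDiff_snd).contMDiffOn

theorem mfderiv_section_mul [hP : IsClosedLieSubgroup 𝕜 E EP P] {n : ℕ} {s : (Fin n → 𝕜) → G}
    {Ω : Set (Fin n → 𝕜)} (hΩ : IsOpen Ω) (hs : ContMDiffOn 𝓘(𝕜, Fin n → 𝕜) 𝓘(𝕜, E) ∞ s Ω)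
    (h0 : 0 ∈ Ω) (h1 : s 0 = 1) (v : Fin n → 𝕜) (Y : EP) :
    modelDeriv (𝓘(𝕜, Fin n → 𝕜).prod 𝓘(𝕜, EP)) 𝓘(𝕜, E)
      (fun q : (Fin n → 𝕜) × P => s q.1 * q.2) (0, 1) (v, Y) =
    modelDeriv 𝓘(𝕜, Fin n → 𝕜) 𝓘(𝕜, E) s 0 v + modelDeriv 𝓘(𝕜, EP) 𝓘(𝕜, E) P.subtype 1 Y := by
  have hd : MDifferentiableAt (𝓘(𝕜, Fin n → 𝕜).prod 𝓘(𝕜, EP)) 𝓘(𝕜, E)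
      (fun q : (Fin n → 𝕜) × P => s q.1 * q.2) (0, 1) :=
    ((contMDiffOn_section_mul hs).contMDiffAt
      ((hΩ.preimage continuous_fst).mem_nhds h0)).mdifferentiableAt (by decide)
  refine (mfderiv_prod_eq_add_apply (v := ((v, Y) : (Fin n → 𝕜) × EP)) hd).trans ?_
  change modelDeriv 𝓘(𝕜, Fin n → 𝕜) 𝓘(𝕜, E) (fun z => s z * ((1 : P) : G)) 0 v +
    modelDeriv 𝓘(𝕜, EP) 𝓘(𝕜, E) (fun z : P => s 0 * (z : G)) 1 Y = _
  simp only [h1, one_mul, Subgroup.coe_one, mul_one]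
  rfl

/-- Take for `s` a linear slice in the chart at `1`, in the direction of a complement of `𝔭`. The
differential of `(x, p) ↦ s(x) p` at `(0, 1)` is then the sum map from complement and `𝔭` to `𝔤`, an
isomorphism. -/
theorem exists_isLocalDiffeomorphAt_section [FiniteDimensional 𝕜 E] [FiniteDimensional 𝕜 EP]
    [CompleteSpace E] [CompleteSpace EP] [hP : IsClosedLieSubgroup 𝕜 E EP P] :
    ∃ (n : ℕ) (s : (Fin n → 𝕜) → G) (Ω : Set (Fin n → 𝕜)), IsOpen Ω ∧ 0 ∈ Ω ∧ s 0 = 1 ∧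
      ContMDiffOn 𝓘(𝕜, Fin n → 𝕜) 𝓘(𝕜, E) ∞ s Ω ∧
      IsLocalDiffeomorphAt (𝓘(𝕜, Fin n → 𝕜).prod 𝓘(𝕜, EP)) 𝓘(𝕜, E) ∞
        (fun q : (Fin n → 𝕜) × P => s q.1 * q.2) (0, 1) := by
  let j : EP →ₗ[𝕜] E := (modelDeriv 𝓘(𝕜, EP) 𝓘(𝕜, E) P.subtype 1).toLinearMap
  have hj : Function.Injective j := hP.injective_mfderiv
  obtain ⟨C, hC⟩ := Submodule.exists_isCompl (LinearMap.range j)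
  let n := Module.finrank 𝕜 C
  let b : (Fin n → 𝕜) ≃ₗ[𝕜] C := (Module.finBasis 𝕜 C).equivFun.symm
  let e₀ : ((Fin n → 𝕜) × EP) ≃ₗ[𝕜] E :=
    ((b.prodCongr (LinearEquiv.ofInjective j hj)).trans
      (Submodule.prodEquivOfIsCompl _ _ hC.symm))
  have he₀ : ∀ v Y, e₀ (v, Y) = (b v : E) + j Y := fun v Y => rfl
  let c := extChartAt 𝓘(𝕜, E) (1 : G)
  have hD := isInvertible_mfderivWithin_extChartAt_symm (mem_extChartAt_target (I := 𝓘(𝕜, E)) (1 : G))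
  simp only [modelWithCornersSelf_coe, Set.range_id, mfderivWithin_univ] at hD
  obtain ⟨D', hD'⟩ := hD
  let D : E ≃L[𝕜] E := D'
  have hD : modelDeriv 𝓘(𝕜, E) 𝓘(𝕜, E) c.symm (c 1) = D := hD'.symm
  -- Composing with `D.symm` cancels the differential of the inverse chart, so that `s` has
  -- differential `b` at `0`.
  let L : (Fin n → 𝕜) →L[𝕜] E :=
    LinearMap.toContinuousLinearMap (D.symm.toLinearEquiv.toLinearMap ∘ₗ C.subtype ∘ₗ b.toLinearMap)
  have hL : ∀ v, D (L v) = b v := fun v => D.apply_symm_apply _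
  let a : (Fin n → 𝕜) → E := fun x => c 1 + L x
  have ha : ContDiff 𝕜 ∞ a := contDiff_const.add L.contDiff
  have ha0 : a 0 = c 1 := by simp [a]
  let Ω : Set (Fin n → 𝕜) := a ⁻¹' c.target
  have hΩ : IsOpen Ω := (isOpen_extChartAt_target _).preimage ha.continuous
  have h0 : 0 ∈ Ω := by
    change a 0 ∈ c.target
    rw [ha0]; exact mem_extChartAt_target _
  have hs : ContMDiffOn 𝓘(𝕜, Fin n → 𝕜) 𝓘(𝕜, E) ∞ (c.symm ∘ a) Ω :=
    (contMDiffOn_extChartAt_symm _).comp ha.contMDiff.contMDiffOn (fun _ h => h)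
  have hs0 : (c.symm ∘ a) 0 = 1 := by
    change c.symm (a 0) = 1
    rw [ha0]; exact extChartAt_to_inv _
  refine ⟨n, c.symm ∘ a, Ω, hΩ, h0, hs0, hs, ?_⟩
  refine isLocalDiffeomorphAt_of_mfderiv (hΩ.preimage continuous_fst) h0
    (contMDiffOn_section_mul hs) e₀.toContinuousLinearEquiv ?_
  refine ContinuousLinearMap.ext fun ⟨v, Y⟩ => ?_
  rw [mfderiv_section_mul hΩ hs h0 hs0]
  have h1 : modelDeriv 𝓘(𝕜, Fin n → 𝕜) 𝓘(𝕜, E) (c.symm ∘ a) 0 =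
      (modelDeriv 𝓘(𝕜, E) 𝓘(𝕜, E) c.symm (a 0)).comp (fderiv 𝕜 a 0) := by
    have h2 : MDifferentiableAt 𝓘(𝕜, E) 𝓘(𝕜, E) c.symm (a 0) :=
      ((contMDiffOn_extChartAt_symm (n := ∞) (1 : G)).contMDiffAt
        ((isOpen_extChartAt_target (I := 𝓘(𝕜, E)) (1 : G)).mem_nhds h0)).mdifferentiableAt (by decide)
    rw [← mfderiv_eq_fderiv]
    exact mfderiv_comp (I' := 𝓘(𝕜, E)) 0 h2
      (ha.contMDiff.contMDiffAt.mdifferentiableAt (by decide))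
  have h3 : fderiv 𝕜 a 0 = L := by
    simp [a]
  rw [h1, ha0, hD, h3]
  change D (L v) + j Y = e₀ (v, Y)
  rw [hL, he₀]

/-- Near the identity, the principal bundle `G → G ⧸ P` of a closed Lie subgroup has local
trivializations. -/
theorem exists_localTriv [FiniteDimensional 𝕜 E] [FiniteDimensional 𝕜 EP]
    [CompleteSpace E] [CompleteSpace EP] [hP : IsClosedLieSubgroup 𝕜 E EP P] :
    ∃ (n : ℕ) (τ : LocalTriv 𝕜 E EP P n), 0 ∈ τ.domain ∧ τ.toFun 0 = 1 := by
  have := topologicalGroup_of_lieGroup 𝓘(𝕜, E) ∞ (G := G)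
  obtain ⟨n, s, Ω, hΩ, h0, hs0, hs, hF⟩ :=
    exists_isLocalDiffeomorphAt_section (𝕜 := 𝕜) (E := E) (EP := EP) (P := P)
  obtain ⟨Φ, hΦ, hΦe⟩ := hF
  have h1 : Φ.source ∈ 𝓝 ((0 : Fin n → 𝕜), (1 : P)) := Φ.open_source.mem_nhds hΦ
  rw [nhds_prod_eq, Filter.mem_prod_iff] at h1
  obtain ⟨Ω₁, hΩ₁, N₁, hN₁, hsub⟩ := h1
  -- `P` carries the subspace topology: elements of `P` close to `1` in `G` are close to `1` in `P`.
  -- Injectivity rests on this.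
  rw [nhds_subtype_eq_comap, Filter.mem_comap] at hN₁
  obtain ⟨N', hN', hN'sub⟩ := hN₁
  have hc : ContinuousAt s 0 := (hs.continuousOn).continuousAt (hΩ.mem_nhds h0)
  have h2 : ContinuousAt (fun z : (Fin n → 𝕜) × (Fin n → 𝕜) => (s z.1)⁻¹ * s z.2) (0, 0) := by
    refine ContinuousAt.mul (ContinuousAt.inv ?_) ?_
    · exact ContinuousAt.comp (f := Prod.fst) (by exact hc) continuousAt_fst
    · exact ContinuousAt.comp (f := Prod.snd) (by exact hc) continuousAt_snd
  have h3 : (fun z : (Fin n → 𝕜) × (Fin n → 𝕜) => (s z.1)⁻¹ * s z.2) ⁻¹' N' ∈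
      𝓝 ((0 : Fin n → 𝕜), (0 : Fin n → 𝕜)) := by
    refine h2.preimage_mem_nhds ?_
    simpa [hs0] using hN'
  rw [nhds_prod_eq, Filter.mem_prod_iff] at h3
  obtain ⟨A, hA, B, hB, hAB⟩ := h3
  obtain ⟨T, hT, hTo, hT0⟩ := mem_nhds_iff.1
    (Filter.inter_mem (Filter.inter_mem hΩ₁ hA) hB)
  refine ⟨n, ⟨⟨T, hTo⟩, s, ?_, ?_⟩, hT0, hs0⟩
  · rintro ⟨x, p⟩ hx ⟨x', p'⟩ hx' h
    have hx := hT hx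
    have hx' := hT hx'
    change s x * (p : G) = s x' * (p' : G) at h
    -- `q = s(x')⁻¹ s(x)` is close to `1`, because `x` and `x'` are close to `0`. Hence `(x, 1)` and
    -- `(x', q)` both lie in the source of `Φ`, and they have the same image.
    let q : P := p' * p⁻¹
    have hq : s x = s x' * (q : G) := by
      simp only [q, Subgroup.coe_mul, Subgroup.coe_inv]
      rw [← mul_assoc, ← h]
      simp
    have hqN : q ∈ N₁ := by
      apply hN'sub
      have := hAB (Set.mk_mem_prod hx'.1.2 hx.2)
      change (s x')⁻¹ * s x ∈ N' at this
      rw [hq, inv_mul_cancel_left] at this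
      exact this
    have hm1 : (x, (1 : P)) ∈ Φ.source :=
      hsub (Set.mk_mem_prod hx.1.1 (hN'sub (by simpa using mem_of_mem_nhds hN')))
    have hm2 : (x', q) ∈ Φ.source := hsub (Set.mk_mem_prod hx'.1.1 hqN)
    have h4 : (x, (1 : P)) = (x', q) := by
      refine Φ.injOn hm1 hm2 ?_
      refine (hΦe hm1).symm.trans (Eq.trans ?_ (hΦe hm2))
      simpa using hq
    have h5 : x = x' := congrArg Prod.fst h4
    subst h5
    have h6 : (p : G) = p' := mul_left_cancel h
    rw [Subtype.ext h6]
  · intro x hx p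
    refine isLocalDiffeomorphAt_mul_right ⟨Φ, ?_, hΦe⟩ p
    exact hsub (Set.mk_mem_prod (hT hx).1.1 (hN'sub (by simpa using mem_of_mem_nhds hN')))

end localTriv

/-! ### Partial derivatives and differential operators on `𝕜ⁿ` -/

section calculus
variable {𝕜 : Type*} [RCLike 𝕜] {n : ℕ} {V : Type*} [NormedAddCommGroup V] [NormedSpace 𝕜 V]

/-- The partial derivative `∂f / ∂x_i`. -/
noncomputable def coordDeriv (i : Fin n) (f : (Fin n → 𝕜) → V) : (Fin n → 𝕜) → V :=
  fun x => fderiv 𝕜 f x (Pi.single i 1)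

theorem partialDeriv_eq_foldr (α : Fin n → ℕ) (f : (Fin n → 𝕜) → V) :
    partialDeriv α f = (List.finRange n).foldr (fun i u => (coordDeriv i)^[α i] u) f := rfl

theorem coordDeriv_contDiffOn {S : Set (Fin n → 𝕜)} (hS : IsOpen S) {f : (Fin n → 𝕜) → V}
    (hf : ContDiffOn 𝕜 ∞ f S) (i : Fin n) : ContDiffOn 𝕜 ∞ (coordDeriv i f) S :=
  (hf.fderiv_of_isOpen hS (by decide)).clm_apply contDiffOn_const

theorem coordDeriv_eqOn {S : Set (Fin n → 𝕜)} (hS : IsOpen S) {f g : (Fin n → 𝕜) → V}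
    (h : Set.EqOn f g S) (i : Fin n) : Set.EqOn (coordDeriv i f) (coordDeriv i g) S := by
  intro x hx
  rw [coordDeriv, coordDeriv, (h.eventuallyEq_of_mem (hS.mem_nhds hx)).fderiv_eq]

theorem coordDeriv_comm {S : Set (Fin n → 𝕜)} (hS : IsOpen S) {f : (Fin n → 𝕜) → V}
    (hf : ContDiffOn 𝕜 ∞ f S) (i k : Fin n) :
    Set.EqOn (coordDeriv i (coordDeriv k f)) (coordDeriv k (coordDeriv i f)) S := by
  intro x hx
  have hx' := hf.contDiffAt (hS.mem_nhds hx)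
  have hs : IsSymmSndFDerivAt 𝕜 f x := hx'.isSymmSndFDerivAt (by
    rw [minSmoothness_of_isRCLikeNormedField]; exact WithTop.coe_le_coe.2 le_top)
  have hd : DifferentiableAt 𝕜 (fderiv 𝕜 f) x :=
    (hx'.fderiv_right (m := 1) (by exact WithTop.coe_le_coe.2 le_top)).differentiableAt (by decide)
  have h1 : ∀ v : Fin n → 𝕜, fderiv 𝕜 (fun y => fderiv 𝕜 f y v) x =
      (fderiv 𝕜 (fderiv 𝕜 f) x).flip v := fun v => by
    rw [fderiv_clm_apply hd (differentiableAt_const v)]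
    ext w
    simp
  change fderiv 𝕜 (fun y => fderiv 𝕜 f y _) x _ = fderiv 𝕜 (fun y => fderiv 𝕜 f y _) x _
  rw [h1, h1]
  exact hs.eq _ _

theorem coordDeriv_iterate_contDiffOn {S : Set (Fin n → 𝕜)} (hS : IsOpen S) {f : (Fin n → 𝕜) → V}
    (hf : ContDiffOn 𝕜 ∞ f S) (i : Fin n) (m : ℕ) : ContDiffOn 𝕜 ∞ ((coordDeriv i)^[m] f) S := by
  induction m with
  | zero => exact hf
  | succ m ih => rw [Function.iterate_succ_apply']; exact coordDeriv_contDiffOn hS ih i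

theorem coordDeriv_iterate_eqOn {S : Set (Fin n → 𝕜)} (hS : IsOpen S) {f g : (Fin n → 𝕜) → V}
    (h : Set.EqOn f g S) (i : Fin n) (m : ℕ) :
    Set.EqOn ((coordDeriv i)^[m] f) ((coordDeriv i)^[m] g) S := by
  induction m with
  | zero => exact h
  | succ m ih =>
    rw [Function.iterate_succ_apply', Function.iterate_succ_apply']
    exact coordDeriv_eqOn hS ih i

theorem coordDeriv_iterate_comm {S : Set (Fin n → 𝕜)} (hS : IsOpen S) {f : (Fin n → 𝕜) → V}
    (hf : ContDiffOn 𝕜 ∞ f S) (i k : Fin n) (m : ℕ) :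
    Set.EqOn (coordDeriv i ((coordDeriv k)^[m] f)) ((coordDeriv k)^[m] (coordDeriv i f)) S := by
  induction m with
  | zero => exact fun _ _ => rfl
  | succ m ih =>
    rw [Function.iterate_succ_apply', Function.iterate_succ_apply']
    exact (coordDeriv_comm hS (coordDeriv_iterate_contDiffOn hS hf k m) i k).trans
      (coordDeriv_eqOn hS ih k)

theorem foldr_coordDeriv_contDiffOn {S : Set (Fin n → 𝕜)} (hS : IsOpen S) {f : (Fin n → 𝕜) → V}
    (hf : ContDiffOn 𝕜 ∞ f S) (α : Fin n → ℕ) (l : List (Fin n)) :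
    ContDiffOn 𝕜 ∞ (l.foldr (fun i u => (coordDeriv i)^[α i] u) f) S := by
  induction l with
  | nil => exact hf
  | cons i l ih => exact coordDeriv_iterate_contDiffOn hS ih i _

theorem partialDeriv_contDiffOn {S : Set (Fin n → 𝕜)} (hS : IsOpen S) {f : (Fin n → 𝕜) → V}
    (hf : ContDiffOn 𝕜 ∞ f S) (α : Fin n → ℕ) : ContDiffOn 𝕜 ∞ (partialDeriv α f) S :=
  foldr_coordDeriv_contDiffOn hS hf α _

/-- `partialDeriv` differentiates in the fixed order of a list, so an additional derivative has to
be commuted inwards to the block of its own variable, which occurs only once. -/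
theorem coordDeriv_foldr {S : Set (Fin n → 𝕜)} (hS : IsOpen S) {f : (Fin n → 𝕜) → V}
    (hf : ContDiffOn 𝕜 ∞ f S) (α : Fin n → ℕ) (i : Fin n) {l : List (Fin n)} (hl : l.Nodup)
    (hi : i ∈ l) :
    Set.EqOn (coordDeriv i (l.foldr (fun i u => (coordDeriv i)^[α i] u) f))
      (l.foldr (fun k u => (coordDeriv k)^[(α + Pi.single i 1 : Fin n → ℕ) k] u) f) S := by
  have hne : ∀ l : List (Fin n), i ∉ l →
      l.foldr (fun k u => (coordDeriv k)^[(α + Pi.single i 1 : Fin n → ℕ) k] u) f =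
      l.foldr (fun k u => (coordDeriv k)^[α k] u) f := by
    intro l hil
    refine List.foldr_ext _ _ _ fun k hk u => ?_
    have : k ≠ i := fun h => hil (h ▸ hk)
    simp [this]
  induction l with
  | nil => simp at hi
  | cons k l ih =>
    rw [List.nodup_cons] at hl
    rw [List.foldr_cons, List.foldr_cons]
    by_cases hik : i = k
    · subst hik
      rw [hne l hl.1]
      simp only [Pi.add_apply, Pi.single_eq_same, Function.iterate_succ_apply']
      exact fun _ _ => rfl
    · have hk : (α + Pi.single i 1 : Fin n → ℕ) k = α k := by simp [Ne.symm hik]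
      rw [hk]
      exact (coordDeriv_iterate_comm hS (foldr_coordDeriv_contDiffOn hS hf α l) i k _).trans
        (coordDeriv_iterate_eqOn hS (ih hl.2 ((List.mem_cons.1 hi).resolve_left hik)) k _)

theorem coordDeriv_partialDeriv {S : Set (Fin n → 𝕜)} (hS : IsOpen S) {f : (Fin n → 𝕜) → V}
    (hf : ContDiffOn 𝕜 ∞ f S) (α : Fin n → ℕ) (i : Fin n) :
    Set.EqOn (coordDeriv i (partialDeriv α f)) (partialDeriv (α + Pi.single i 1) f) S :=
  coordDeriv_foldr hS hf α i (List.nodup_finRange n) (List.mem_finRange i)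

theorem partialDeriv_zero (f : (Fin n → 𝕜) → V) : partialDeriv 0 f = f := by
  rw [partialDeriv_eq_foldr]
  induction List.finRange n with
  | nil => rfl
  | cons i l ih => rw [List.foldr_cons, ih]; rfl

/-- A property of families of functions which is stable under partial derivatives of first order is
stable under all partial derivatives. -/
theorem partialDeriv_induction {ι : Type*} {C : (ι → (Fin n → 𝕜) → V) → Prop}
    (h : ∀ i F, C F → C fun φ => coordDeriv i (F φ)) (α : Fin n → ℕ) {F : ι → (Fin n → 𝕜) → V}
    (hF : C F) : C fun φ => partialDeriv α (F φ) := by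
  simp only [partialDeriv_eq_foldr]
  have hit : ∀ (i : Fin n) (m : ℕ) (F : ι → (Fin n → 𝕜) → V), C F →
      C fun φ => (coordDeriv i)^[m] (F φ) := by
    intro i m F hF
    induction m with
    | zero => exact hF
    | succ m ih =>
      simp only [Function.iterate_succ_apply']
      exact h i _ ih
  induction List.finRange n with
  | nil => exact hF
  | cons i l ih => exact hit i _ _ ih

theorem fderiv_eq_sum_coordDeriv (f : (Fin n → 𝕜) → V) (x v : Fin n → 𝕜) :
    fderiv 𝕜 f x v = ∑ i, v i • coordDeriv i f x := by
  conv_lhs => rw [pi_eq_sum_univ' v]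
  rw [map_sum]
  refine Finset.sum_congr rfl fun i _ => ?_
  rw [map_smul, coordDeriv]

/-- Families of functions `F φ` which are obtained from the functions `f φ`, on the sets `S φ`, by
applying a linear differential operator whose coefficients are smooth on `Ω`. -/
inductive IsDiffOp {ι : Type*} (Ω : Set (Fin n → 𝕜)) (S : ι → Set (Fin n → 𝕜))
    (f : ι → (Fin n → 𝕜) → V) : (ι → (Fin n → 𝕜) → V) → Prop
  | base (α : Fin n → ℕ) (c : (Fin n → 𝕜) → V →L[𝕜] V) (hc : ContDiffOn 𝕜 ∞ c Ω) :
      IsDiffOp Ω S f fun φ x => c x (partialDeriv α (f φ) x)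
  | add (F F' : ι → (Fin n → 𝕜) → V) (hF : IsDiffOp Ω S f F) (hF' : IsDiffOp Ω S f F') :
      IsDiffOp Ω S f fun φ x => F φ x + F' φ x
  | congr (F F' : ι → (Fin n → 𝕜) → V) (hF : IsDiffOp Ω S f F)
      (h : ∀ φ, Set.EqOn (F φ) (F' φ) (S φ)) : IsDiffOp Ω S f F'

namespace IsDiffOp
variable {ι : Type*} {Ω : Set (Fin n → 𝕜)} {S : ι → Set (Fin n → 𝕜)}
  {f : ι → (Fin n → 𝕜) → V} {F : ι → (Fin n → 𝕜) → V}

theorem clm (hF : IsDiffOp Ω S f F) {c : (Fin n → 𝕜) → V →L[𝕜] V} (hc : ContDiffOn 𝕜 ∞ c Ω) :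
    IsDiffOp Ω S f fun φ x => c x (F φ x) := by
  induction hF with
  | base α c' hc' => exact base α (fun x => (c x).comp (c' x)) (hc.clm_comp hc')
  | add F F' _ _ h h' => simpa only [map_add] using h.add _ _ h'
  | congr F F' _ h' h => exact h.congr _ _ fun φ x hx => congrArg (c x) (h' φ hx)

theorem smul (hF : IsDiffOp Ω S f F) {c : (Fin n → 𝕜) → 𝕜} (hc : ContDiffOn 𝕜 ∞ c Ω) :
    IsDiffOp Ω S f fun φ x => c x • F φ x :=
  hF.clm (c := fun x => c x • ContinuousLinearMap.id 𝕜 V) (hc.smul contDiffOn_const)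

theorem sum {κ : Type*} (s : Finset κ) {F : κ → ι → (Fin n → 𝕜) → V}
    (hF : ∀ k ∈ s, IsDiffOp Ω S f (F k)) : IsDiffOp Ω S f fun φ x => ∑ k ∈ s, F k φ x := by
  classical
  induction s using Finset.induction_on with
  | empty => simpa using base (ι := ι) (S := S) (f := f) 0 0 contDiffOn_const
  | insert k s hk ih =>
    simp only [Finset.sum_insert hk]
    exact (hF k (Finset.mem_insert_self _ _)).add _ _
      (ih fun k' hk' => hF k' (Finset.mem_insert_of_mem hk'))

variable (hS : ∀ φ, IsOpen (S φ)) (hSΩ : ∀ φ, S φ ⊆ Ω) (hf : ∀ φ, ContDiffOn 𝕜 ∞ (f φ) (S φ))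
include hS hSΩ hf

theorem contDiffOn (hF : IsDiffOp Ω S f F) (φ : ι) : ContDiffOn 𝕜 ∞ (F φ) (S φ) := by
  induction hF with
  | base α c hc => exact (hc.mono (hSΩ φ)).clm_apply (partialDeriv_contDiffOn (hS φ) (hf φ) α)
  | add F F' _ _ h h' => exact h.add h'
  | congr F F' _ h' h => exact h.congr fun x hx => (h' φ hx).symm

/-- The product rule `∂_i (c ∂^α f) = (∂_i c) ∂^α f + c ∂^(α + e_i) f`; its second term uses that
partial derivatives of the smooth `f φ` commute. -/
theorem coordDeriv (hΩ : IsOpen Ω) (hF : IsDiffOp Ω S f F) (i : Fin n) :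
    IsDiffOp Ω S f fun φ => coordDeriv i (F φ) := by
  have hd : ∀ {f : (Fin n → 𝕜) → V} {φ x}, ContDiffOn 𝕜 ∞ f (S φ) → x ∈ S φ →
      DifferentiableAt 𝕜 f x := fun h hx =>
    (h.contDiffAt ((hS _).mem_nhds hx)).differentiableAt (by decide)
  induction hF with
  | base α c hc =>
    refine ((base α (fun x => fderiv 𝕜 c x (Pi.single i 1)) ((hc.fderiv_of_isOpen hΩ
      (by decide)).clm_apply contDiffOn_const)).add _ _
      (base (α + Pi.single i 1) c hc)).congr _ _ fun φ x hx => ?_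
    have h1 : DifferentiableAt 𝕜 c x :=
      (hc.contDiffAt (hΩ.mem_nhds (hSΩ φ hx))).differentiableAt (by decide)
    have h2 := hd (partialDeriv_contDiffOn (hS φ) (hf φ) α) hx
    rw [BiPairing.coordDeriv, fderiv_clm_apply h1 h2]
    beta_reduce
    rw [← coordDeriv_partialDeriv (hS φ) (hf φ) α i hx]
    simp [BiPairing.coordDeriv, add_comm]
  | add F F' hF hF' h h' =>
    refine (h.add _ _ h').congr _ _ fun φ x hx => ?_
    rw [BiPairing.coordDeriv, fderiv_fun_add (hd (hF.contDiffOn hS hSΩ hf φ) hx)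
      (hd (hF'.contDiffOn hS hSΩ hf φ) hx)]
    rfl
  | congr F F' _ h' h => exact h.congr _ _ fun φ => coordDeriv_eqOn (hS φ) (h' φ) i
end IsDiffOp

variable {W : Type*} [NormedAddCommGroup W] [NormedSpace 𝕜 W]
  {U : Type*} [NormedAddCommGroup U] [NormedSpace 𝕜 U] [FiniteDimensional 𝕜 V]
  [FiniteDimensional 𝕜 W]

theorem contDiffOn_tensor (T : V ⊗[𝕜] W →ₗ[𝕜] U) {Ω : Set (Fin n → 𝕜)} {v : (Fin n → 𝕜) → V}
    {w : (Fin n → 𝕜) → W} (hv : ContDiffOn 𝕜 ∞ v Ω) (hw : ContDiffOn 𝕜 ∞ w Ω) :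
    ContDiffOn 𝕜 ∞ (fun x => T (v x ⊗ₜ w x)) Ω := by
  let B : V →L[𝕜] W →L[𝕜] U := LinearMap.toContinuousLinearMap
    ((LinearMap.toContinuousLinearMap (𝕜 := 𝕜) (E := W) (F' := U)).toLinearMap ∘ₗ
      TensorProduct.curry T)
  exact (B.contDiff.comp_contDiffOn hv).clm_apply hw

/-- A linear map applied to the tensor product of two linear differential operators is a bilinear
differential operator. -/
theorem exists_coeffs_of_isDiffOp {ι κ : Type*} {Ω : Set (Fin n → 𝕜)} {S : ι → Set (Fin n → 𝕜)}
    {S' : κ → Set (Fin n → 𝕜)} {f F : ι → (Fin n → 𝕜) → V} {f' F' : κ → (Fin n → 𝕜) → W}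
    (hF : IsDiffOp Ω S f F) (hF' : IsDiffOp Ω S' f' F') (T : V ⊗[𝕜] W →ₗ[𝕜] U) :
    ∃ a : Coeffs 𝕜 V W U n, a.SmoothOn Ω ∧ ∀ φ ψ, ∀ x ∈ S φ, x ∈ S' ψ →
      T (F φ x ⊗ₜ F' ψ x) = a.eval (f φ) (f' ψ) x := by
  induction hF with
  | add F₁ F₂ _ _ h₁ h₂ =>
    obtain ⟨a, ha, ha'⟩ := h₁
    obtain ⟨b, hb, hb'⟩ := h₂
    refine ⟨a + b, fun αβ t => (ha αβ t).add (hb αβ t), fun φ ψ x hx hx' => ?_⟩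
    rw [TensorProduct.add_tmul, map_add, ha' φ ψ x hx hx', hb' φ ψ x hx hx', Coeffs.eval_add]
  | congr F₁ F₂ _ h' h =>
    obtain ⟨a, ha, ha'⟩ := h
    exact ⟨a, ha, fun φ ψ x hx hx' => by rw [← h' φ hx, ha' φ ψ x hx hx']⟩
  | base α c hc =>
    induction hF' with
    | add F₁ F₂ _ _ h₁ h₂ =>
      obtain ⟨a, ha, ha'⟩ := h₁
      obtain ⟨b, hb, hb'⟩ := h₂
      refine ⟨a + b, fun αβ t => (ha αβ t).add (hb αβ t), fun φ ψ x hx hx' => ?_⟩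
      rw [TensorProduct.tmul_add, map_add, ha' φ ψ x hx hx', hb' φ ψ x hx hx', Coeffs.eval_add]
    | congr F₁ F₂ _ h' h =>
      obtain ⟨a, ha, ha'⟩ := h
      exact ⟨a, ha, fun φ ψ x hx hx' => by rw [← h' ψ hx', ha' φ ψ x hx hx']⟩
    | base β c' hc' =>
      classical
      refine ⟨Finsupp.single (α, β) fun x => T ∘ₗ TensorProduct.map (c x).toLinearMap
        (c' x).toLinearMap, fun αβ t => ?_, fun φ ψ x hx hx' => ?_⟩
      · by_cases h : (α, β) = αβ
        · subst h
          simp only [Finsupp.single_eq_same]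
          induction t using TensorProduct.induction_on with
          | zero => simpa using contDiffOn_const
          | add s t hs ht => simpa only [map_add] using hs.add ht
          | tmul v w =>
            exact contDiffOn_tensor T (hc.clm_apply contDiffOn_const)
              (hc'.clm_apply contDiffOn_const)
        · rw [Finsupp.single_eq_of_ne (Ne.symm h)]
          exact contDiffOn_const
      · rw [Coeffs.eval, Finsupp.sum_single_index (by simp)]
        rfl
end calculus

/-! ### The chain rule for differentials between model spaces -/

section modelDeriv
variable {𝕜 : Type*} [RCLike 𝕜] {E₁ : Type*} [NormedAddCommGroup E₁] [NormedSpace 𝕜 E₁]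
  {E₂ : Type*} [NormedAddCommGroup E₂] [NormedSpace 𝕜 E₂]
  {E₃ : Type*} [NormedAddCommGroup E₃] [NormedSpace 𝕜 E₃]
  {H₁ : Type*} [TopologicalSpace H₁] {I : ModelWithCorners 𝕜 E₁ H₁}
  {H₂ : Type*} [TopologicalSpace H₂] {J : ModelWithCorners 𝕜 E₂ H₂}
  {H₃ : Type*} [TopologicalSpace H₃] {K : ModelWithCorners 𝕜 E₃ H₃}
  {M : Type*} [TopologicalSpace M] [ChartedSpace H₁ M]
  {N : Type*} [TopologicalSpace N] [ChartedSpace H₂ N]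
  {Q : Type*} [TopologicalSpace Q] [ChartedSpace H₃ Q]

theorem modelDeriv_comp {g : N → Q} {f : M → N} {x : M} (hg : MDifferentiableAt J K g (f x))
    (hf : MDifferentiableAt I J f x) :
    modelDeriv I K (g ∘ f) x = (modelDeriv J K g (f x)).comp (modelDeriv I J f x) :=
  mfderiv_comp x hg hf
end modelDeriv

/-! ### The moving frame of a local trivialization -/

section frame
open TopologicalSpace
variable {𝕜 : Type*} [RCLike 𝕜] {E : Type*} [NormedAddCommGroup E] [NormedSpace 𝕜 E]
  {EP : Type*} [NormedAddCommGroup EP] [NormedSpace 𝕜 EP]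
  {G : Type*} [TopologicalSpace G] [ChartedSpace E G] [Group G] [LieGroup 𝓘(𝕜, E) ∞ G]
  {P : Subgroup G} [ChartedSpace EP P] [LieGroup 𝓘(𝕜, EP) ∞ P]
  {V : Type*} [NormedAddCommGroup V] [NormedSpace 𝕜 V]
  {n : ℕ} (τ : LocalTriv 𝕜 E EP P n)

theorem LocalTriv.contMDiffOn :
    ContMDiffOn 𝓘(𝕜, Fin n → 𝕜) 𝓘(𝕜, E) ∞ τ.toFun τ.domain := by
  intro x hx
  have h1 : ContMDiffAt 𝓘(𝕜, Fin n → 𝕜) (𝓘(𝕜, Fin n → 𝕜).prod 𝓘(𝕜, EP)) ∞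
      (fun y : Fin n → 𝕜 => (y, (1 : P))) x := contMDiffAt_id.prodMk contMDiffAt_const
  have h2 := ContMDiffAt.comp (I' := 𝓘(𝕜, Fin n → 𝕜).prod 𝓘(𝕜, EP)) x
    (τ.isLocalDiffeomorphAt x hx 1).contMDiffAt h1
  refine (h2.congr_of_eventuallyEq (Filter.Eventually.of_forall fun y => ?_)).contMDiffWithinAt
  simp

theorem LocalTriv.contMDiffAt {x : Fin n → 𝕜} (hx : x ∈ τ.domain) :
    ContMDiffAt 𝓘(𝕜, Fin n → 𝕜) 𝓘(𝕜, E) ∞ τ.toFun x :=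
  τ.contMDiffOn.contMDiffAt (τ.domain.isOpen.mem_nhds hx)

/-- The differential at `x` of the section `s` of a local trivialization, translated to the Lie
algebra by `s(x)⁻¹`. -/
noncomputable def LocalTriv.logDeriv (x : Fin n → 𝕜) : (Fin n → 𝕜) →L[𝕜] E :=
  modelDeriv 𝓘(𝕜, Fin n → 𝕜) 𝓘(𝕜, E) (fun y => (τ.toFun x)⁻¹ * τ.toFun y) x

theorem LocalTriv.mdifferentiableAt_inv_mul {x : Fin n → 𝕜} (hx : x ∈ τ.domain) (g : G) :
    MDifferentiableAt 𝓘(𝕜, Fin n → 𝕜) 𝓘(𝕜, E) (fun y => g * τ.toFun y) x :=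
  ((contMDiffAt_const (c := g)).mul (τ.contMDiffAt hx)).mdifferentiableAt (by decide)

/-- Write `s(y) = s(x) · (s(x)⁻¹ s(y))`. The second factor is `1` at `y = x` and has differential
`logDeriv` there, so the chain rule yields a left invariant derivative at `s(x)`. -/
theorem LocalTriv.fderiv_comp {x : Fin n → 𝕜} (hx : x ∈ τ.domain) {f : G → V}
    (hf : MDifferentiableAt 𝓘(𝕜, E) 𝓘(𝕜, V) f (τ.toFun x)) (v : Fin n → 𝕜) :
    fderiv 𝕜 (fun y => f (τ.toFun y)) x v =
      rightDeriv (𝕜 := 𝕜) (E := E) (τ.logDeriv x v) f (τ.toFun x) := by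
  have h1 : MDifferentiableAt 𝓘(𝕜, E) 𝓘(𝕜, V) (fun h => f (τ.toFun x * h))
      ((τ.toFun x)⁻¹ * τ.toFun x) := by
    refine MDifferentiableAt.comp (I' := 𝓘(𝕜, E)) _ ?_
      ((contMDiff_mul_left (I := 𝓘(𝕜, E)) (n := ∞)).mdifferentiable (by decide) _)
    simpa using hf
  have h2 := modelDeriv_comp (f := fun y => (τ.toFun x)⁻¹ * τ.toFun y) h1 (τ.mdifferentiableAt_inv_mul hx _)
  have h3 : ((fun h => f (τ.toFun x * h)) ∘ fun y => (τ.toFun x)⁻¹ * τ.toFun y) =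
      fun y => f (τ.toFun y) := by
    funext y
    simp
  rw [h3, inv_mul_cancel] at h2
  rw [← mfderiv_eq_fderiv]
  exact congrArg (fun L : (Fin n → 𝕜) →L[𝕜] V => L v) h2

/-- The map `(v, Y) ↦ s(x)⁻¹ ds_x(v) + Y` from `𝕜ⁿ × 𝔭` to the Lie algebra of `G`. -/
noncomputable def LocalTriv.frame (x : Fin n → 𝕜) : ((Fin n → 𝕜) × EP) →L[𝕜] E :=
  (τ.logDeriv x).coprod (modelDeriv 𝓘(𝕜, EP) 𝓘(𝕜, E) P.subtype 1)

variable (𝕜 E) in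
/-- Left translation, as a diffeomorphism. -/
def mulLeftDiffeo (g : G) : G ≃ₘ^∞⟮𝓘(𝕜, E), 𝓘(𝕜, E)⟯ G where
  toEquiv := Equiv.mulLeft g
  contMDiff_toFun := contMDiff_mul_left
  contMDiff_invFun := contMDiff_mul_left

/-- The frame is the differential at `(x, 1)` of the local diffeomorphism `(y, p) ↦ s(x)⁻¹ s(y) p`.
-/
theorem LocalTriv.isInvertible_frame {x : Fin n → 𝕜} (hx : x ∈ τ.domain) :
    (τ.frame x).IsInvertible := by
  have h1 := (τ.isLocalDiffeomorphAt x hx 1).comp (K := 𝓘(𝕜, E)) (P := G)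
    ((mulLeftDiffeo 𝕜 E (τ.toFun x)⁻¹).isLocalDiffeomorph _)
  refine ⟨h1.mfderivToContinuousLinearEquiv (by decide), ?_⟩
  refine ContinuousLinearMap.ext fun ⟨v, Y⟩ => ?_
  refine (mfderiv_prod_eq_add_apply (v := ((v, Y) : (Fin n → 𝕜) × EP))
    (h1.mdifferentiableAt (by decide))).trans ?_
  change modelDeriv 𝓘(𝕜, Fin n → 𝕜) 𝓘(𝕜, E)
      (fun z => (τ.toFun x)⁻¹ * (τ.toFun z * ((1 : P) : G))) x v +
    modelDeriv 𝓘(𝕜, EP) 𝓘(𝕜, E) (fun z : P => (τ.toFun x)⁻¹ * (τ.toFun x * (z : G))) 1 Y = _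
  simp only [Subgroup.coe_one, mul_one, inv_mul_cancel_left]
  rfl

/-- In `logDeriv` the point `x` is both a parameter and the place of differentiation. Read in the
chart at `1`, it is a partial derivative of one smooth function of two variables, restricted to the
diagonal; the constant differential `D` of the chart is then removed. -/
theorem LocalTriv.contDiffOn_logDeriv : ContDiffOn 𝕜 ∞ τ.logDeriv τ.domain := by
  intro x₀ hx₀
  apply ContDiffAt.contDiffWithinAt
  let c := extChartAt 𝓘(𝕜, E) (1 : G)
  obtain ⟨D', hD'⟩ := isInvertible_mfderiv_extChartAt (mem_extChartAt_source (I := 𝓘(𝕜, E)) (1 : G))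
  let D : E ≃L[𝕜] E := D'
  have hD : modelDeriv 𝓘(𝕜, E) 𝓘(𝕜, E) c 1 = D := hD'.symm
  have hcd : ContMDiffAt 𝓘(𝕜, E) 𝓘(𝕜, E) ∞ c 1 := contMDiffAt_extChartAt
  let Ψ : (Fin n → 𝕜) → (Fin n → 𝕜) → E := fun x y => c ((τ.toFun x)⁻¹ * τ.toFun y)
  have hΨ : ContDiffAt 𝕜 ∞ (Function.uncurry Ψ) (x₀, x₀) := by
    rw [← contMDiffAt_iff_contDiffAt]
    have h1 : ContMDiffAt 𝓘(𝕜, (Fin n → 𝕜) × (Fin n → 𝕜)) 𝓘(𝕜, E) ∞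
        (fun q : (Fin n → 𝕜) × (Fin n → 𝕜) => (τ.toFun q.1)⁻¹ * τ.toFun q.2) (x₀, x₀) := by
      refine ContMDiffAt.mul (ContMDiffAt.inv ?_) ?_
      · exact ContMDiffAt.comp (I' := 𝓘(𝕜, Fin n → 𝕜)) (f := Prod.fst) (x₀, x₀)
          (by exact τ.contMDiffAt hx₀) contDiff_fst.contMDiff.contMDiffAt
      · exact ContMDiffAt.comp (I' := 𝓘(𝕜, Fin n → 𝕜)) (f := Prod.snd) (x₀, x₀)
          (by exact τ.contMDiffAt hx₀) contDiff_snd.contMDiff.contMDiffAt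
    refine ContMDiffAt.comp (I' := 𝓘(𝕜, E)) (x₀, x₀) ?_ h1
    change ContMDiffAt 𝓘(𝕜, E) 𝓘(𝕜, E) ∞ c ((τ.toFun x₀)⁻¹ * τ.toFun x₀)
    rw [inv_mul_cancel]
    exact hcd
  have h2 : ContDiffAt 𝕜 ∞ (fun x => fderiv 𝕜 (Ψ x) x) x₀ :=
    ContDiffAt.fderiv (g := fun x => x) hΨ contDiffAt_id (by decide)
  have h3 : ContDiffAt 𝕜 ∞ (fun x => (D.symm : E →L[𝕜] E).comp (fderiv 𝕜 (Ψ x) x)) x₀ :=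
    contDiffAt_const.clm_comp h2
  refine h3.congr_of_eventuallyEq ?_
  filter_upwards [τ.domain.isOpen.mem_nhds hx₀] with x hx
  have h4 : MDifferentiableAt 𝓘(𝕜, E) 𝓘(𝕜, E) c ((τ.toFun x)⁻¹ * τ.toFun x) := by
    rw [inv_mul_cancel]
    exact hcd.mdifferentiableAt (by decide)
  have h5 := modelDeriv_comp (f := fun y => (τ.toFun x)⁻¹ * τ.toFun y) h4 (τ.mdifferentiableAt_inv_mul hx _)
  rw [inv_mul_cancel, hD] at h5
  have h6 : fderiv 𝕜 (Ψ x) x = (D : E →L[𝕜] E).comp (τ.logDeriv x) := by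
    rw [← mfderiv_eq_fderiv]
    exact h5
  rw [h6]
  ext v
  simp

theorem LocalTriv.contDiffOn_inverse_frame [CompleteSpace EP] :
    ContDiffOn 𝕜 ∞ (fun x => (τ.frame x).inverse) τ.domain := by
  intro x hx
  have h1 : ContDiffWithinAt 𝕜 ∞ τ.frame τ.domain x := by
    have h2 : τ.frame = fun y => (τ.logDeriv y).comp (ContinuousLinearMap.fst 𝕜 (Fin n → 𝕜) EP) +
        (modelDeriv 𝓘(𝕜, EP) 𝓘(𝕜, E) P.subtype 1).comp
          (ContinuousLinearMap.snd 𝕜 (Fin n → 𝕜) EP) := by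
      funext y
      ext1 <;> ext <;> simp [LocalTriv.frame]
    rw [h2]
    exact ((τ.contDiffOn_logDeriv x hx).clm_comp contDiffWithinAt_const).add contDiffWithinAt_const
  exact (τ.isInvertible_frame hx).contDiffAt_map_inverse.comp_contDiffWithinAt x h1

theorem LocalTriv.frame_inverse {x : Fin n → 𝕜} (hx : x ∈ τ.domain) (X : E) :
    X = τ.logDeriv x ((τ.frame x).inverse X).1 +
      modelDeriv 𝓘(𝕜, EP) 𝓘(𝕜, E) P.subtype 1 ((τ.frame x).inverse X).2 := by
  obtain ⟨e, he⟩ := τ.isInvertible_frame hx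
  have h1 : τ.frame x ((τ.frame x).inverse X) = X := by
    rw [← he, ContinuousLinearMap.inverse_equiv]
    exact e.apply_symm_apply X
  exact h1.symm
end frame

/-! ### Partial derivatives versus left invariant operators -/

section jets
open TopologicalSpace
variable {𝕜 : Type*} [RCLike 𝕜] {E : Type*} [NormedAddCommGroup E] [NormedSpace 𝕜 E]
  [CompleteSpace E] {EP : Type*} [NormedAddCommGroup EP] [NormedSpace 𝕜 EP] [CompleteSpace EP]
  {G : Type*} [TopologicalSpace G] [ChartedSpace E G] [Group G] [LieGroup 𝓘(𝕜, E) ∞ G]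
  {P : Subgroup G} [ChartedSpace EP P] [LieGroup 𝓘(𝕜, EP) ∞ P]
  {V : Type*} [NormedAddCommGroup V] [NormedSpace 𝕜 V]
  {n : ℕ} (τ : LocalTriv 𝕜 E EP P n)

/-- Families of vectors which are finite sums of smooth functions times constant vectors. -/
inductive IsSmoothFamily {n : ℕ} (Ω : Set (Fin n → 𝕜)) {M : Type*} [AddCommGroup M] [Module 𝕜 M] :
    ((Fin n → 𝕜) → M) → Prop
  | base (a : (Fin n → 𝕜) → 𝕜) (ha : ContDiffOn 𝕜 ∞ a Ω) (u : M) :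
      IsSmoothFamily Ω fun x => a x • u
  | add (c c' : (Fin n → 𝕜) → M) (h : IsSmoothFamily Ω c) (h' : IsSmoothFamily Ω c') :
      IsSmoothFamily Ω fun x => c x + c' x

theorem IsSmoothFamily.sum {Ω : Set (Fin n → 𝕜)} {M : Type*} [AddCommGroup M] [Module 𝕜 M]
    {κ : Type*} (s : Finset κ) {c : κ → (Fin n → 𝕜) → M} (h : ∀ k ∈ s, IsSmoothFamily Ω (c k)) :
    IsSmoothFamily Ω fun x => ∑ k ∈ s, c k x := by
  classical
  induction s using Finset.induction_on with
  | empty => simpa using IsSmoothFamily.base (M := M) (Ω := Ω) 0 contDiffOn_const 0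
  | insert k s hk ih =>
    simp only [Finset.sum_insert hk]
    exact (h k (Finset.mem_insert_self _ _)).add _ _
      (ih fun k' hk' => h k' (Finset.mem_insert_of_mem hk'))

/-- The part of the domain of a local trivialization over which a function on `O` is defined. -/
def LocalTriv.domainOver (O : Opens G) : Set (Fin n → 𝕜) := τ.domain ∩ τ.toFun ⁻¹' O

theorem LocalTriv.isOpen_domainOver (O : Opens G) : IsOpen (τ.domainOver O) :=
  τ.contMDiffOn.continuousOn.isOpen_inter_preimage τ.domain.isOpen O.isOpen

theorem LocalTriv.contDiffOn_comp {O : Opens G} (f : smoothFn 𝕜 E V O) :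
    ContDiffOn 𝕜 ∞ (fun x => (f : G → V) (τ.toFun x)) (τ.domainOver O) := by
  rw [← contMDiffOn_iff_contDiffOn]
  exact f.2.1.comp (τ.contMDiffOn.mono Set.inter_subset_left) fun x hx => hx.2

theorem LocalTriv.contDiffOn_evalJet {O : Opens G} (f : smoothFn 𝕜 E V O) (u : Env 𝕜 E G) :
    ContDiffOn 𝕜 ∞ (fun x => evalJet f (τ.toFun x) u) (τ.domainOver O) :=
  τ.contDiffOn_comp (rightAct 𝕜 E V O u f)

variable (𝕜 E G) in
/-- The inclusion of the Lie algebra into its enveloping algebra, on the model vector space. -/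
noncomputable def envGen : E →ₗ[𝕜] Env 𝕜 E G where
  toFun X := UniversalEnvelopingAlgebra.ι 𝕜 (L := LieAlg 𝕜 E G) X
  map_add' X Y := (UniversalEnvelopingAlgebra.ι 𝕜 (L := LieAlg 𝕜 E G)).map_add X Y
  map_smul' c X := (UniversalEnvelopingAlgebra.ι 𝕜 (L := LieAlg 𝕜 E G)).map_smul c X

theorem evalJet_envGen_mul {O : Opens G} (f : smoothFn 𝕜 E V O) {g : G} (hg : g ∈ O)
    (X : E) (u : Env 𝕜 E G) :
    evalJet f g (envGen 𝕜 E G X * u) =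
      rightDeriv (𝕜 := 𝕜) (E := E) X (fun h => evalJet f h u) g :=
  evalJet_ι_mul f hg X u

theorem LocalTriv.fderiv_evalJet {O : Opens G} (f : smoothFn 𝕜 E V O) (u : Env 𝕜 E G)
    {x : Fin n → 𝕜} (hx : x ∈ τ.domainOver O) (v : Fin n → 𝕜) :
    fderiv 𝕜 (fun y => evalJet f (τ.toFun y) u) x v = evalJet f (τ.toFun x)
      (envGen 𝕜 E G (τ.logDeriv x v) * u) := by
  rw [evalJet_envGen_mul f hx.2]
  exact τ.fderiv_comp hx.1 (smoothFn_mdifferentiableAt (rightAct 𝕜 E V O u f) hx.2) v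

theorem LocalTriv.contDiffOn_evalJet_family {O : Opens G} (f : smoothFn 𝕜 E V O)
    {c : (Fin n → 𝕜) → Env 𝕜 E G} (hc : IsSmoothFamily (τ.domain : Set (Fin n → 𝕜)) c) :
    ContDiffOn 𝕜 ∞ (fun x => evalJet f (τ.toFun x) (c x)) (τ.domainOver O) := by
  induction hc with
  | base a ha u =>
    simp only [map_smul]
    exact (ha.mono Set.inter_subset_left).smul (τ.contDiffOn_evalJet f u)
  | add c c' _ _ h h' => simpa only [map_add] using h.add h'

/-- `∂_i (a r(u) f) = (∂_i a) r(u) f + a r(X u) f` with `X = s⁻¹ ∂_i s`. This `X` varies with `x`;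
expanding it in a fixed basis of `𝔤` gives a smooth family again, and the same one for all `f`. -/
theorem LocalTriv.coordDeriv_evalJet_family [FiniteDimensional 𝕜 E]
    {c : (Fin n → 𝕜) → Env 𝕜 E G} (hc : IsSmoothFamily (τ.domain : Set (Fin n → 𝕜)) c)
    (i : Fin n) : ∃ c' : (Fin n → 𝕜) → Env 𝕜 E G,
      IsSmoothFamily (τ.domain : Set (Fin n → 𝕜)) c' ∧
      ∀ (O : Opens G) (f : smoothFn 𝕜 E V O),
        Set.EqOn (coordDeriv i fun x => evalJet f (τ.toFun x) (c x))
          (fun x => evalJet f (τ.toFun x) (c' x)) (τ.domainOver O) := by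
  have hd : ∀ {O : Opens G} {f : (Fin n → 𝕜) → V} {x}, ContDiffOn 𝕜 ∞ f (τ.domainOver O) →
      x ∈ τ.domainOver O → DifferentiableAt 𝕜 f x := fun h hx =>
    (h.contDiffAt ((τ.isOpen_domainOver _).mem_nhds hx)).differentiableAt (by decide)
  induction hc with
  | add c₁ c₂ h₁ h₂ ih₁ ih₂ =>
    obtain ⟨c₁', hc₁', hc₁⟩ := ih₁
    obtain ⟨c₂', hc₂', hc₂⟩ := ih₂
    refine ⟨_, hc₁'.add _ _ hc₂', fun O f x hx => ?_⟩
    simp only [map_add]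
    refine Eq.trans ?_ (congrArg₂ (· + ·) (hc₁ O f hx) (hc₂ O f hx))
    rw [coordDeriv, fderiv_fun_add
      (hd (τ.contDiffOn_evalJet_family f h₁) hx) (hd (τ.contDiffOn_evalJet_family f h₂) hx)]
    rfl
  | base a ha u =>
    let b := Module.finBasis 𝕜 E
    refine ⟨fun x => fderiv 𝕜 a x (Pi.single i 1) • u + ∑ k, (a x * b.repr (τ.logDeriv x
      (Pi.single i 1)) k) • (envGen 𝕜 E G (b k) * u),
      IsSmoothFamily.add _ _ (IsSmoothFamily.base _ ((ha.fderiv_of_isOpen τ.domain.isOpen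
        (by decide)).clm_apply contDiffOn_const) u)
        (IsSmoothFamily.sum _ fun k _ => IsSmoothFamily.base _ (ha.mul ?_) _), fun O f x hx => ?_⟩
    · exact (LinearMap.toContinuousLinearMap (b.coord k)).contDiff.comp_contDiffOn
        (τ.contDiffOn_logDeriv.clm_apply contDiffOn_const)
    · have h1 : DifferentiableAt 𝕜 a x :=
        (ha.contDiffAt (τ.domain.isOpen.mem_nhds hx.1)).differentiableAt (by decide)
      have h2 := hd (τ.contDiffOn_evalJet f u) hx
      simp only [map_smul]
      rw [coordDeriv, fderiv_fun_smul h1 h2]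
      simp only [add_apply, smul_apply, map_add, map_sum, map_smul,
        ContinuousLinearMap.smulRight_apply]
      rw [τ.fderiv_evalJet f u hx, add_comm]
      congr 1
      have h3 : envGen 𝕜 E G (τ.logDeriv x (Pi.single i 1)) =
          ∑ k, b.repr (τ.logDeriv x (Pi.single i 1)) k •
            envGen 𝕜 E G (b k) := by
        conv_lhs => rw [← b.sum_repr (τ.logDeriv x (Pi.single i 1))]
        simp only [map_sum, map_smul]
      rw [h3, Finset.sum_mul, map_sum, Finset.smul_sum]
      simp only [smul_mul_assoc, map_smul, mul_smul]

/-- In a local trivialization, partial derivatives are given by left invariant differential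
operators. -/
theorem LocalTriv.partialDeriv_eq_evalJet [FiniteDimensional 𝕜 E] (α : Fin n → ℕ) :
    ∃ c : (Fin n → 𝕜) → Env 𝕜 E G, ∀ (O : Opens G) (f : smoothFn 𝕜 E V O),
      ∀ x ∈ τ.domain, τ.toFun x ∈ O →
        partialDeriv α (fun y => (f : G → V) (τ.toFun y)) x = evalJet f (τ.toFun x) (c x) := by
  let C : ((Σ O : Opens G, smoothFn 𝕜 E V O) → (Fin n → 𝕜) → V) → Prop := fun F =>
    ∃ c : (Fin n → 𝕜) → Env 𝕜 E G, IsSmoothFamily (τ.domain : Set (Fin n → 𝕜)) c ∧ ∀ φ,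
      Set.EqOn (F φ) (fun x => evalJet φ.2 (τ.toFun x) (c x)) (τ.domainOver φ.1)
  have h := partialDeriv_induction (C := C) (fun i F hF => ?_) α
    (F := fun φ y => (φ.2 : G → V) (τ.toFun y)) ?_
  · obtain ⟨c, _, hc⟩ := h
    exact ⟨c, fun O f x hx hxO => hc ⟨O, f⟩ ⟨hx, hxO⟩⟩
  · obtain ⟨c, hc, hF⟩ := hF
    obtain ⟨c', hc', h'⟩ := τ.coordDeriv_evalJet_family (V := V) hc i
    exact ⟨c', hc', fun φ => (coordDeriv_eqOn (τ.isOpen_domainOver _) (hF φ) i).trans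
      (h' φ.1 φ.2)⟩
  · exact ⟨_, IsSmoothFamily.base 1 contDiffOn_const 1, fun φ x _ => by simp [evalJet_one]⟩

variable [hP : IsClosedLieSubgroup 𝕜 E EP P] [FiniteDimensional 𝕜 V]

/-- In a local trivialization, left invariant differential operators act on sections by linear
differential operators with smooth coefficients. -/
theorem LocalTriv.isDiffOp_evalJet [FiniteDimensional 𝕜 EP] (ρV : SmoothRep 𝕜 EP P V)
    (u : Env 𝕜 E G) :
    IsDiffOp (ι := Σ O : Opens (G ⧸ P), sections E ρV O) (τ.domain : Set (Fin n → 𝕜))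
      (fun φ => τ.domainOver (liftOpens φ.1)) (fun φ x => (φ.2 : G → V) (τ.toFun x))
      fun φ x => evalJet (sectionFn φ.2) (τ.toFun x) u := by
  -- Induction on the degree modulo `𝔘(𝔭)`: elements of `𝔘(𝔭)` act on sections by constant
  -- endomorphisms, that is, with order zero.
  obtain ⟨N, hN⟩ := exists_mem_relFil (homLie P.subtype hP.contMDiff_subtype) u
  induction N generalizing u with
  | zero =>
    obtain ⟨y, rfl⟩ := mem_relFil_zero hN
    refine (IsDiffOp.base 0 (fun _ => LinearMap.toContinuousLinearMap
      (envRep ρV (MulOpposite.unop (envAnti 𝕜 _ y)))) contDiffOn_const).congr _ _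
      fun φ x hx => ?_
    have h1 := evalJet_section_mul φ.2 hx.2 y 1
    rw [one_mul, evalJet_one] at h1
    simp only [partialDeriv_zero]
    exact h1.symm
  | succ N ih =>
    refine relFil_succ_induction (C := fun u =>
      IsDiffOp (ι := Σ O : Opens (G ⧸ P), sections E ρV O) (τ.domain : Set (Fin n → 𝕜))
      (fun φ => τ.domainOver (liftOpens φ.1)) (fun φ x => (φ.2 : G → V) (τ.toFun x))
      fun φ x => evalJet (sectionFn φ.2) (τ.toFun x) u) ih ?_ ?_ hN
    · intro X w hw
      let b := Module.finBasis 𝕜 EP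
      -- At `s(x)` write `X = logDeriv(v) + Y`, where `(v, Y)` is the inverse of the frame applied
      -- to `X` and is smooth in `x`. The first part acts as the coordinate derivative along `v`;
      -- the second, times `w`, still has degree `N`, so the induction hypothesis covers it.
      have hR : ContDiffOn 𝕜 ∞ (fun x => (τ.frame x).inverse (X : E)) τ.domain :=
        τ.contDiffOn_inverse_frame.clm_apply contDiffOn_const
      have h1 : ∀ i : Fin n, IsDiffOp (ι := Σ O : Opens (G ⧸ P), sections E ρV O)
          (τ.domain : Set (Fin n → 𝕜)) (fun φ => τ.domainOver (liftOpens φ.1))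
          (fun φ x => (φ.2 : G → V) (τ.toFun x)) fun φ x => ((τ.frame x).inverse (X : E)).1 i •
            coordDeriv i (fun y => evalJet (sectionFn φ.2) (τ.toFun y) w) x := by
        intro i
        have h0 := IsDiffOp.coordDeriv
          (S := fun φ : (Σ O : Opens (G ⧸ P), sections E ρV O) => τ.domainOver (liftOpens φ.1))
          (f := fun φ x => (φ.2 : G → V) (τ.toFun x)) (fun φ => τ.isOpen_domainOver _)
          (fun φ => Set.inter_subset_left) (fun φ => τ.contDiffOn_comp (sectionFn φ.2))
          τ.domain.isOpen (ih w hw) i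
        exact h0.smul (((ContinuousLinearMap.proj i).comp (ContinuousLinearMap.fst 𝕜 (Fin n → 𝕜)
            EP)).contDiff.comp_contDiffOn hR)
      have h2 : ∀ k, IsDiffOp (ι := Σ O : Opens (G ⧸ P), sections E ρV O)
          (τ.domain : Set (Fin n → 𝕜)) (fun φ => τ.domainOver (liftOpens φ.1))
          (fun φ x => (φ.2 : G → V) (τ.toFun x)) fun φ x =>
            b.repr ((τ.frame x).inverse (X : E)).2 k • evalJet (sectionFn φ.2) (τ.toFun x)
              (envGen 𝕜 E G (modelDeriv 𝓘(𝕜, EP) 𝓘(𝕜, E) P.subtype 1 (b k)) * w) := fun k =>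
        (ih _ (ι_sub_mul_mem_relFil (L' := LieAlg 𝕜 EP P) (b k) hw)).smul
          (((LinearMap.toContinuousLinearMap (b.coord k)).comp (ContinuousLinearMap.snd 𝕜
            (Fin n → 𝕜) EP)).contDiff.comp_contDiffOn hR)
      refine ((IsDiffOp.sum Finset.univ fun i _ => h1 i).add _ _
        (IsDiffOp.sum Finset.univ fun k _ => h2 k)).congr _ _ fun φ x hx => ?_
      beta_reduce
      rw [← fderiv_eq_sum_coordDeriv, τ.fderiv_evalJet _ _ hx]
      have h3 : envGen 𝕜 E G X = envGen 𝕜 E G (τ.logDeriv x ((τ.frame x).inverse (X : E)).1) +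
          ∑ k, b.repr ((τ.frame x).inverse (X : E)).2 k •
            envGen 𝕜 E G (modelDeriv 𝓘(𝕜, EP) 𝓘(𝕜, E) P.subtype 1 (b k)) := by
        conv_lhs => rw [τ.frame_inverse hx.1 X, map_add]
        congr 1
        conv_lhs => rw [← b.sum_repr ((τ.frame x).inverse (X : E)).2]
        simp only [map_sum, map_smul]
      change _ = evalJet (sectionFn φ.2) (τ.toFun x) (envGen 𝕜 E G X * w)
      rw [h3, add_mul, map_add, Finset.sum_mul, map_sum]
      simp only [smul_mul_assoc, map_smul]
    · intro s t hs ht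
      simpa only [map_add] using hs.add _ _ ht

variable {W : Type*} [NormedAddCommGroup W] [NormedSpace 𝕜 W] [FiniteDimensional 𝕜 W]
  {U : Type*} [NormedAddCommGroup U] [NormedSpace 𝕜 U]

/-- The property is stable under sums in `t`; for a pure tensor it combines two operators from
`LocalTriv.isDiffOp_evalJet`. -/
theorem LocalTriv.exists_coeffs_biDiff [FiniteDimensional 𝕜 EP] (ρV : SmoothRep 𝕜 EP P V)
    (ρW : SmoothRep 𝕜 EP P W)
    (t : (Env 𝕜 E G ⊗[𝕜] Env 𝕜 E G) ⊗[𝕜] (V ⊗[𝕜] W →ₗ[𝕜] U)) :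
    ∃ a : Coeffs 𝕜 V W U n, a.SmoothOn τ.domain ∧
    ∀ (O : Opens (G ⧸ P)) (φ : sections E ρV O) (ψ : sections E ρW O), ∀ x ∈ τ.domain,
      τ.toFun x ∈ liftOpens O → biDiff U (sectionFn φ) (sectionFn ψ) (τ.toFun x) t =
        a.eval (fun y => (φ : G → V) (τ.toFun y)) (fun y => (ψ : G → W) (τ.toFun y)) x := by
  have hadd : ∀ t t' : (Env 𝕜 E G ⊗[𝕜] Env 𝕜 E G) ⊗[𝕜] (V ⊗[𝕜] W →ₗ[𝕜] U),
    (∃ a : Coeffs 𝕜 V W U n, a.SmoothOn τ.domain ∧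
    ∀ (O : Opens (G ⧸ P)) (φ : sections E ρV O) (ψ : sections E ρW O), ∀ x ∈ τ.domain,
      τ.toFun x ∈ liftOpens O → biDiff U (sectionFn φ) (sectionFn ψ) (τ.toFun x) t =
        a.eval (fun y => (φ : G → V) (τ.toFun y)) (fun y => (ψ : G → W) (τ.toFun y)) x) →
    (∃ a : Coeffs 𝕜 V W U n, a.SmoothOn τ.domain ∧
    ∀ (O : Opens (G ⧸ P)) (φ : sections E ρV O) (ψ : sections E ρW O), ∀ x ∈ τ.domain,
      τ.toFun x ∈ liftOpens O → biDiff U (sectionFn φ) (sectionFn ψ) (τ.toFun x) t' =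
        a.eval (fun y => (φ : G → V) (τ.toFun y)) (fun y => (ψ : G → W) (τ.toFun y)) x) →
    (∃ a : Coeffs 𝕜 V W U n, a.SmoothOn τ.domain ∧
    ∀ (O : Opens (G ⧸ P)) (φ : sections E ρV O) (ψ : sections E ρW O), ∀ x ∈ τ.domain,
      τ.toFun x ∈ liftOpens O → biDiff U (sectionFn φ) (sectionFn ψ) (τ.toFun x) (t + t') =
        a.eval (fun y => (φ : G → V) (τ.toFun y)) (fun y => (ψ : G → W) (τ.toFun y)) x) := by
    rintro t t' ⟨a, ha, ha'⟩ ⟨b, hb, hb'⟩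
    refine ⟨a + b, fun αβ t => (ha αβ t).add (hb αβ t), fun O φ ψ x hx hxO => ?_⟩
    rw [map_add, ha' O φ ψ x hx hxO, hb' O φ ψ x hx hxO, Coeffs.eval_add]
  induction t using TensorProduct.induction_on with
  | zero => exact ⟨0, fun _ _ => contDiffOn_const, fun O φ ψ x _ _ => by rw [map_zero]; rfl⟩
  | add t t' h h' => exact hadd t t' h h'
  | tmul u T =>
    induction u using TensorProduct.induction_on with
    | zero =>
      exact ⟨0, fun _ _ => contDiffOn_const, fun O φ ψ x _ _ => by
        rw [TensorProduct.zero_tmul, map_zero]; rfl⟩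
    | add u u' h h' => rw [TensorProduct.add_tmul]; exact hadd _ _ h h'
    | tmul u₁ u₂ =>
      obtain ⟨a, ha, ha'⟩ := exists_coeffs_of_isDiffOp (τ.isDiffOp_evalJet ρV u₁)
        (τ.isDiffOp_evalJet ρW u₂) T
      exact ⟨a, ha, fun O φ ψ x hx hxO => ha' ⟨O, φ⟩ ⟨O, ψ⟩ x ⟨hx, hxO⟩ ⟨hx, hxO⟩⟩

/-- At a point of a local trivialization, a bilinear differential operator is given by an element of
`𝔘(𝔤) ⊗ 𝔘(𝔤) ⊗ Hom(V ⊗ W, U)`. -/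
theorem LocalTriv.exists_biDiff_eq_eval [FiniteDimensional 𝕜 E] (a : Coeffs 𝕜 V W U n)
    {x : Fin n → 𝕜} (hx : x ∈ τ.domain) :
    ∃ t : (Env 𝕜 E G ⊗[𝕜] Env 𝕜 E G) ⊗[𝕜] (V ⊗[𝕜] W →ₗ[𝕜] U),
    ∀ (O : Opens G) (f : smoothFn 𝕜 E V O) (f' : smoothFn 𝕜 E W O), τ.toFun x ∈ O →
      a.eval (fun y => (f : G → V) (τ.toFun y)) (fun y => (f' : G → W) (τ.toFun y)) x =
        biDiff U f f' (τ.toFun x) t := by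
  choose c hc using τ.partialDeriv_eq_evalJet (V := V)
  choose c' hc' using τ.partialDeriv_eq_evalJet (V := W)
  -- The coefficients are frozen at `x`; as `c` and `c'` do not depend on the functions, one `t`
  -- serves them all.
  refine ⟨a.sum fun αβ T => (c αβ.1 x ⊗ₜ c' αβ.2 x) ⊗ₜ T x, fun O f f' hxO => ?_⟩
  rw [Coeffs.eval, Finsupp.sum, Finsupp.sum, map_sum]
  refine Finset.sum_congr rfl fun αβ _ => ?_
  rw [hc αβ.1 O f x hx hxO, hc' αβ.2 O f' x hx hxO, biDiff_tmul]
  rfl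

end jets

/-! ### Vector valued polynomials vanishing identically -/

section polynomial
variable {R : Type*} [Field R] {σ : Type*} [DecidableEq σ]

theorem prod_map_X (s : Multiset σ) :
    (s.map (MvPolynomial.X (R := R))).prod = MvPolynomial.monomial (Multiset.toFinsupp s) 1 := by
  induction s using Multiset.induction_on with
  | empty => simp
  | cons a s ih =>
    rw [Multiset.map_cons, Multiset.prod_cons, ih, ← Multiset.singleton_add, map_add,
      Multiset.toFinsupp_singleton, MvPolynomial.X, MvPolynomial.monomial_mul, one_mul]

/-- Vectors are determined by the values of the polynomial which has them as coefficients. -/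
theorem eq_zero_of_forall_prod_smul [Infinite R] {U : Type*} [AddCommGroup U] [Module R U]
    {κ : Type*} (S : Finset κ) {e : κ → Multiset σ} (he : Function.Injective e) (d : κ → U)
    (h : ∀ l : σ → R, ∑ k ∈ S, ((e k).map l).prod • d k = 0) : ∀ k ∈ S, d k = 0 := by
  intro k hk
  rw [← Module.forall_dual_apply_eq_zero_iff R]
  intro ξ
  -- A functional `ξ` reduces to scalar coefficients, and over an infinite field a polynomial with
  -- zero values is zero.
  have h1 : ∑ k ∈ S, MvPolynomial.C (ξ (d k)) * ((e k).map (MvPolynomial.X (R := R))).prod = 0 := by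
    refine MvPolynomial.funext fun l => ?_
    rw [map_sum, map_zero, ← map_zero ξ, ← h l, map_sum]
    refine Finset.sum_congr rfl fun k _ => ?_
    rw [map_mul, map_multiset_prod, Multiset.map_map]
    simp [mul_comm]
  have h2 := congrArg (MvPolynomial.coeff (Multiset.toFinsupp (e k))) h1
  rw [MvPolynomial.coeff_sum, Finset.sum_eq_single k] at h2
  · simpa [prod_map_X] using h2
  · intro k' _ hk'
    have h3 : Multiset.toFinsupp (e k') ≠ Multiset.toFinsupp (e k) := fun h3 =>
      hk' (he (Multiset.toFinsupp.injective h3))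
    rw [prod_map_X, MvPolynomial.coeff_C_mul, MvPolynomial.coeff_monomial, if_neg h3, mul_zero]
  · exact fun h => (h hk).elim

theorem filterMap_const_none {α β : Type*} (s : Multiset α) :
    Multiset.filterMap (fun _ => (none : Option β)) s = 0 := by
  induction s using Multiset.induction_on <;> simp [*]

/-- Allows a pair of multi-indices to be treated as a single monomial in a doubled set of variables.
-/
theorem disjSum_injective {α β : Type*} :
    Function.Injective fun s : Multiset α × Multiset β => s.1.disjSum s.2 := by
  rintro ⟨s, t⟩ ⟨s', t'⟩ h
  have h1 := congrArg (Multiset.filterMap Sum.getLeft?) h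
  have h2 := congrArg (Multiset.filterMap Sum.getRight?) h
  simp only [Multiset.disjSum, Multiset.filterMap_add, Multiset.filterMap_map] at h1 h2
  simp only [Function.comp_def, Sum.getLeft?_inl, Sum.getLeft?_inr, Sum.getRight?_inl,
    Sum.getRight?_inr, Multiset.filterMap_some, filterMap_const_none, add_zero, zero_add] at h1 h2
  rw [h1, h2]
end polynomial

/-! ### Jets of products with powers of a scalar function -/

section powers
open TopologicalSpace
variable {𝕜 : Type*} [RCLike 𝕜] {E : Type*} [NormedAddCommGroup E] [NormedSpace 𝕜 E]
  [CompleteSpace E]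
  {G : Type*} [TopologicalSpace G] [ChartedSpace E G] [Group G] [LieGroup 𝓘(𝕜, E) ∞ G]
  {F : Type*} [NormedAddCommGroup F] [NormedSpace 𝕜 F] {O : Opens G}

/-- The product of a scalar function and a vector valued function. -/
def smoothFnSmul (c : smoothFn 𝕜 E 𝕜 O) (f : smoothFn 𝕜 E F O) : smoothFn 𝕜 E F O :=
  ⟨fun g => (c : G → 𝕜) g • (f : G → F) g, c.2.1.smul f.2.1, fun g hg => by simp [f.2.2 g hg]⟩

theorem rightDeriv_pow {h : G → 𝕜} {g : G} (hh : MDifferentiableAt 𝓘(𝕜, E) 𝓘(𝕜, 𝕜) h g)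
    (X : LieAlg 𝕜 E G) (m : ℕ) :
    MDifferentiableAt 𝓘(𝕜, E) 𝓘(𝕜, 𝕜) (fun k => h k ^ (m + 1)) g ∧
      rightDeriv X (fun k => h k ^ (m + 1)) g = (m + 1) * h g ^ m * rightDeriv X h g := by
  induction m with
  | zero => simpa using hh
  | succ m ih =>
    have h1 : (fun k => h k ^ (m + 1 + 1)) = fun k => h k • h k ^ (m + 1) := by
      funext k
      rw [smul_eq_mul, pow_succ']
    rw [h1]
    refine ⟨hh.smul ih.1, ?_⟩
    rw [rightDeriv_smul X hh ih.1, ih.2]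
    push_cast
    simp only [smul_eq_mul]
    ring

/-- Leibniz rule for the product of a high power of `h` with `f`. -/
theorem exists_evalJet_pow {h : smoothFn 𝕜 E 𝕜 O} {g₀ : G} (hg₀ : g₀ ∈ O)
    (h0 : (h : G → 𝕜) g₀ = 0) {d : ℕ} (x : Fin d → LieAlg 𝕜 E G) (l : List (Fin d)) (m : ℕ)
    (f f' : smoothFn 𝕜 E F O)
    (hf : ∀ k ∈ O, (f' : G → F) k = (h : G → 𝕜) k ^ (l.length + m) • (f : G → F) k) :
    ∃ f'' : smoothFn 𝕜 E F O,
      (∀ k ∈ O, evalJet f' k (envWord x l) = (h : G → 𝕜) k ^ m • (f'' : G → F) k) ∧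
      (f'' : G → F) g₀ = (((l.length + m).descFactorial l.length : 𝕜) *
        (l.map fun i => rightDeriv (x i) (h : G → 𝕜) g₀).prod) • (f : G → F) g₀ := by
  induction l generalizing m with
  | nil =>
    refine ⟨f, fun k hk => ?_, by simp⟩
    simpa [envWord, evalJet_one] using hf k hk
  | cons i l ih =>
    obtain ⟨q, hq, hq0⟩ := ih (m + 1) (fun k hk => by
      rw [hf k hk, List.length_cons, add_right_comm, add_assoc])
    -- The tail of the word acts first and leaves `h^(m+1) q`. Then `r(x_i)(h^(m+1) q) = h^m ((m+1)
    -- (r(x_i) h) q + h r(x_i) q)`.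
    refine ⟨((m + 1 : ℕ) : 𝕜) • smoothFnSmul (rightLin O (x i) h) q +
      smoothFnSmul h (rightLin O (x i) q), fun k hk => ?_, ?_⟩
    · have h1 := smoothFn_mdifferentiableAt h hk
      have h2 := rightDeriv_pow h1 (x i) m
      rw [envWord_cons, evalJet_ι_mul f' hk, rightDeriv_congr (x i) O.isOpen hq hk,
        rightDeriv_smul (x i) h2.1 (smoothFn_mdifferentiableAt q hk), h2.2]
      have h3 := rightLin_apply O (x i) h hk
      have h4 := rightLin_apply O (x i) q hk
      change _ = (h : G → 𝕜) k ^ m • (((m + 1 : ℕ) : 𝕜) • ((rightLin O (x i) h : G → 𝕜) k •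
        (q : G → F) k) + (h : G → 𝕜) k • (rightLin O (x i) q : G → F) k)
      rw [h3, h4, smul_add, smul_smul, smul_smul, smul_smul, add_comm]
      push_cast
      congr 2 <;> ring
    · have h3 := rightLin_apply O (x i) h hg₀
      change ((m + 1 : ℕ) : 𝕜) • ((rightLin O (x i) h : G → 𝕜) g₀ •
        (q : G → F) g₀) + (h : G → 𝕜) g₀ • (rightLin O (x i) q : G → F) g₀ = _
      -- At `g₀` the summand containing `h` drops out, and `m + 1` is the next factor of the falling
      -- factorial.
      rw [h0, zero_smul, add_zero, h3, hq0, smul_smul, smul_smul, List.length_cons,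
        Nat.descFactorial_succ, List.map_cons, List.prod_cons]
      have h4 : l.length + 1 + m - l.length = m + 1 := by omega
      have h5 : l.length + (m + 1) = l.length + 1 + m := by omega
      rw [h4, h5]
      push_cast
      congr 1
      ring

/-- Each letter lowers the exponent of `h` by at most one, so a positive power of `h` survives and
vanishes at `g₀`. -/
theorem evalJet_pow_of_card_lt {h : smoothFn 𝕜 E 𝕜 O} {g₀ : G} (hg₀ : g₀ ∈ O)
    (h0 : (h : G → 𝕜) g₀ = 0) {d : ℕ} (x : Fin d → LieAlg 𝕜 E G) (s : Multiset (Fin d)) {m : ℕ}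
    (hs : s.card < m) (f f' : smoothFn 𝕜 E F O)
    (hf : ∀ k ∈ O, (f' : G → F) k = (h : G → 𝕜) k ^ m • (f : G → F) k) :
    evalJet f' g₀ (envMono x s) = 0 := by
  obtain ⟨r, rfl⟩ := Nat.exists_eq_add_of_lt hs
  obtain ⟨f'', h1, _⟩ := exists_evalJet_pow hg₀ h0 x (s.sort (· ≤ ·)) (r + 1) f f' (fun k hk => by
    rw [hf k hk, Multiset.length_sort, add_assoc])
  rw [envMono, h1 g₀ hg₀, h0, zero_pow (Nat.succ_ne_zero r), zero_smul]

/-- Every letter must differentiate a different factor `h`, in one of `m!` ways. The resulting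
scalars commute, so only the multiset of letters matters. -/
theorem evalJet_pow_of_card_eq {h : smoothFn 𝕜 E 𝕜 O} {g₀ : G} (hg₀ : g₀ ∈ O)
    (h0 : (h : G → 𝕜) g₀ = 0) {d : ℕ} (x : Fin d → LieAlg 𝕜 E G) (s : Multiset (Fin d)) {m : ℕ}
    (hs : s.card = m) (f f' : smoothFn 𝕜 E F O)
    (hf : ∀ k ∈ O, (f' : G → F) k = (h : G → 𝕜) k ^ m • (f : G → F) k) :
    evalJet f' g₀ (envMono x s) =
      ((m.factorial : 𝕜) * (s.map fun i => rightDeriv (x i) (h : G → 𝕜) g₀).prod) •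
        (f : G → F) g₀ := by
  subst hs
  obtain ⟨f'', h1, h2⟩ := exists_evalJet_pow hg₀ h0 x (s.sort (· ≤ ·)) 0 f f' (fun k hk => by
    rw [hf k hk, Multiset.length_sort, add_zero])
  rw [envMono, h1 g₀ hg₀, h2, pow_zero, one_smul, add_zero, Nat.descFactorial_self,
    Multiset.length_sort, ← Multiset.prod_coe, ← Multiset.map_coe, Multiset.sort_eq]
end powers

/-! ### Sections over the image of a local trivialization -/

section localSections
open TopologicalSpace
variable {𝕜 : Type*} [RCLike 𝕜] {E : Type*} [NormedAddCommGroup E] [NormedSpace 𝕜 E]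
  {EP : Type*} [NormedAddCommGroup EP] [NormedSpace 𝕜 EP]
  {G : Type*} [TopologicalSpace G] [ChartedSpace E G] [Group G] [LieGroup 𝓘(𝕜, E) ∞ G]
  {P : Subgroup G} [ChartedSpace EP P] [LieGroup 𝓘(𝕜, EP) ∞ P]
  {V : Type*} [NormedAddCommGroup V] [NormedSpace 𝕜 V]
  {n : ℕ} (τ : LocalTriv 𝕜 E EP P n)

/-- The inverse of the map `(x, p) ↦ s(x) p`. -/
noncomputable def LocalTriv.coord : G → (Fin n → 𝕜) × P :=
  Function.invFunOn (fun q : (Fin n → 𝕜) × P => τ.toFun q.1 * q.2) {q | q.1 ∈ τ.domain}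

theorem LocalTriv.coord_apply {x : Fin n → 𝕜} (hx : x ∈ τ.domain) (p : P) :
    τ.coord (τ.toFun x * p) = (x, p) :=
  τ.injOn.leftInvOn_invFunOn (x := (x, p)) hx

/-- Near the given point the smooth local inverse takes values over the domain of `τ`; injectivity
of `(x, p) ↦ s(x) p` there identifies it with the chosen inverse `coord`. -/
theorem LocalTriv.eventually_coord {x : Fin n → 𝕜} (hx : x ∈ τ.domain) (p : P) :
    (∀ᶠ g in 𝓝 (τ.toFun x * p), ∃ y ∈ τ.domain, ∃ q : P, τ.toFun y * q = g) ∧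
    ContMDiffAt 𝓘(𝕜, E) (𝓘(𝕜, Fin n → 𝕜).prod 𝓘(𝕜, EP)) ∞ τ.coord (τ.toFun x * p) := by
  obtain ⟨Φ, hΦ, he⟩ := τ.isLocalDiffeomorphAt x hx p
  have h1 : Φ (x, p) = τ.toFun x * p := (he hΦ).symm
  have ht : τ.toFun x * p ∈ Φ.target := h1 ▸ Φ.map_source hΦ
  have h2 : Φ.toPartialEquiv.symm (τ.toFun x * p) = (x, p) := by
    rw [← h1]
    exact Φ.left_inv hΦ
  have hs : ContMDiffAt 𝓘(𝕜, E) (𝓘(𝕜, Fin n → 𝕜).prod 𝓘(𝕜, EP)) ∞ Φ.toPartialEquiv.symm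
      (τ.toFun x * p) := Φ.contMDiffOn_invFun.contMDiffAt (Φ.open_target.mem_nhds ht)
  have h3 : ∀ᶠ g in 𝓝 (τ.toFun x * p), (Φ.toPartialEquiv.symm g).1 ∈ τ.domain := by
    refine (continuousAt_fst.comp hs.continuousAt).preimage_mem_nhds
      (τ.domain.isOpen.mem_nhds ?_)
    rw [Function.comp_apply, h2]
    exact hx
  have h4 : ∀ᶠ g in 𝓝 (τ.toFun x * p),
      τ.toFun (Φ.toPartialEquiv.symm g).1 * (Φ.toPartialEquiv.symm g).2 = g := by
    filter_upwards [Φ.open_target.mem_nhds ht] with g hg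
    exact (he (Φ.map_target hg)).trans (Φ.right_inv hg)
  refine ⟨?_, hs.congr_of_eventuallyEq ?_⟩
  · filter_upwards [h3, h4] with g h3 h4
    exact ⟨_, h3, _, h4⟩
  · filter_upwards [h3, h4] with g h3 h4
    conv_lhs => rw [← h4, τ.coord_apply h3]

/-- The image of a local trivialization in `G ⧸ P`. -/
def LocalTriv.base : Opens (G ⧸ P) where
  carrier := {z | ∃ x ∈ τ.domain, (τ.toFun x : G ⧸ P) = z}
  is_open' := by
    refine isQuotientMap_quot_mk.isOpen_preimage.1 (isOpen_iff_mem_nhds.2 ?_)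
    rintro g ⟨x, hx, hg⟩
    have hg : (τ.toFun x : G ⧸ P) = g := hg
    obtain ⟨p, rfl⟩ : ∃ p : P, τ.toFun x * p = g :=
      ⟨⟨_, QuotientGroup.eq.1 hg⟩, by simp⟩
    filter_upwards [(τ.eventually_coord hx p).1] with g' hg'
    obtain ⟨y, hy, q, rfl⟩ := hg'
    exact ⟨y, hy, (QuotientGroup.mk_mul_of_mem _ q.2).symm⟩

theorem LocalTriv.mem_liftOpens_base {g : G} :
    g ∈ liftOpens τ.base ↔ ∃ x ∈ τ.domain, ∃ p : P, τ.toFun x * p = g := by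
  constructor
  · rintro ⟨x, hx, hg⟩
    have hg : (τ.toFun x : G ⧸ P) = g := hg
    exact ⟨x, hx, ⟨_, QuotientGroup.eq.1 hg⟩, by simp⟩
  · rintro ⟨x, hx, p, rfl⟩
    exact ⟨x, hx, (QuotientGroup.mk_mul_of_mem _ p.2).symm⟩

theorem LocalTriv.contMDiffOn_coord :
    ContMDiffOn 𝓘(𝕜, E) (𝓘(𝕜, Fin n → 𝕜).prod 𝓘(𝕜, EP)) ∞ τ.coord (liftOpens τ.base) := by
  intro g hg
  obtain ⟨x, hx, p, rfl⟩ := τ.mem_liftOpens_base.1 hg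
  exact (τ.eventually_coord hx p).2.contMDiffWithinAt

variable [CompleteSpace EP] [FiniteDimensional 𝕜 V]

/-- A representation is assumed smooth on fixed vectors only; expanding `f` in a basis reduces to
these. -/
theorem contMDiffOn_rep_inv (ρ : SmoothRep 𝕜 EP P V) {f : (Fin n → 𝕜) → V} {Ω : Set (Fin n → 𝕜)}
    (hf : ContDiffOn 𝕜 ∞ f Ω) :
    ContMDiffOn (𝓘(𝕜, Fin n → 𝕜).prod 𝓘(𝕜, EP)) 𝓘(𝕜, V) ∞
      (fun q : (Fin n → 𝕜) × P => ρ.toRep q.2⁻¹ (f q.1)) (Prod.fst ⁻¹' Ω) := by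
  let b := Module.finBasis 𝕜 V
  have h1 : (fun q : (Fin n → 𝕜) × P => ρ.toRep q.2⁻¹ (f q.1)) =
      fun q => ∑ i, b.repr (f q.1) i • ρ.toRep q.2⁻¹ (b i) := by
    funext q
    conv_lhs => rw [← b.sum_repr (f q.1)]
    simp only [map_sum, map_smul]
  rw [h1]
  refine contMDiffOn_finsetSum fun i _ => ?_
  have h2 : ContMDiffOn 𝓘(𝕜, Fin n → 𝕜) 𝓘(𝕜, 𝕜) ∞ (fun x => b.repr (f x) i) Ω := by
    rw [contMDiffOn_iff_contDiffOn]
    exact (LinearMap.toContinuousLinearMap (b.coord i)).contDiff.comp_contDiffOn hf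
  refine ContMDiffOn.smul (h2.comp contMDiffOn_fst (fun _ h => h)) ?_
  · exact ((ρ.smooth (b i)).comp (contMDiff_snd.inv)).contMDiffOn

/-- The section which a function on the domain of a local trivialization represents. -/
theorem LocalTriv.exists_section (ρ : SmoothRep 𝕜 EP P V) {f : (Fin n → 𝕜) → V}
    (hf : ContDiffOn 𝕜 ∞ f τ.domain) : ∃ φ : sections E ρ τ.base, ∀ x ∈ τ.domain, ∀ p : P,
      (φ : G → V) (τ.toFun x * p) = ρ.toRep p⁻¹ (f x) := by
  classical
  have h1 : ∀ x ∈ τ.domain, ∀ p : P, (liftOpens τ.base : Set G).indicator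
      (fun g => ρ.toRep (τ.coord g).2⁻¹ (f (τ.coord g).1)) (τ.toFun x * p) =
        ρ.toRep p⁻¹ (f x) := by
    intro x hx p
    have : τ.toFun x * p ∈ (liftOpens τ.base : Set G) := τ.mem_liftOpens_base.2 ⟨x, hx, p, rfl⟩
    rw [Set.indicator_of_mem this, τ.coord_apply hx]
  refine ⟨⟨(liftOpens τ.base : Set G).indicator
    (fun g => ρ.toRep (τ.coord g).2⁻¹ (f (τ.coord g).1)), ⟨?_, fun g hg =>
      Set.indicator_of_notMem hg _⟩, fun g p => ?_⟩, h1⟩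
  · have h3 : ∀ g ∈ liftOpens τ.base, (τ.coord g).1 ∈ τ.domain := fun g hg => by
      obtain ⟨x, hx, p, rfl⟩ := τ.mem_liftOpens_base.1 hg
      rw [τ.coord_apply hx]
      exact hx
    have h2 := (contMDiffOn_rep_inv ρ hf).comp τ.contMDiffOn_coord h3
    exact h2.congr fun g hg => Set.indicator_of_mem hg _
  · by_cases hg : g ∈ (liftOpens τ.base : Set G)
    · obtain ⟨x, hx, q, rfl⟩ := τ.mem_liftOpens_base.1 hg
      have h2 := h1 x hx (q * p)
      rw [Subgroup.coe_mul, ← mul_assoc] at h2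
      rw [h2, h1 x hx]
      simp
    · have hg' : g * p ∉ (liftOpens τ.base : Set G) := fun h => hg (by
        simpa using mul_mem_liftOpens h p⁻¹)
      rw [Set.indicator_of_notMem hg, Set.indicator_of_notMem hg', map_zero]
end localSections

/-! ### Test sections and injectivity -/

section injectivity
open TopologicalSpace
variable {𝕜 : Type*} [RCLike 𝕜] {E : Type*} [NormedAddCommGroup E] [NormedSpace 𝕜 E]
  [CompleteSpace E] {EP : Type*} [NormedAddCommGroup EP] [NormedSpace 𝕜 EP] [CompleteSpace EP]
  {G : Type*} [TopologicalSpace G] [ChartedSpace E G] [Group G] [LieGroup 𝓘(𝕜, E) ∞ G]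
  {P : Subgroup G} [ChartedSpace EP P] [LieGroup 𝓘(𝕜, EP) ∞ P]
  {V : Type*} [NormedAddCommGroup V] [NormedSpace 𝕜 V] [FiniteDimensional 𝕜 V]
  {W : Type*} [NormedAddCommGroup W] [NormedSpace 𝕜 W] [FiniteDimensional 𝕜 W]
  {U : Type*} [NormedAddCommGroup U] [NormedSpace 𝕜 U] [FiniteDimensional 𝕜 U]
  {n : ℕ} (τ : LocalTriv 𝕜 E EP P n)

variable (𝕜 EP P) in
/-- The trivial representation on the scalars. -/
noncomputable def trivialRep : SmoothRep 𝕜 EP P 𝕜 where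
  toRep := 1
  smooth _ := contMDiff_const

/-- The left invariant vector fields `X_i` with `X_i(1) = ∂s/∂x_i(0)`. -/
noncomputable def LocalTriv.coordVec (i : Fin n) : LieAlg 𝕜 E G :=
  τ.logDeriv 0 (Pi.single i 1)

/-- Invertibility of the frame at `0` says that the `coordVec i` span a complement of `𝔭`. This is
the hypothesis of `span_envMono_tmul`. -/
theorem LocalTriv.exists_sum_coordVec [hP : IsClosedLieSubgroup 𝕜 E EP P] (h0 : 0 ∈ τ.domain)
    (X : LieAlg 𝕜 E G) : ∃ (c : Fin n → 𝕜) (Y : LieAlg 𝕜 EP P),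
      X = ∑ i, c i • τ.coordVec i + homLie P.subtype hP.contMDiff_subtype Y := by
  refine ⟨((τ.frame 0).inverse (X : E)).1, ((τ.frame 0).inverse (X : E)).2, ?_⟩
  refine (τ.frame_inverse h0 X).trans (congrArg₂ (fun a b : E => a + b) ?_ rfl)
  conv_lhs => rw [pi_eq_sum_univ' ((τ.frame 0).inverse (X : E)).1, map_sum]
  simp only [map_smul]
  rfl

theorem contDiff_pairing (l : Fin n → 𝕜) : ContDiff 𝕜 ∞ fun x : Fin n → 𝕜 => ∑ i, l i * x i :=
  ContDiff.sum fun i _ => contDiff_const.mul (contDiff_apply 𝕜 𝕜 i)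

theorem fderiv_pairing (l : Fin n → 𝕜) (k : Fin n) :
    fderiv 𝕜 (fun x : Fin n → 𝕜 => ∑ i, l i * x i) 0 (Pi.single k 1) = l k := by
  let L : (Fin n → 𝕜) →L[𝕜] 𝕜 := ∑ i, l i • ContinuousLinearMap.proj i
  have h : (fun x : Fin n → 𝕜 => ∑ i, l i * x i) = L := by
    funext x
    simp [L]
  rw [h, L.fderiv]
  simp [L, Pi.single_apply]

/-- Sections with prescribed lowest order jets at the identity. -/
theorem LocalTriv.exists_testSection (ρ : SmoothRep 𝕜 EP P V) (h0 : 0 ∈ τ.domain)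
    (h1 : τ.toFun 0 = 1) (l : Fin n → 𝕜) (m : ℕ) (v : V) : ∃ φ : sections E ρ τ.base,
      ∀ s : Multiset (Fin n), (s.card < m → evalJet (sectionFn φ) 1 (envMono τ.coordVec s) = 0) ∧
        (s.card = m → evalJet (sectionFn φ) 1 (envMono τ.coordVec s) =
          ((m.factorial : 𝕜) * (s.map l).prod) • v) := by
  -- For the trivial representation sections are functions constant along `P`: here `h` is the
  -- linear form `l` in the coordinates. With `φ₀` given by the constant `v`, the test section is
  -- `h^m φ₀`.
  obtain ⟨h, hh⟩ := τ.exists_section (trivialRep 𝕜 EP P) (contDiff_pairing l).contDiffOn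
  obtain ⟨φ₀, hφ₀⟩ := τ.exists_section ρ (contDiffOn_const (c := v))
  obtain ⟨φ, hφ⟩ := τ.exists_section ρ
    (((contDiff_pairing l).pow m).contDiffOn.smul (contDiffOn_const (c := v)))
  have hm : (1 : G) ∈ liftOpens τ.base := τ.mem_liftOpens_base.2 ⟨0, h0, 1, by simp [h1]⟩
  have hh' : ∀ x ∈ τ.domain, ∀ p : P, (h : G → 𝕜) (τ.toFun x * p) = ∑ i, l i * x i := hh
  have e0 : (h : G → 𝕜) 1 = 0 := by simpa [h1] using hh' 0 h0 1
  have e1 : (φ₀ : G → V) 1 = v := by simpa [h1] using hφ₀ 0 h0 1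
  have e2 : ∀ k ∈ liftOpens τ.base,
      (sectionFn φ : G → V) k = (sectionFn h : G → 𝕜) k ^ m • (sectionFn φ₀ : G → V) k := by
    intro k hk
    obtain ⟨x, hx, p, rfl⟩ := τ.mem_liftOpens_base.1 hk
    change (φ : G → V) _ = (h : G → 𝕜) _ ^ m • (φ₀ : G → V) _
    rw [hφ x hx, hφ₀ x hx, hh' x hx]
    exact map_smul _ _ _
  have e3 : ∀ i, rightDeriv (τ.coordVec i) (h : G → 𝕜) 1 = l i := by
    intro i
    have h2 := τ.fderiv_comp h0 (f := (h : G → 𝕜)) (by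
      rw [h1]; exact smoothFn_mdifferentiableAt (sectionFn h) hm) (Pi.single i 1)
    rw [h1] at h2
    refine h2.symm.trans ((fderiv_pairing l i).symm ▸ ?_)
    refine congrArg (fun L : (Fin n → 𝕜) →L[𝕜] 𝕜 => L (Pi.single i 1))
      (Filter.EventuallyEq.fderiv_eq ?_)
    filter_upwards [τ.domain.isOpen.mem_nhds h0] with x hx
    simpa using hh' x hx 1
  refine ⟨φ, fun s => ⟨fun hs => ?_, fun hs => ?_⟩⟩
  · exact evalJet_pow_of_card_lt hm e0 τ.coordVec s hs _ _ e2
  · have h3 := evalJet_pow_of_card_eq hm e0 τ.coordVec s hs _ _ e2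
    rw [h3]
    change ((m.factorial : 𝕜) * (s.map fun i => rightDeriv (τ.coordVec i) (h : G → 𝕜) 1).prod) •
      (φ₀ : G → V) 1 = _
    simp only [e3, e1]

/-- An element which acts by zero on all pairs of sections near the identity is zero. -/
theorem LocalTriv.biVermaMk_eq_zero [hP : IsClosedLieSubgroup 𝕜 E EP P]
    (ρV : SmoothRep 𝕜 EP P V) (ρW : SmoothRep 𝕜 EP P W) (h0 : 0 ∈ τ.domain) (h1 : τ.toFun 0 = 1)
    {t : (Env 𝕜 E G ⊗[𝕜] Env 𝕜 E G) ⊗[𝕜] (V ⊗[𝕜] W →ₗ[𝕜] U)}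
    (ht : ∀ (φ : sections E ρV τ.base) (ψ : sections E ρW τ.base),
      biDiff U (sectionFn φ) (sectionFn ψ) 1 t = 0) : biVermaMk E ρV ρW t = 0 := by
  classical
  have hm : (1 : G) ∈ liftOpens τ.base := τ.mem_liftOpens_base.2 ⟨0, h0, 1, by simp [h1]⟩
  -- Modulo the relations `t` becomes a sum of ordered monomials with coefficients `c`; it remains
  -- to show that all coefficients vanish.
  obtain ⟨c, hc⟩ := span_envMono_tmul (τ.exists_sum_coordVec h0) (homAct ρV ρW U) t
  have hc' : biVermaMk E ρV ρW t = biVermaMk E ρV ρW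
      (c.sum fun s T => (envMono τ.coordVec s.1 ⊗ₜ envMono τ.coordVec s.2) ⊗ₜ T) :=
    (Submodule.Quotient.eq _).2 hc
  suffices h : c = 0 by rw [hc', h, Finsupp.sum_zero_index, map_zero]
  have hz : ∀ (φ : sections E ρV τ.base) (ψ : sections E ρW τ.base), ∑ s ∈ c.support,
      c s (evalJet (sectionFn φ) 1 (envMono τ.coordVec s.1) ⊗ₜ
        evalJet (sectionFn ψ) 1 (envMono τ.coordVec s.2)) = 0 := by
    intro φ ψ
    have h2 := biDiff_balanced (U := U) φ ψ hm (t := t - c.sum fun s T =>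
      (envMono τ.coordVec s.1 ⊗ₜ envMono τ.coordVec s.2) ⊗ₜ T) (by rw [map_sub, hc', sub_self])
    rw [map_sub, ht, zero_sub, neg_eq_zero, Finsupp.sum, map_sum] at h2
    exact h2
  by_contra hne
  -- Take a term of maximal total degree. Test sections of orders `|α|` and `|β|` annihilate every
  -- term for which one degree is smaller; by maximality only the bidegree `(|α|, |β|)` survives.
  obtain ⟨⟨α, β⟩, hαβ, hmax⟩ := c.support.exists_max_image (fun s => s.1.card + s.2.card)
    (Finsupp.support_nonempty_iff.2 hne)
  refine Finsupp.mem_support_iff.1 hαβ (TensorProduct.ext' fun v w => ?_)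
  let S := c.support.filter fun s => s.1.card = α.card ∧ s.2.card = β.card
  -- Up to the factor `|α|! |β|!` the surviving terms form a polynomial, with coefficients `c s (v ⊗
  -- w)`, in the two linear forms; `l` on the disjoint union encodes both forms at once.
  refine eq_zero_of_forall_prod_smul (R := 𝕜) S disjSum_injective
    (fun s => c s (v ⊗ₜ w)) (fun l => ?_) (α, β) (Finset.mem_filter.2 ⟨hαβ, rfl, rfl⟩)
  obtain ⟨φ, hφ⟩ := τ.exists_testSection ρV h0 h1 (fun i => l (Sum.inl i)) α.card v
  obtain ⟨ψ, hψ⟩ := τ.exists_testSection ρW h0 h1 (fun i => l (Sum.inr i)) β.card w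
  have h3 := hz φ ψ
  rw [← Finset.sum_filter_add_sum_filter_not c.support
    (fun s => s.1.card = α.card ∧ s.2.card = β.card)] at h3
  have h4 : ∑ s ∈ c.support with ¬ (s.1.card = α.card ∧ s.2.card = β.card),
      c s (evalJet (sectionFn φ) 1 (envMono τ.coordVec s.1) ⊗ₜ
        evalJet (sectionFn ψ) 1 (envMono τ.coordVec s.2)) = 0 := by
    refine Finset.sum_eq_zero fun s hs => ?_
    obtain ⟨hs1, hs2⟩ := Finset.mem_filter.1 hs
    have h5 : s.1.card + s.2.card ≤ α.card + β.card := hmax s hs1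
    rcases lt_or_ge s.1.card α.card with h6 | h6
    · rw [(hφ s.1).1 h6, TensorProduct.zero_tmul, map_zero]
    · rw [(hψ s.2).1 (by omega), TensorProduct.tmul_zero, map_zero]
  have h6 : ∀ s ∈ S, c s (evalJet (sectionFn φ) 1 (envMono τ.coordVec s.1) ⊗ₜ
        evalJet (sectionFn ψ) 1 (envMono τ.coordVec s.2)) =
      ((α.card.factorial : 𝕜) * (β.card.factorial : 𝕜)) •
        (((s.1.disjSum s.2).map l).prod • c s (v ⊗ₜ w)) := by
    intro s hs
    obtain ⟨_, hs1, hs2⟩ := Finset.mem_filter.1 hs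
    rw [(hφ s.1).2 hs1, (hψ s.2).2 hs2, TensorProduct.smul_tmul_smul, map_smul, smul_smul,
      Multiset.map_disjSum, Multiset.prod_add]
    congr 1
    ring
  rw [h4, add_zero, Finset.sum_congr rfl h6, ← Finset.smul_sum] at h3
  exact (smul_eq_zero.1 h3).resolve_left (mul_ne_zero (Nat.cast_ne_zero.2 (Nat.factorial_ne_zero _))
    (Nat.cast_ne_zero.2 (Nat.factorial_ne_zero _)))
end injectivity

/-! ### Bilinearity and dependence on jets -/

section pairing
open TopologicalSpace
variable {𝕜 : Type*} [RCLike 𝕜] {E : Type*} [NormedAddCommGroup E] [NormedSpace 𝕜 E]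
  [CompleteSpace E]
  {G : Type*} [TopologicalSpace G] [ChartedSpace E G] [Group G] [LieGroup 𝓘(𝕜, E) ∞ G]
  {V : Type*} [NormedAddCommGroup V] [NormedSpace 𝕜 V]
  {W : Type*} [NormedAddCommGroup W] [NormedSpace 𝕜 W]
  {U : Type*} [NormedAddCommGroup U] [NormedSpace 𝕜 U] {O : Opens G}

theorem biDiff_add_left (f f' : smoothFn 𝕜 E V O) (ψ : smoothFn 𝕜 E W O) (g : G) :
    biDiff U (f + f') ψ g = biDiff U f ψ g + biDiff U f' ψ g :=
  TensorProduct.ext_threefold fun u v T => by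
    simp only [LinearMap.add_apply, biDiff_tmul, map_add, Submodule.coe_add, Pi.add_apply,
      TensorProduct.add_tmul]

theorem biDiff_add_right (f : smoothFn 𝕜 E V O) (ψ ψ' : smoothFn 𝕜 E W O) (g : G) :
    biDiff U f (ψ + ψ') g = biDiff U f ψ g + biDiff U f ψ' g :=
  TensorProduct.ext_threefold fun u v T => by
    simp only [LinearMap.add_apply, biDiff_tmul, map_add, Submodule.coe_add, Pi.add_apply,
      TensorProduct.tmul_add]

theorem biDiff_smul_left (c : 𝕜) (f : smoothFn 𝕜 E V O) (ψ : smoothFn 𝕜 E W O) (g : G) :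
    biDiff U (c • f) ψ g = c • biDiff U f ψ g :=
  TensorProduct.ext_threefold fun u v T => by
    simp only [LinearMap.smul_apply, biDiff_tmul, map_smul, Submodule.coe_smul, Pi.smul_apply,
      ← TensorProduct.smul_tmul']

theorem biDiff_smul_right (c : 𝕜) (f : smoothFn 𝕜 E V O) (ψ : smoothFn 𝕜 E W O) (g : G) :
    biDiff U f (c • ψ) g = c • biDiff U f ψ g :=
  TensorProduct.ext_threefold fun u v T => by
    simp only [LinearMap.smul_apply, biDiff_tmul, map_smul, Submodule.coe_smul, Pi.smul_apply,
      TensorProduct.tmul_smul]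

theorem biDiff_congr_jets {O' : Opens G} {f : smoothFn 𝕜 E V O} {ψ : smoothFn 𝕜 E W O}
    {f' : smoothFn 𝕜 E V O'} {ψ' : smoothFn 𝕜 E W O'} {g g' : G}
    (hf : ∀ u, evalJet f g u = evalJet f' g' u) (hψ : ∀ u, evalJet ψ g u = evalJet ψ' g' u) :
    biDiff U f ψ g = biDiff U f' ψ' g' := by
  unfold biDiff
  rw [LinearMap.ext hf, LinearMap.ext hψ]
end pairing

/-! ### Invariant classes and pairings of local sections -/

section localPairing
open TopologicalSpace
variable {𝕜 : Type*} [RCLike 𝕜] {E : Type*} [NormedAddCommGroup E] [NormedSpace 𝕜 E]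
  [CompleteSpace E] {EP : Type*} [NormedAddCommGroup EP] [NormedSpace 𝕜 EP] [CompleteSpace EP]
  {G : Type*} [TopologicalSpace G] [ChartedSpace E G] [Group G] [LieGroup 𝓘(𝕜, E) ∞ G]
  {P : Subgroup G} [ChartedSpace EP P] [LieGroup 𝓘(𝕜, EP) ∞ P] [IsClosedLieSubgroup 𝕜 E EP P]
  {V : Type*} [NormedAddCommGroup V] [NormedSpace 𝕜 V] [FiniteDimensional 𝕜 V]
  {W : Type*} [NormedAddCommGroup W] [NormedSpace 𝕜 W] [FiniteDimensional 𝕜 W]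
  {U : Type*} [NormedAddCommGroup U] [NormedSpace 𝕜 U] [FiniteDimensional 𝕜 U]
  {ρV : SmoothRep 𝕜 EP P V} {ρW : SmoothRep 𝕜 EP P W} {ρU : SmoothRep 𝕜 EP P U}
  {t t' : (Env 𝕜 E G ⊗[𝕜] Env 𝕜 E G) ⊗[𝕜] (V ⊗[𝕜] W →ₗ[𝕜] U)}

theorem biDiff_eq_of_mk_eq {O : Opens (G ⧸ P)} (φ : sections E ρV O) (ψ : sections E ρW O) {g : G}
    (hg : g ∈ liftOpens O) (h : biVermaMk E ρV ρW t = biVermaMk E ρV ρW t') :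
    biDiff U (sectionFn φ) (sectionFn ψ) g t = biDiff U (sectionFn φ) (sectionFn ψ) g t' := by
  have h1 := biDiff_balanced (U := U) φ ψ hg (t := t - t') (by rw [map_sub, h, sub_self])
  rwa [map_sub, sub_eq_zero] at h1

/-- The section `g ↦ T((r(u) φ)(g) ⊗ (r(u') ψ)(g))` for a `P`-invariant class of `u ⊗ u' ⊗ T`. -/
noncomputable def biDiffSection (ht : biVermaMk E ρV ρW t ∈ biVermaInvariants E ρV ρW ρU)
    {O : Opens (G ⧸ P)} (φ : sections E ρV O) (ψ : sections E ρW O) : sections E ρU O :=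
  ⟨(liftOpens O : Set G).indicator fun g => biDiff U (sectionFn φ) (sectionFn ψ) g t,
    ⟨(biDiff_smooth _ _ t).congr fun g hg => Set.indicator_of_mem hg _,
      fun g hg => Set.indicator_of_notMem hg _⟩, fun g p => by
    by_cases hg : g ∈ (liftOpens O : Set G)
    · rw [Set.indicator_of_mem hg, Set.indicator_of_mem (mul_mem_liftOpens hg p),
        biDiff_right (ρU := ρU) φ ψ hg p t, biDiff_eq_of_mk_eq φ ψ hg
          ((biVermaAct_mk (ρU := ρU) p t).symm.trans (ht p))]
    · have hg' : g * p ∉ (liftOpens O : Set G) := fun h => hg (by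
        simpa using mul_mem_liftOpens h p⁻¹)
      rw [Set.indicator_of_notMem hg, Set.indicator_of_notMem hg', map_zero]⟩

theorem biDiffSection_apply (ht : biVermaMk E ρV ρW t ∈ biVermaInvariants E ρV ρW ρU)
    {O : Opens (G ⧸ P)} (φ : sections E ρV O) (ψ : sections E ρW O) {g : G}
    (hg : g ∈ liftOpens O) : (biDiffSection ht φ ψ : G → U) g =
      biDiff U (sectionFn φ) (sectionFn ψ) g t :=
  Set.indicator_of_mem (s := (liftOpens O : Set G)) hg
    fun g => biDiff U (sectionFn φ) (sectionFn ψ) g t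

theorem sections_ext {O : Opens (G ⧸ P)} {φ φ' : sections E ρU O}
    (h : ∀ g ∈ liftOpens O, (φ : G → U) g = (φ' : G → U) g) : φ = φ' := by
  refine Subtype.ext (funext fun g => ?_)
  by_cases hg : g ∈ liftOpens O
  · exact h g hg
  · rw [φ.2.1.2 g hg, φ'.2.1.2 g hg]

/-- The bilinear pairing of local sections given by a `P`-invariant class. -/
noncomputable def biDiffPairing (ht : biVermaMk E ρV ρW t ∈ biVermaInvariants E ρV ρW ρU) :
    LocalPairing E ρV ρW ρU := fun O =>
  LinearMap.mk₂ 𝕜 (biDiffSection ht)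
    (fun φ φ' ψ => sections_ext fun g hg => by
      rw [biDiffSection_apply ht _ _ hg]
      refine Eq.trans ?_ (congrArg₂ (· + ·) (biDiffSection_apply ht φ ψ hg)
        (biDiffSection_apply ht φ' ψ hg)).symm
      exact DFunLike.congr_fun (biDiff_add_left (sectionFn φ) (sectionFn φ') (sectionFn ψ) g) t)
    (fun c φ ψ => sections_ext fun g hg => by
      rw [biDiffSection_apply ht _ _ hg]
      refine Eq.trans ?_ (congrArg (c • ·) (biDiffSection_apply ht φ ψ hg)).symm
      exact DFunLike.congr_fun (biDiff_smul_left c (sectionFn φ) (sectionFn ψ) g) t)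
    (fun φ ψ ψ' => sections_ext fun g hg => by
      rw [biDiffSection_apply ht _ _ hg]
      refine Eq.trans ?_ (congrArg₂ (· + ·) (biDiffSection_apply ht φ ψ hg)
        (biDiffSection_apply ht φ ψ' hg)).symm
      exact DFunLike.congr_fun (biDiff_add_right (sectionFn φ) (sectionFn ψ) (sectionFn ψ') g) t)
    (fun c φ ψ => sections_ext fun g hg => by
      rw [biDiffSection_apply ht _ _ hg]
      refine Eq.trans ?_ (congrArg (c • ·) (biDiffSection_apply ht φ ψ hg)).symm
      exact DFunLike.congr_fun (biDiff_smul_right c (sectionFn φ) (sectionFn ψ) g) t)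

theorem biDiffPairing_apply (ht : biVermaMk E ρV ρW t ∈ biVermaInvariants E ρV ρW ρU)
    {O : Opens (G ⧸ P)} (φ : sections E ρV O) (ψ : sections E ρW O) {g : G}
    (hg : g ∈ liftOpens O) : (biDiffPairing ht O φ ψ : G → U) g =
      biDiff U (sectionFn φ) (sectionFn ψ) g t :=
  biDiffSection_apply ht φ ψ hg

theorem inv_mul_mem_liftOpens {g h : G} {O : Opens (G ⧸ P)}
    (hh : h ∈ liftOpens (translateOpens 𝕜 E g O)) : g⁻¹ * h ∈ liftOpens O := hh

/-- Left invariant operators commute with `l_g`. Thus `G`-invariance holds for every `t`; invariance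
of the class is needed only for the values to be sections. -/
theorem biDiff_translate (g : G) {O : Opens (G ⧸ P)} (φ : sections E ρV O) (ψ : sections E ρW O)
    {h : G} (hh : g⁻¹ * h ∈ liftOpens O) :
    biDiff U (sectionFn (translateSection g φ)) (sectionFn (translateSection g ψ)) h =
      biDiff U (sectionFn φ) (sectionFn ψ) (g⁻¹ * h) :=
  biDiff_congr_jets
    (fun u => (evalJet_translate (O' := liftOpens (translateOpens 𝕜 E g O)) g⁻¹
      (fun _ h => h) _ _ (fun _ _ => rfl) hh u).symm)
    (fun u => (evalJet_translate (O' := liftOpens (translateOpens 𝕜 E g O)) g⁻¹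
      (fun _ h => h) _ _ (fun _ _ => rfl) hh u).symm)

theorem restrictSection_apply {O O' : Opens (G ⧸ P)} (h : O' ≤ O) (φ : sections E ρU O) {g : G}
    (hg : g ∈ liftOpens O') : (restrictSection h φ : G → U) g = (φ : G → U) g :=
  Set.indicator_of_mem (s := (liftOpens O' : Set G)) hg (φ : G → U)

theorem evalJet_restrict {O O' : Opens (G ⧸ P)} (h : O' ≤ O) (φ : sections E ρU O) {g : G}
    (hg : g ∈ liftOpens O') (u : Env 𝕜 E G) :
    evalJet (sectionFn (restrictSection h φ)) g u = evalJet (sectionFn φ) g u :=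
  (evalJet_congr (O := liftOpens O) (O' := liftOpens O') (fun _ hk => h hk) (sectionFn φ)
    (sectionFn (restrictSection h φ)) (fun _ hk => (restrictSection_apply h φ hk).symm) hg u).symm

theorem isNaturalPairing_biDiffPairing
    (ht : biVermaMk E ρV ρW t ∈ biVermaInvariants E ρV ρW ρU) :
    IsNaturalPairing (biDiffPairing ht) := fun O O' h φ ψ => sections_ext fun g hg => by
  rw [restrictSection_apply h _ hg, biDiffPairing_apply ht _ _ hg,
    biDiffPairing_apply ht _ _ (O := O) (h hg)]
  exact DFunLike.congr_fun (biDiff_congr_jets (evalJet_restrict h φ hg)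
    (evalJet_restrict h ψ hg)) t

theorem biDiffPairing_mem [FiniteDimensional 𝕜 EP]
    (ht : biVermaMk E ρV ρW t ∈ biVermaInvariants E ρV ρW ρU) :
    biDiffPairing ht ∈ invariantPairings E ρV ρW ρU := by
  refine ⟨isNaturalPairing_biDiffPairing ht, fun n τ => ?_,
    fun g O φ ψ => sections_ext fun k hk => ?_⟩
  · obtain ⟨a, ha, ha'⟩ := τ.exists_coeffs_biDiff ρV ρW t
    exact ⟨a, ha, fun O φ ψ x hx hxO => (biDiffPairing_apply ht φ ψ hxO).trans
      (ha' O φ ψ x hx hxO)⟩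
  · refine (biDiffPairing_apply ht _ _ hk).trans (Eq.trans ?_
      (biDiffPairing_apply ht φ ψ (inv_mul_mem_liftOpens hk)).symm)
    rw [biDiff_translate g φ ψ (inv_mul_mem_liftOpens hk)]

theorem exists_biVermaMk_eq (m : biVermaInvariants E ρV ρW ρU) :
    ∃ t : (Env 𝕜 E G ⊗[𝕜] Env 𝕜 E G) ⊗[𝕜] (V ⊗[𝕜] W →ₗ[𝕜] U),
      biVermaMk E ρV ρW t = m :=
  Submodule.mkQ_surjective _ _

/-- A representative of a `P`-invariant class. -/
noncomputable def biVermaRepr (m : biVermaInvariants E ρV ρW ρU) :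
    (Env 𝕜 E G ⊗[𝕜] Env 𝕜 E G) ⊗[𝕜] (V ⊗[𝕜] W →ₗ[𝕜] U) :=
  (exists_biVermaMk_eq m).choose

theorem biVermaMk_repr (m : biVermaInvariants E ρV ρW ρU) :
    biVermaMk E ρV ρW (biVermaRepr m) = m :=
  (exists_biVermaMk_eq m).choose_spec

theorem biVermaMk_repr_mem (m : biVermaInvariants E ρV ρW ρU) :
    biVermaMk E ρV ρW (biVermaRepr m) ∈ biVermaInvariants E ρV ρW ρU :=
  (biVermaMk_repr m).symm ▸ m.2

variable (E ρV ρW ρU) in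
/-- The map from `P`-invariant classes to pairings of local sections. -/
noncomputable def invariantToPairing : biVermaInvariants E ρV ρW ρU →ₗ[𝕜] LocalPairing E ρV ρW ρU where
  toFun m := biDiffPairing (biVermaMk_repr_mem m)
  map_add' m m' := by
    funext O
    refine LinearMap.ext₂ fun φ ψ => sections_ext fun g hg => ?_
    rw [biDiffPairing_apply _ _ _ hg]
    refine Eq.trans ?_ (congrArg₂ (· + ·) (biDiffPairing_apply (biVermaMk_repr_mem m) φ ψ hg)
      (biDiffPairing_apply (biVermaMk_repr_mem m') φ ψ hg)).symm
    refine Eq.trans ?_ (map_add (biDiff U (sectionFn φ) (sectionFn ψ) g) _ _)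
    refine biDiff_eq_of_mk_eq φ ψ hg ?_
    rw [map_add, biVermaMk_repr, biVermaMk_repr, biVermaMk_repr, Submodule.coe_add]
  map_smul' c m := by
    funext O
    refine LinearMap.ext₂ fun φ ψ => sections_ext fun g hg => ?_
    rw [biDiffPairing_apply _ _ _ hg]
    refine Eq.trans ?_ (congrArg (c • ·) (biDiffPairing_apply (biVermaMk_repr_mem m) φ ψ hg)).symm
    refine Eq.trans ?_ (map_smul (biDiff U (sectionFn φ) (sectionFn ψ) g) _ _)
    refine biDiff_eq_of_mk_eq φ ψ hg ?_
    rw [map_smul, biVermaMk_repr, biVermaMk_repr, Submodule.coe_smul]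

/-- The chosen representative may be replaced by any other one, by `biDiff_eq_of_mk_eq`. -/
theorem invariantToPairing_apply {m : biVermaInvariants E ρV ρW ρU}
    (ht : biVermaMk E ρV ρW t = m) {O : Opens (G ⧸ P)} (φ : sections E ρV O)
    (ψ : sections E ρW O) {g : G} (hg : g ∈ liftOpens O) :
    (invariantToPairing E ρV ρW ρU m O φ ψ : G → U) g =
      biDiff U (sectionFn φ) (sectionFn ψ) g t :=
  (biDiffPairing_apply (biVermaMk_repr_mem m) φ ψ hg).trans
    (biDiff_eq_of_mk_eq φ ψ hg ((biVermaMk_repr m).trans ht.symm))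

theorem LocalTriv.one_mem {n : ℕ} (τ : LocalTriv 𝕜 E EP P n) (h0 : 0 ∈ τ.domain)
    (h1 : τ.toFun 0 = 1) : (1 : G) ∈ liftOpens τ.base :=
  τ.mem_liftOpens_base.2 ⟨0, h0, 1, by simp [h1]⟩

/-- A class is `P`-invariant if it maps pairs of sections to equivariant functions. -/
theorem LocalTriv.biVermaMk_mem_invariants {n : ℕ} (τ : LocalTriv 𝕜 E EP P n) (h0 : 0 ∈ τ.domain)
    (h1 : τ.toFun 0 = 1)
    (ht : ∀ (φ : sections E ρV τ.base) (ψ : sections E ρW τ.base) (p : P),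
      biDiff U (sectionFn φ) (sectionFn ψ) p t =
        ρU.toRep p⁻¹ (biDiff U (sectionFn φ) (sectionFn ψ) 1 t)) :
    biVermaMk E ρV ρW t ∈ biVermaInvariants E ρV ρW ρU := by
  intro p
  rw [biVermaAct_mk, ← sub_eq_zero, ← map_sub]
  -- It suffices that `p.t` and `t` have the same values at `1`; this is the assumed equivariance
  -- compared with `biDiff_right`.
  refine τ.biVermaMk_eq_zero ρV ρW h0 h1 fun φ ψ => ?_
  have h2 := biDiff_right (ρU := ρU) φ ψ (τ.one_mem h0 h1) p t
  rw [one_mul, ht φ ψ p] at h2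
  have h3 := congrArg (ρU.toRep p) h2
  simp only [Representation.self_inv_apply] at h3
  rw [map_sub, h3, sub_self]

variable (E ρV ρW ρU) in
/-- The isomorphism from `P`-invariant classes onto invariant bilinear differential pairings. -/
theorem exists_localEquiv [FiniteDimensional 𝕜 E] [FiniteDimensional 𝕜 EP] :
    ∃ Φ : biVermaInvariants E ρV ρW ρU ≃ₗ[𝕜] invariantPairings E ρV ρW ρU,
      ∀ m, (Φ m : LocalPairing E ρV ρW ρU) = invariantToPairing E ρV ρW ρU m := by
  obtain ⟨n, τ, h0, h1⟩ := exists_localTriv (𝕜 := 𝕜) (E := E) (EP := EP) (P := P)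
  let L := (invariantToPairing E ρV ρW ρU).codRestrict (invariantPairings E ρV ρW ρU)
    fun m => biDiffPairing_mem (biVermaMk_repr_mem m)
  refine ⟨LinearEquiv.ofBijective L ⟨?_, ?_⟩, fun m => rfl⟩
  · rw [injective_iff_map_eq_zero]
    intro m hm
    obtain ⟨t, ht⟩ := exists_biVermaMk_eq m
    refine Subtype.ext (ht.symm.trans (τ.biVermaMk_eq_zero ρV ρW h0 h1 fun φ ψ => ?_))
    rw [← invariantToPairing_apply ht φ ψ (τ.one_mem h0 h1)]
    have h2 : invariantToPairing E ρV ρW ρU m = 0 := congrArg Subtype.val hm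
    rw [h2]
    rfl
  · rintro ⟨B, hnat, hdiff, hinv⟩
    obtain ⟨a, -, ha⟩ := hdiff n τ
    -- At `s(0) = 1` the pairing is described by some `t`. By invariance, its value at `g` is its
    -- value at `1` on the translates by `g⁻¹`, so the same `t` works everywhere.
    obtain ⟨t, ht⟩ := τ.exists_biDiff_eq_eval (E := E) a h0
    have hB : ∀ (O : Opens (G ⧸ P)) (φ : sections E ρV O) (ψ : sections E ρW O) (g : G),
        g ∈ liftOpens O → (B O φ ψ : G → U) g = biDiff U (sectionFn φ) (sectionFn ψ) g t := by
      intro O φ ψ g hg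
      have hg' : g⁻¹⁻¹ * 1 = g := by simp
      have h2 : τ.toFun 0 ∈ liftOpens (translateOpens 𝕜 E g⁻¹ O) := by
        rw [h1]
        change g⁻¹⁻¹ * 1 ∈ liftOpens O
        rwa [hg']
      have h3 := (ha _ (translateSection g⁻¹ φ) (translateSection g⁻¹ ψ) 0 h0 h2).trans
        (ht _ (sectionFn (translateSection g⁻¹ φ)) (sectionFn (translateSection g⁻¹ ψ)) h2)
      rw [hinv, h1, biDiff_translate g⁻¹ φ ψ (hg'.symm ▸ hg)] at h3
      change (B O φ ψ : G → U) (g⁻¹⁻¹ * 1) = _ at h3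
      rwa [hg'] at h3
    -- The choice of `t` depends on a trivialization, but the values of `B` are sections of the
    -- third bundle; their equivariance forces the class of `t` to be `P`-invariant.
    have hm : biVermaMk E ρV ρW t ∈ biVermaInvariants E ρV ρW ρU := by
      refine τ.biVermaMk_mem_invariants h0 h1 fun φ ψ p => ?_
      have h1m := τ.one_mem h0 h1
      have h2 := (B τ.base φ ψ).2.2 1 p
      rw [one_mul] at h2
      rw [← hB _ φ ψ _ h1m, ← h2, hB _ φ ψ _ (by simpa using mul_mem_liftOpens h1m p)]
    refine ⟨⟨_, hm⟩, Subtype.ext ?_⟩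
    funext O
    refine LinearMap.ext₂ fun φ ψ => sections_ext fun g hg => ?_
    rw [hB O φ ψ g hg]
    exact invariantToPairing_apply rfl φ ψ hg
end localPairing

/-! ### Bump functions over scalars with zero imaginary part -/

section bump
variable {𝕜 : Type*} [RCLike 𝕜]

theorem ofReal_re_of_im_eq_zero (h𝕜 : ∀ z : 𝕜, RCLike.im z = 0) (z : 𝕜) :
    ((RCLike.re z : ℝ) : 𝕜) = z := by
  conv_rhs => rw [← RCLike.re_add_im z, h𝕜 z]
  simp

/-- When all imaginary parts vanish, `re` preserves norms and is inverse to the coercion from `ℝ`,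
so the little-o estimate for `φ` carries over. -/
theorem hasDerivAt_ofReal_comp_re (h𝕜 : ∀ z : 𝕜, RCLike.im z = 0) {φ : ℝ → ℝ} {φ' : ℝ} {z : 𝕜}
    (h : HasDerivAt φ φ' (RCLike.re z)) :
    HasDerivAt (fun w : 𝕜 => ((φ (RCLike.re w) : ℝ) : 𝕜)) (φ' : 𝕜) z := by
  rw [hasDerivAt_iff_isLittleO] at h ⊢
  have h1 := h.comp_tendsto (RCLike.continuous_re (K := 𝕜)).continuousAt.tendsto
  rw [← Asymptotics.isLittleO_norm_norm] at h1 ⊢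
  refine h1.congr (fun w => ?_) (fun w => ?_)
  · rw [Function.comp_apply, Real.norm_eq_abs, ← RCLike.norm_ofReal (K := 𝕜)]
    simp only [smul_eq_mul, RCLike.ofReal_sub, RCLike.ofReal_mul, ofReal_re_of_im_eq_zero h𝕜]
  · rw [Function.comp_apply, ← map_sub, Real.norm_eq_abs, ← RCLike.norm_ofReal (K := 𝕜) (RCLike.re (w - z)),
      ofReal_re_of_im_eq_zero h𝕜]

/-- The derivative over `𝕜` has the same form, with `deriv φ` for `φ`; this allows induction on the
finite order `m`. -/
theorem contDiff_ofReal_comp_re (h𝕜 : ∀ z : 𝕜, RCLike.im z = 0) (m : ℕ) {φ : ℝ → ℝ}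
    (h : ContDiff ℝ ∞ φ) : ContDiff 𝕜 m fun w : 𝕜 => ((φ (RCLike.re w) : ℝ) : 𝕜) := by
  have hd : ∀ {φ : ℝ → ℝ}, ContDiff ℝ ∞ φ → ∀ z : 𝕜, HasDerivAt
      (fun w : 𝕜 => ((φ (RCLike.re w) : ℝ) : 𝕜)) ((deriv φ (RCLike.re z) : ℝ) : 𝕜) z :=
    fun h z => hasDerivAt_ofReal_comp_re h𝕜
      (h.differentiable (by decide) _).hasDerivAt
  induction m generalizing φ with
  | zero =>
    exact contDiff_zero.2 (continuous_iff_continuousAt.2 fun z => (hd h z).continuousAt)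
  | succ m ih =>
    refine (contDiff_succ_iff_deriv (n := m)).2 ⟨fun z => (hd h z).differentiableAt, by simp, ?_⟩
    have h1 : deriv (fun w : 𝕜 => ((φ (RCLike.re w) : ℝ) : 𝕜)) =
        fun w => ((deriv φ (RCLike.re w) : ℝ) : 𝕜) := funext fun z => (hd h z).deriv
    rw [h1]
    exact ih (contDiff_infty_iff_deriv.1 h).2

theorem exists_bump (h𝕜 : ∀ z : 𝕜, RCLike.im z = 0) (n : ℕ) {r : ℝ} (hr : 0 < r) :
    ∃ b : (Fin n → 𝕜) → 𝕜, ContDiff 𝕜 ∞ b ∧ (∀ x, ‖x‖ < r / 2 → b x = 1) ∧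
      ∀ x, b x ≠ 0 → ‖x‖ ≤ r := by
  let φ : ContDiffBump (0 : ℝ) := ⟨r / 2, r, by positivity, by linarith⟩
  have hn : ∀ z : 𝕜, ‖RCLike.re z‖ = ‖z‖ := fun z => by
    rw [Real.norm_eq_abs, ← RCLike.norm_ofReal (K := 𝕜), ofReal_re_of_im_eq_zero h𝕜]
  -- The norm on `Fin n → 𝕜` is the maximum norm, so a product of bumps in the single coordinates is
  -- adapted to balls.
  refine ⟨fun x => ∏ i, ((φ (RCLike.re (x i)) : ℝ) : 𝕜), ?_, fun x hx => ?_, fun x hx => ?_⟩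
  · refine contDiff_prod fun i _ => ?_
    exact (contDiff_infty.2 fun m => contDiff_ofReal_comp_re h𝕜 m φ.contDiff).comp
      (contDiff_apply 𝕜 𝕜 i)
  · refine Finset.prod_eq_one fun i _ => ?_
    have h1 : RCLike.re (x i) ∈ Metric.closedBall (0 : ℝ) φ.rIn := by
      rw [mem_closedBall_zero_iff, hn]
      exact ((norm_le_pi_norm x i).trans hx.le)
    rw [φ.one_of_mem_closedBall h1, RCLike.ofReal_one]
  · refine (pi_norm_le_iff_of_nonneg hr.le).2 fun i => ?_
    by_contra hi
    refine Finset.prod_ne_zero_iff.1 hx i (Finset.mem_univ i) ?_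
    rw [φ.zero_of_le_dist (by rw [dist_zero_right, hn]; exact (not_le.1 hi).le), RCLike.ofReal_zero]
end bump

/-! ### Extension to global sections and global pairings -/

section globalSections
open TopologicalSpace
variable {𝕜 : Type*} [RCLike 𝕜] {E : Type*} [NormedAddCommGroup E] [NormedSpace 𝕜 E]
  [CompleteSpace E] {EP : Type*} [NormedAddCommGroup EP] [NormedSpace 𝕜 EP] [CompleteSpace EP]
  {G : Type*} [TopologicalSpace G] [ChartedSpace E G] [Group G] [LieGroup 𝓘(𝕜, E) ∞ G]
  {P : Subgroup G} [ChartedSpace EP P] [LieGroup 𝓘(𝕜, EP) ∞ P] [hP : IsClosedLieSubgroup 𝕜 E EP P]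
  {V : Type*} [NormedAddCommGroup V] [NormedSpace 𝕜 V] [FiniteDimensional 𝕜 V]
  {W : Type*} [NormedAddCommGroup W] [NormedSpace 𝕜 W] [FiniteDimensional 𝕜 W]
  {U : Type*} [NormedAddCommGroup U] [NormedSpace 𝕜 U] [FiniteDimensional 𝕜 U]
  {ρV : SmoothRep 𝕜 EP P V} {ρW : SmoothRep 𝕜 EP P W} {ρU : SmoothRep 𝕜 EP P U}
  {t : (Env 𝕜 E G ⊗[𝕜] Env 𝕜 E G) ⊗[𝕜] (V ⊗[𝕜] W →ₗ[𝕜] U)}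

/-- Both functions restrict to the same function on `S`, and restriction does not change jets. -/
theorem evalJet_congr_of_eqOn {O O' : Opens G} (f : smoothFn 𝕜 E V O) (f' : smoothFn 𝕜 E V O')
    {S : Set G} (hS : IsOpen S) (hO : S ⊆ O) (hO' : S ⊆ O')
    (h : Set.EqOn (f : G → V) (f' : G → V) S) {g : G} (hg : g ∈ S) (u : Env 𝕜 E G) :
    evalJet f g u = evalJet f' g u := by
  let f₀ : smoothFn 𝕜 E V ⟨S, hS⟩ := ⟨S.indicator (f : G → V),
    (f.2.1.mono hO).congr fun g hg => Set.indicator_of_mem hg _,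
    fun g hg => Set.indicator_of_notMem hg _⟩
  rw [evalJet_congr (O' := ⟨S, hS⟩) hO f f₀ (fun k hk => (Set.indicator_of_mem hk (f : G → V)).symm)
    hg u]
  exact (evalJet_congr (O' := ⟨S, hS⟩) hO' f' f₀
    (fun k hk => (h hk).symm.trans (Set.indicator_of_mem hk (f : G → V)).symm) hg u).symm

/-- The set is `s(K) P`, a compact set times a closed one. This is where closedness of `P` is used.
-/
theorem LocalTriv.isClosed_image_mul {n : ℕ} (τ : LocalTriv 𝕜 E EP P n) {K : Set (Fin n → 𝕜)}
    (hK : IsCompact K) (hKd : K ⊆ τ.domain) :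
    IsClosed {g : G | ∃ x ∈ K, ∃ p : P, τ.toFun x * p = g} := by
  have := topologicalGroup_of_lieGroup 𝓘(𝕜, E) ∞ (G := G)
  have h1 : IsCompact (τ.toFun '' K) := hK.image_of_continuousOn (τ.contMDiffOn.continuousOn.mono hKd)
  convert hP.isClosed.mul_left_of_isCompact h1 using 1
  ext g
  simp only [Set.mem_mul, Set.mem_image, SetLike.mem_coe, Set.mem_ofPred_eq]
  constructor
  · rintro ⟨x, hx, p, rfl⟩
    exact ⟨_, ⟨x, hx, rfl⟩, p, p.2, rfl⟩
  · rintro ⟨_, ⟨x, hx, rfl⟩, p, hp, rfl⟩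
    exact ⟨x, hx, ⟨p, hp⟩, rfl⟩

/-- In the real case, germs of sections at the base point extend to global sections. -/
theorem LocalTriv.exists_global_section (h𝕜 : ∀ z : 𝕜, RCLike.im z = 0) {n : ℕ}
    (τ : LocalTriv 𝕜 E EP P n) (h0 : 0 ∈ τ.domain) (h1 : τ.toFun 0 = 1)
    (φ : sections E ρV τ.base) : ∃ φ' : sections E ρV (⊤ : Opens (G ⧸ P)),
      ∀ (p : P) (u : Env 𝕜 E G), evalJet (sectionFn φ') p u = evalJet (sectionFn φ) p u := by
  classical
  obtain ⟨ε, hε, hεd⟩ := Metric.isOpen_iff.1 τ.domain.isOpen 0 h0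
  have hKd : Metric.closedBall (0 : Fin n → 𝕜) (ε / 2) ⊆ τ.domain :=
    (Metric.closedBall_subset_ball (by linarith)).trans hεd
  -- `b` equals `1` on the open ball of radius `ε / 4` and vanishes outside the closed ball of
  -- radius `ε / 2`, which is compact and lies in the domain.
  obtain ⟨b, hb, hb1, hbs⟩ := exists_bump h𝕜 n (half_pos hε)
  have hC := τ.isClosed_image_mul (isCompact_closedBall _ _) hKd
  let f : G → V := (liftOpens τ.base : Set G).indicator fun g => b (τ.coord g).1 • (φ : G → V) g
  have hf : ∀ g ∈ liftOpens τ.base, f g = b (τ.coord g).1 • (φ : G → V) g := fun g hg =>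
    Set.indicator_of_mem (s := (liftOpens τ.base : Set G)) hg _
  have hfs : ContMDiff 𝓘(𝕜, E) 𝓘(𝕜, V) ∞ f := by
    intro g
    -- Over the closed ball `f` is locally a product of smooth functions; the complement of the
    -- closed set over the ball is open, and `f` vanishes there.
    by_cases hg : g ∈ {g : G | ∃ x ∈ Metric.closedBall (0 : Fin n → 𝕜) (ε / 2),
      ∃ p : P, τ.toFun x * p = g}
    · obtain ⟨x, hx, p, rfl⟩ := hg
      have hg : τ.toFun x * p ∈ liftOpens τ.base := τ.mem_liftOpens_base.2 ⟨x, hKd hx, p, rfl⟩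
      have h2 := (liftOpens τ.base).isOpen.mem_nhds hg
      have h3 : ContMDiffOn 𝓘(𝕜, E) 𝓘(𝕜, 𝕜) ∞ (fun g => b (τ.coord g).1) (liftOpens τ.base) :=
        (hb.contMDiff.comp contMDiff_fst).comp_contMDiffOn τ.contMDiffOn_coord
      refine ((h3.contMDiffAt h2).smul (φ.2.1.1.contMDiffAt h2)).congr_of_eventuallyEq ?_
      filter_upwards [h2] with g hg
      exact hf g hg
    · refine (contMDiffAt_const (c := (0 : V))).congr_of_eventuallyEq ?_
      filter_upwards [hC.isOpen_compl.mem_nhds hg] with k hk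
      by_cases hk' : k ∈ liftOpens τ.base
      · obtain ⟨x, hx, p, rfl⟩ := τ.mem_liftOpens_base.1 hk'
        rw [hf _ hk', τ.coord_apply hx]
        by_cases hbx : b x = 0
        · rw [hbx, zero_smul]
        · exact (hk ⟨x, mem_closedBall_zero_iff.2 (hbs x hbx), p, rfl⟩).elim
      · exact Set.indicator_of_notMem (s := (liftOpens τ.base : Set G)) hk' _
  refine ⟨⟨f, ⟨hfs.contMDiffOn, fun g hg => (hg trivial).elim⟩, fun g p => ?_⟩, fun p u => ?_⟩
  · by_cases hg : g ∈ liftOpens τ.base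
    · rw [hf _ hg, hf _ (mul_mem_liftOpens hg p), φ.2.2, map_smul]
      obtain ⟨x, hx, q, rfl⟩ := τ.mem_liftOpens_base.1 hg
      have h2 := τ.coord_apply hx (q * p)
      rw [Subgroup.coe_mul, ← mul_assoc] at h2
      rw [h2, τ.coord_apply hx]
    · have hg' : g * p ∉ liftOpens τ.base := fun h => hg (by
        simpa using mul_mem_liftOpens h p⁻¹)
      have h2 : ∀ k ∉ liftOpens τ.base, f k = 0 := fun k hk =>
        Set.indicator_of_notMem (s := (liftOpens τ.base : Set G)) hk _
      rw [h2 _ hg, h2 _ hg', map_zero]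
  -- Points near `P` have coordinates near `0`, where `b = 1`; hence `f` and `φ` agree on a
  -- neighbourhood of `P`.
  · have hS : IsOpen ((liftOpens τ.base : Set G) ∩
        τ.coord ⁻¹' (Prod.fst ⁻¹' Metric.ball (0 : Fin n → 𝕜) (ε / 2 / 2))) :=
      τ.contMDiffOn_coord.continuousOn.isOpen_inter_preimage (liftOpens τ.base).isOpen
        (Metric.isOpen_ball.preimage continuous_fst)
    have hp : τ.toFun 0 * (p : G) = p := by rw [h1, one_mul]
    refine evalJet_congr_of_eqOn (O := liftOpens (⊤ : Opens (G ⧸ P))) _ _ hS (fun _ _ => trivial) Set.inter_subset_left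
      (fun k hk => ?_) ⟨τ.mem_liftOpens_base.2 ⟨0, h0, p, hp⟩, ?_⟩ u
    · refine (hf k hk.1).trans ?_
      rw [hb1 _ (mem_ball_zero_iff.1 hk.2), one_smul]
      rfl
    · rw [← hp, Set.mem_preimage, τ.coord_apply h0]
      exact Metric.mem_ball_self (by positivity)

theorem biDiff_translateGlobal (g : G) (φ : sections E ρV (⊤ : Opens (G ⧸ P)))
    (ψ : sections E ρW (⊤ : Opens (G ⧸ P))) (h : G) :
    biDiff U (sectionFn (translateGlobal g φ)) (sectionFn (translateGlobal g ψ)) h =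
      biDiff U (sectionFn φ) (sectionFn ψ) (g⁻¹ * h) :=
  biDiff_congr_jets
    (fun u => (evalJet_translate (O := liftOpens (⊤ : Opens (G ⧸ P)))
      (O' := liftOpens (⊤ : Opens (G ⧸ P))) g⁻¹
      (fun _ _ => trivial) _ _ (fun _ _ => rfl) trivial u).symm)
    (fun u => (evalJet_translate (O := liftOpens (⊤ : Opens (G ⧸ P)))
      (O' := liftOpens (⊤ : Opens (G ⧸ P))) g⁻¹
      (fun _ _ => trivial) _ _ (fun _ _ => rfl) trivial u).symm)

variable (E ρV ρW ρU) in
/-- The map from `P`-invariant classes to pairings of global sections. -/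
noncomputable def invariantToGlobal : biVermaInvariants E ρV ρW ρU →ₗ[𝕜] GlobalPairing E ρV ρW ρU :=
  LinearMap.proj (⊤ : Opens (G ⧸ P)) ∘ₗ invariantToPairing E ρV ρW ρU

theorem invariantToGlobal_apply {m : biVermaInvariants E ρV ρW ρU}
    (ht : biVermaMk E ρV ρW t = m) (φ : sections E ρV (⊤ : Opens (G ⧸ P)))
    (ψ : sections E ρW (⊤ : Opens (G ⧸ P))) (g : G) :
    (invariantToGlobal E ρV ρW ρU m φ ψ : G → U) g =
      biDiff U (sectionFn φ) (sectionFn ψ) g t :=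
  invariantToPairing_apply ht φ ψ (O := ⊤) trivial

theorem invariantToGlobal_mem [FiniteDimensional 𝕜 EP] (m : biVermaInvariants E ρV ρW ρU) :
    invariantToGlobal E ρV ρW ρU m ∈ globalInvariantPairings E ρV ρW ρU := by
  refine ⟨fun n τ => ?_, fun g φ ψ => sections_ext fun k _ => ?_⟩
  · obtain ⟨a, ha, ha'⟩ := (biDiffPairing_mem (biVermaMk_repr_mem m)).2.1 n τ
    exact ⟨a, ha, fun φ ψ x hx => ha' ⊤ φ ψ x hx trivial⟩
  · rw [invariantToGlobal_apply (biVermaMk_repr m), biDiff_translateGlobal]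
    exact (invariantToGlobal_apply (biVermaMk_repr m) φ ψ (g⁻¹ * k)).symm

variable (E ρV ρW ρU) in
/-- In the real case, `P`-invariant classes are the same as invariant bilinear differential pairings
of global sections. -/
theorem exists_globalEquiv [FiniteDimensional 𝕜 E] [FiniteDimensional 𝕜 EP]
    (h𝕜 : ∀ z : 𝕜, RCLike.im z = 0) :
    ∃ Φ : biVermaInvariants E ρV ρW ρU ≃ₗ[𝕜] globalInvariantPairings E ρV ρW ρU,
      ∀ m, (Φ m : GlobalPairing E ρV ρW ρU) = invariantToGlobal E ρV ρW ρU m := by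
  obtain ⟨n, τ, h0, h1⟩ := exists_localTriv (𝕜 := 𝕜) (E := E) (EP := EP) (P := P)
  -- Local sections can be replaced by global ones with the same jets along all of `P`: injectivity
  -- uses the jets at `1`, and the `P`-invariance of the class compares `1` with `p`.
  have hext : ∀ (φ : sections E ρV τ.base) (ψ : sections E ρW τ.base),
      ∃ (φ' : sections E ρV (⊤ : Opens (G ⧸ P))) (ψ' : sections E ρW (⊤ : Opens (G ⧸ P))),
        ∀ p : P, biDiff U (sectionFn φ') (sectionFn ψ') p =
          biDiff U (sectionFn φ) (sectionFn ψ) p := fun φ ψ => by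
    obtain ⟨φ', hφ'⟩ := τ.exists_global_section h𝕜 h0 h1 φ
    obtain ⟨ψ', hψ'⟩ := τ.exists_global_section h𝕜 h0 h1 ψ
    exact ⟨φ', ψ', fun p => biDiff_congr_jets (hφ' p) (hψ' p)⟩
  let L := (invariantToGlobal E ρV ρW ρU).codRestrict (globalInvariantPairings E ρV ρW ρU)
    invariantToGlobal_mem
  refine ⟨LinearEquiv.ofBijective L ⟨?_, ?_⟩, fun m => rfl⟩
  · rw [injective_iff_map_eq_zero]
    intro m hm
    obtain ⟨t, ht⟩ := exists_biVermaMk_eq m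
    refine Subtype.ext (ht.symm.trans (τ.biVermaMk_eq_zero ρV ρW h0 h1 fun φ ψ => ?_))
    obtain ⟨φ', ψ', h⟩ := hext φ ψ
    have h2 : invariantToGlobal E ρV ρW ρU m = 0 := congrArg Subtype.val hm
    have h3 := invariantToGlobal_apply ht φ' ψ' 1
    rw [h2] at h3
    have h4 := h 1
    rw [Subgroup.coe_one] at h4
    rw [← h4, ← h3]
    rfl
  · rintro ⟨B, hdiff, hinv⟩
    obtain ⟨a, -, ha⟩ := hdiff n τ
    obtain ⟨t, ht⟩ := τ.exists_biDiff_eq_eval (E := E) a h0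
    have hB : ∀ (φ : sections E ρV (⊤ : Opens (G ⧸ P))) (ψ : sections E ρW (⊤ : Opens (G ⧸ P)))
        (g : G), (B φ ψ : G → U) g = biDiff U (sectionFn φ) (sectionFn ψ) g t := by
      intro φ ψ g
      have hg' : g⁻¹⁻¹ * 1 = g := by simp
      have h3 := (ha (translateGlobal g⁻¹ φ) (translateGlobal g⁻¹ ψ) 0 h0).trans
        (ht _ (sectionFn (translateGlobal g⁻¹ φ)) (sectionFn (translateGlobal g⁻¹ ψ)) trivial)
      rw [hinv, h1, biDiff_translateGlobal g⁻¹ φ ψ] at h3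
      change (B φ ψ : G → U) (g⁻¹⁻¹ * 1) = _ at h3
      rwa [hg'] at h3
    have hm : biVermaMk E ρV ρW t ∈ biVermaInvariants E ρV ρW ρU := by
      refine τ.biVermaMk_mem_invariants h0 h1 fun φ ψ p => ?_
      obtain ⟨φ', ψ', h⟩ := hext φ ψ
      have h2 := (B φ' ψ').2.2 1 p
      have h4 := h 1
      rw [Subgroup.coe_one] at h4
      rw [one_mul] at h2
      rw [← h p, ← h4, ← hB, ← hB, h2]
    refine ⟨⟨_, hm⟩, Subtype.ext (LinearMap.ext₂ fun φ ψ => sections_ext fun g _ => ?_)⟩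
    rw [hB φ ψ g]
    exact invariantToGlobal_apply rfl φ ψ g
end globalSections

end BiPairing

/-! ### The isomorphism theorem for local and global sections -/

theorem mainTheorem5 {𝕜 : Type*} [RCLike 𝕜]
    -- `G` is a real or complex Lie group, `P` a closed (complex) Lie subgroup
    {EG : Type*} [NormedAddCommGroup EG] [NormedSpace 𝕜 EG] [FiniteDimensional 𝕜 EG]
    [CompleteSpace EG]
    {EP : Type*} [NormedAddCommGroup EP] [NormedSpace 𝕜 EP] [FiniteDimensional 𝕜 EP]
    [CompleteSpace EP]
    {G : Type*} [TopologicalSpace G] [ChartedSpace EG G] [Group G] [LieGroup 𝓘(𝕜, EG) ∞ G]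
    (P : Subgroup G) [ChartedSpace EP P] [LieGroup 𝓘(𝕜, EP) ∞ P] [IsClosedLieSubgroup 𝕜 EG EP P]
    -- finite-dimensional representations of `P`, inducing the bundles on `G ⧸ P`
    {V : Type*} [NormedAddCommGroup V] [NormedSpace 𝕜 V] [FiniteDimensional 𝕜 V]
    {W : Type*} [NormedAddCommGroup W] [NormedSpace 𝕜 W] [FiniteDimensional 𝕜 W]
    {E : Type*} [NormedAddCommGroup E] [NormedSpace 𝕜 E] [FiniteDimensional 𝕜 E]
    (ρV : SmoothRep 𝕜 EP P V) (ρW : SmoothRep 𝕜 EP P W) (ρE : SmoothRep 𝕜 EP P E) :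
    -- local sections
    (∃ Φ : biVermaInvariants EG ρV ρW ρE ≃ₗ[𝕜] invariantPairings EG ρV ρW ρE,
      ∀ (t : (Env 𝕜 EG G ⊗[𝕜] Env 𝕜 EG G) ⊗[𝕜] (V ⊗[𝕜] W →ₗ[𝕜] E))
        (ht : biVermaMk EG ρV ρW t ∈ biVermaInvariants EG ρV ρW ρE)
        (O : TopologicalSpace.Opens (G ⧸ P)) (φ : sections EG ρV O) (ψ : sections EG ρW O),
        ∀ g ∈ liftOpens O, (((Φ ⟨biVermaMk EG ρV ρW t, ht⟩ : invariantPairings EG ρV ρW ρE) :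
            LocalPairing EG ρV ρW ρE) O φ ψ : G → E) g =
          biDiff E (sectionFn φ) (sectionFn ψ) g t) ∧
    -- global smooth sections, in the real case
    ((∀ z : 𝕜, RCLike.im z = 0) →
      ∃ Φ : biVermaInvariants EG ρV ρW ρE ≃ₗ[𝕜] globalInvariantPairings EG ρV ρW ρE,
        ∀ (t : (Env 𝕜 EG G ⊗[𝕜] Env 𝕜 EG G) ⊗[𝕜] (V ⊗[𝕜] W →ₗ[𝕜] E))
          (ht : biVermaMk EG ρV ρW t ∈ biVermaInvariants EG ρV ρW ρE)
          (φ : sections EG ρV (⊤ : TopologicalSpace.Opens (G ⧸ P)))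
          (ψ : sections EG ρW (⊤ : TopologicalSpace.Opens (G ⧸ P))) (g : G),
          (((Φ ⟨biVermaMk EG ρV ρW t, ht⟩ : globalInvariantPairings EG ρV ρW ρE) :
              GlobalPairing EG ρV ρW ρE) φ ψ : G → E) g =
            biDiff E (sectionFn φ) (sectionFn ψ) g t) := by
  obtain ⟨Φ, hΦ⟩ := exists_localEquiv EG ρV ρW ρE
  refine ⟨⟨Φ, fun t ht O φ ψ g hg => ?_⟩, fun h𝕜 => ?_⟩
  · rw [hΦ]
    exact invariantToPairing_apply rfl φ ψ hg
  · obtain ⟨Φ', hΦ'⟩ := exists_globalEquiv EG ρV ρW ρE h𝕜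
    refine ⟨Φ', fun t ht φ ψ g => ?_⟩
    rw [hΦ']
    exact invariantToGlobal_apply rfl φ ψ g
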